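/- Let $\mathfrak M$ be a (Hausdorff, finite-dimensional) $C^2$ manifold and let $X_1,\dots,X_q$ be $C^1$ vector fields on $\mathfrak M$. For $x\in\mathfrak M$ and $\delta>0$ let $B_X(x,\delta)$ be the set of all $y\in\mathfrak M$ for which there are a curve $\gamma:[0,1]\to\mathfrak M$ and $a_1,\dots,a_q\in L^\infty([0,1])$ with $\gamma(0)=x$, $\gamma(1)=y$, $\big\|\sum_j|a_j|^2\big\|_{L^\infty}<1$ and $\gamma'(t)=\sum_j a_j(t)\,\delta\,X_j(\gamma(t))$; the last equation means that $\gamma$ is continuous and that for every $t_0\in[0,1]$ there is a $C^2$ chart $\psi$ of $\mathfrak M$ near $\gamma(t_0)$ such that $\psi(\gamma(t))=\psi(\gamma(t_0))+\int_{t_0}^t\sum_j a_j(s)\,\delta\,(\psi_*X_j)(\psi(\gamma(s)))\,ds$ for all $t\in[0,1]$ near $t_0$. Put $\rho(x,y):=\inf\{\delta>0: y\in B_X(x,\delta)\}\in[0,\infty]$, where $\inf\emptyset=\infty$. Fix $x_0\in\mathfrak M$, let $Z:=\{y\in\mathfrak M:\rho(x_0,y)<\infty\}$ with the topology induced by $\rho$,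 and let $M\subseteq Z$ be a connected open subset of $Z$ containing $x_0$, with the subspace topology from $Z$. Suppose that for all $i,j$ there are functions $c_{i,j}^k:M\to\mathbb R$ ($1\le k\le q$), locally bounded in the topology of $M$, with $[X_i,X_j](p)=\sum_{k=1}^q c_{i,j}^k(p)X_k(p)$ for every $p\in M$. Then $M$ is Hausdorff and second countable, and there is a $C^2$ manifold structure on $M$ (of some finite dimension, compatible with its topology) such that: - the inclusion $\iota:M\hookrightarrow\mathfrak M$ is a $C^2$ injective immersion, i.e. an injective $C^2$ map with injective differential at every point; - $X_1,\dots,X_q$ are $C^1$ vector fields tangent to $M$: there are $C^1$ vector fields $Y_1,\dots,Y_q$ on $M$ with $d\iota(p)Y_j(p)=X_j(p)$ for all $p\in M$ and all $j$; - $X_1,\dots,X_q$ span the tangent space to $M$ at every point: $Y_1(p),\dots,Y_q(p)$ span $T_pM$ for every $p\in M$. Furthermore, this $C^2$ structure is unique in the following sense: if $M$ is given another $C^2$ structure (of any finite dimension, compatible with its topology) such that the inclusion $M\hookrightarrow\mathfrak M$ is a $C^2$ injective immersion, then the identity map $M\to M$ is a $C^2$ diffeomorphism between the two structures. -/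

import Mathlib

open scoped Manifold ContDiff Topology

noncomputable section

/-- A list `X_1, …, X_q` of (a priori arbitrary) vector fields on a `D`-dimensional manifold. -/
abbrev VectorFields (q D : ℕ) (𝔐 : Type*) [TopologicalSpace 𝔐]
    [ChartedSpace (EuclideanSpace ℝ (Fin D)) 𝔐] : Type _ :=
  Fin q → (x : 𝔐) → TangentSpace (𝓡 D) x

/-- A vector field on a `C^2` manifold is `C^1` when it is so as a section of the tangent bundle. -/
def IsC1VectorField {D : ℕ} {𝔐 : Type*} [TopologicalSpace 𝔐]
    [ChartedSpace (EuclideanSpace ℝ (Fin D)) 𝔐] [IsManifold (𝓡 D) 2 𝔐]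
    (V : (x : 𝔐) → TangentSpace (𝓡 D) x) : Prop :=
  ContMDiff (𝓡 D) (𝓡 D).tangent 1 (fun x => (⟨x, V x⟩ : TangentBundle (𝓡 D) 𝔐))

section CarnotCaratheodory

variable {q D : ℕ} {𝔐 : Type*} [TopologicalSpace 𝔐]
  [ChartedSpace (EuclideanSpace ℝ (Fin D)) 𝔐]

/-- The vector `(ψ_* V)(ψ(x)) = dψ(x) V(x)` of `ℝ^D`, for a chart `ψ` and a vector field `V`. -/
def chartPushforward (ψ : OpenPartialHomeomorph 𝔐 (EuclideanSpace ℝ (Fin D)))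
    (V : (x : 𝔐) → TangentSpace (𝓡 D) x) (x : 𝔐) : EuclideanSpace ℝ (Fin D) :=
  mfderiv (𝓡 D) 𝓘(ℝ, EuclideanSpace ℝ (Fin D)) ψ x (V x)

/-- `γ'(t) = ∑ j, b_j(t) X_j(γ(t))` on `[0,1]`, in the Carathéodory sense: the curve `γ` is
continuous on `[0,1]`, and every `t₀ ∈ [0,1]` has a `C^2` chart `ψ` around `γ(t₀)` such that, for
`t ∈ [0,1]` near `t₀`, `ψ(γ(t)) = ψ(γ(t₀)) + ∫_{t₀}^t ∑ j, b_j(s) (ψ_* X_j)(ψ(γ(s))) ds`.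
For measurable bounded `b_j` the integrand is bounded and measurable near `t₀`. -/
def IsControlledCurve (X : VectorFields q D 𝔐) (b : Fin q → ℝ → ℝ) (γ : ℝ → 𝔐) : Prop :=
  ContinuousOn γ (Set.Icc 0 1) ∧
  ∀ t₀ ∈ Set.Icc (0 : ℝ) 1, ∃ ψ ∈ IsManifold.maximalAtlas (𝓡 D) 2 𝔐, γ t₀ ∈ ψ.source ∧
    ∀ᶠ t in 𝓝[Set.Icc 0 1] t₀, γ t ∈ ψ.source ∧
      ψ (γ t) = ψ (γ t₀) + ∫ s in t₀..t, ∑ j, b j s • chartPushforward ψ (X j) (γ s)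

/-- The Carnot–Carathéodory ball `B_X(x, δ)`. Only the values of `γ` and `a` on `[0,1]` matter. -/
def ccBall (X : VectorFields q D 𝔐) (x : 𝔐) (δ : ℝ) : Set 𝔐 :=
  {y | ∃ (γ : ℝ → 𝔐) (a : Fin q → ℝ → ℝ), γ 0 = x ∧ γ 1 = y ∧
    (∀ j, MeasureTheory.MemLp (a j) ⊤ (MeasureTheory.volume.restrict (Set.Icc (0 : ℝ) 1))) ∧
    MeasureTheory.eLpNorm (fun t => ∑ j, |a j t| ^ 2) ⊤
      (MeasureTheory.volume.restrict (Set.Icc (0 : ℝ) 1)) < 1 ∧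
    IsControlledCurve X (fun j t => a j t * δ) γ}

/-- `ρ(x, y) = inf {δ > 0 : y ∈ B_X(x, δ)}`, which is `∞` when there is no such `δ`. -/
def ccDist (X : VectorFields q D 𝔐) (x y : 𝔐) : ENNReal :=
  ⨅ (δ : ℝ) (_ : 0 < δ) (_ : y ∈ ccBall X x δ), ENNReal.ofReal δ

/-- The set `Z` of all points at finite `ρ`-distance from `x₀`. -/
structure RhoFiniteSet (X : VectorFields q D 𝔐) (x₀ : 𝔐) where
  point : 𝔐
  finite : ccDist X x₀ point < ⊤

/-- The topology that `ρ` induces on `Z`: a set is open if it contains a `ρ`-ball of positive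
radius around each of its points. -/
instance (X : VectorFields q D 𝔐) (x₀ : 𝔐) : TopologicalSpace (RhoFiniteSet X x₀) where
  IsOpen U := ∀ z ∈ U, ∃ r : ENNReal, 0 < r ∧ ∀ w : RhoFiniteSet X x₀, ccDist X z.point w.point < r → w ∈ U
  isOpen_univ := fun _ _ => ⟨1, one_pos, fun _ _ => Set.mem_univ _⟩
  isOpen_inter := by
    rintro U V hU hV z ⟨hzU, hzV⟩
    obtain ⟨r, hr, h⟩ := hU z hzU
    obtain ⟨s, hs, h'⟩ := hV z hzV
    exact ⟨min r s, lt_min hr hs, fun w hw =>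
      ⟨h w (hw.trans_le (min_le_left _ _)), h' w (hw.trans_le (min_le_right _ _))⟩⟩
  isOpen_sUnion := by
    rintro S hS z ⟨U, hU, hz⟩
    obtain ⟨r, hr, h⟩ := hS U hU z hz
    exact ⟨r, hr, fun w hw => ⟨U, hU, h w hw⟩⟩

theorem self_mem_ccBall [IsManifold (𝓡 D) 2 𝔐] (X : VectorFields q D 𝔐) (x : 𝔐) (δ : ℝ) :
    x ∈ ccBall X x δ := by
  refine ⟨fun _ => x, fun _ _ => 0, rfl, rfl, fun j => MeasureTheory.MemLp.zero, ?_,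
    continuousOn_const, fun t₀ _ => ⟨chartAt _ x, IsManifold.chart_mem_maximalAtlas x,
      mem_chart_source _ x, Filter.Eventually.of_forall fun t => ⟨mem_chart_source _ x, ?_⟩⟩⟩
  · have h : (fun _ : ℝ => ∑ _j : Fin q, |(0 : ℝ)| ^ 2) = 0 := by ext; simp
    rw [h, MeasureTheory.eLpNorm_zero]
    exact one_pos
  · simp

theorem ccDist_self_lt_top [IsManifold (𝓡 D) 2 𝔐] (X : VectorFields q D 𝔐) (x : 𝔐) :
    ccDist X x x < ⊤ :=
  (iInf_le_of_le (1 : ℝ) (iInf_le_of_le one_pos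
    (iInf_le_of_le (self_mem_ccBall X x 1) le_rfl))).trans_lt ENNReal.ofReal_lt_top

/-- The point `x₀`, as an element of `Z`. -/
def RhoFiniteSet.base [IsManifold (𝓡 D) 2 𝔐] (X : VectorFields q D 𝔐) (x₀ : 𝔐) : RhoFiniteSet X x₀ :=
  ⟨x₀, ccDist_self_lt_top X x₀⟩

end CarnotCaratheodory

/-- A real-valued function on a topological space is locally bounded. -/
def IsLocallyBounded {N : Type*} [TopologicalSpace N] (f : N → ℝ) : Prop :=
  ∀ p, ∃ U ∈ 𝓝 p, ∃ C : ℝ, ∀ y ∈ U, |f y| ≤ C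

/-- A `C^2` atlas (of some finite dimension) on the topological space `N`, all of whose charts are
homeomorphisms between open sets for the given topology of `N`. -/
structure C2Structure (N : Type*) [TopologicalSpace N] where
  dim : ℕ
  [charted : ChartedSpace (EuclideanSpace ℝ (Fin dim)) N]
  [isManifold : IsManifold (𝓡 dim) 2 N]

namespace C2Structure

variable {N : Type*} [TopologicalSpace N]

/-- The space `N`, seen as a manifold through the `C^2` structure `S`. -/
def Carrier (_S : C2Structure N) : Type _ := N

instance (S : C2Structure N) : TopologicalSpace S.Carrier :=
  inferInstanceAs (TopologicalSpace N)

instance (S : C2Structure N) : ChartedSpace (EuclideanSpace ℝ (Fin S.dim)) S.Carrier :=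
  S.charted

instance (S : C2Structure N) : IsManifold (𝓡 S.dim) 2 S.Carrier :=
  S.isManifold

/-- A map out of `N`, seen as a map out of the manifold `S.Carrier`. -/
def lift {P : Type*} (S : C2Structure N) (f : N → P) : S.Carrier → P := f

end C2Structure

/-- A `C^2` injective immersion: an injective `C^2` map with injective differential everywhere. -/
structure IsC2InjectiveImmersion {n D : ℕ} {N 𝔐 : Type*}
    [TopologicalSpace N] [ChartedSpace (EuclideanSpace ℝ (Fin n)) N]
    [TopologicalSpace 𝔐] [ChartedSpace (EuclideanSpace ℝ (Fin D)) 𝔐] (f : N → 𝔐) : Prop where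
  injective : Function.Injective f
  contMDiff : ContMDiff (𝓡 n) (𝓡 D) 2 f
  mfderiv_injective : ∀ p, Function.Injective (mfderiv (𝓡 n) (𝓡 D) f p)

/-- The inclusion of a subset `M` of `Z` into the ambient manifold. -/
def inclusion {q D : ℕ} {𝔐 : Type*} [TopologicalSpace 𝔐]
    [ChartedSpace (EuclideanSpace ℝ (Fin D)) 𝔐] {X : VectorFields q D 𝔐} {x₀ : 𝔐}
    (M : Set (RhoFiniteSet X x₀)) : M → 𝔐 :=
  fun p => p.1.point

end

/-! `M` is a piece of a leaf of the distribution spanned by the `X_j`, and the proof is Frobenius'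
theorem with the missing regularity replaced by estimates along controlled curves. The tool is
Gronwall's inequality (`IsControlledLine.norm_le_gronwallBound`): along a curve with control of size
at most `L`, a function `F` changes at a rate at most `L * ∑ j, ‖X_j F‖`, even though the curve need
not be differentiable at every time.

Near `p ∈ M`, let `n` be the rank of the fields at `p`. In a chart, combine the fields to a frame
`V(x) : ℝ^n → ℝ^D` with `π ∘ V = id` for a fixed linear projection `π` (`exists_adaptedFrame`). The
transversal components `R_j` of the `X_j` vanish at `p`. The bracket relations turn each `X_k R_j`
into a linear expression in the `R_l` whose coefficients contain the `c_{i,j}^k` but none of their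
derivatives (`AdaptedFrame.fderiv_R_apply`), so local boundedness suffices. By Gronwall the `R_j`
stay zero along short controlled curves from `p` (`exists_forall_controlledLine_R_eq_zero`), and
where they vanish the rank is `n` and `V` is integrable.

The equation `DΘ = V(Θ)` is then solvable (`exists_frobenius_solution`), with `Θ(u)` the time-one
value of `θ' = V(θ) u`. These curves are controlled, hence remain in `M`. Conversely, short
controlled curves that start on the image of `Θ` remain on it, by Gronwall for `x - Θ(π x - π p)`.
So `Θ` parametrizes a `ρ`-open part of `M`, with inverse `π` up to a translation
(`exists_leafChart`), and `Θ` is `C^2` because `V(Θ)` is `C^1`. Each leaf chart is the restriction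
of an ambient `C^2` map, which makes the transition maps `C^2`.

Connectedness makes the rank constant. Since `ρ` pseudometrizes `Z`, the space `M` is paracompact;
being connected and locally second countable, it is second countable. For uniqueness, the identity
from another structure is `C^2` in leaf charts and has injective differential; Hausdorff dimension
forces equal dimensions, and the inverse function theorem inverts it. -/

open scoped Manifold ContDiff Topology

noncomputable section

open MeasureTheory

/-! ### Controlled curves and the pseudometric properties of `ρ` -/

section CaratheodoryCurves

variable {q D : ℕ} {𝔐 : Type*} [TopologicalSpace 𝔐]
  [ChartedSpace (EuclideanSpace ℝ (Fin D)) 𝔐]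

/-- A curve defined for all times that solves `γ' = ∑ j, b_j X_j(γ)` in the Carathéodory sense,
with a control `b` of Euclidean size at most `L`. -/
structure IsControlledLine (X : VectorFields q D 𝔐) (b : Fin q → ℝ → ℝ) (γ : ℝ → 𝔐) (L : ℝ) :
    Prop where
  continuous : Continuous γ
  measurable : ∀ j, AEStronglyMeasurable (b j) volume
  bound : ∀ᵐ t, ∑ j, b j t ^ 2 ≤ L ^ 2
  chart : ∀ t₀, ∃ ψ ∈ IsManifold.maximalAtlas (𝓡 D) 2 𝔐, γ t₀ ∈ ψ.source ∧
    ∀ᶠ t in 𝓝 t₀,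
      ψ (γ t) = ψ (γ t₀) + ∫ s in t₀..t, ∑ j, b j s • chartPushforward ψ (X j) (γ s)

/-- A controlled line that rests at `x` before time `0` and at `y` after time `1`. -/
structure IsControlledPath (X : VectorFields q D 𝔐) (b : Fin q → ℝ → ℝ) (γ : ℝ → 𝔐) (L : ℝ)
    (x y : 𝔐) : Prop extends IsControlledLine X b γ L where
  eq_left : ∀ t ≤ 0, γ t = x
  eq_right : ∀ t, 1 ≤ t → γ t = y
  control_left : ∀ t < 0, ∀ j, b j t = 0
  control_right : ∀ t, 1 < t → ∀ j, b j t = 0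

variable {X : VectorFields q D 𝔐} {b : Fin q → ℝ → ℝ} {γ : ℝ → 𝔐} {L : ℝ}

/-- Serves time reversal (`c = -1`), truncation (`0 < c ≤ 1`) and concatenation (`c > 1`). A
negative `c * L` is harmless, since only its square enters. -/
theorem IsControlledLine.comp_affine (h : IsControlledLine X b γ L) {c : ℝ} (hc : c ≠ 0) (d : ℝ) :
    IsControlledLine X (fun j t => c * b j (c * t + d)) (fun t => γ (c * t + d)) (c * L) := by
  have hq : Measure.QuasiMeasurePreserving (fun t : ℝ => c * t + d) volume volume := by
    have h1 : Measure.QuasiMeasurePreserving (fun t : ℝ => c * t) volume volume := by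
      refine ⟨by fun_prop, ?_⟩
      rw [Real.map_volume_mul_left hc]
      exact Measure.smul_absolutelyContinuous
    exact (measurePreserving_add_right volume d).quasiMeasurePreserving.comp h1
  refine ⟨h.continuous.comp (by fun_prop), fun j => ?_, ?_, fun t₀ => ?_⟩
  · exact ((h.measurable j).comp_quasiMeasurePreserving hq).const_mul c
  · filter_upwards [hq.ae h.bound] with t ht
    simp only [mul_pow, ← Finset.mul_sum]
    exact mul_le_mul_of_nonneg_left ht (sq_nonneg c)
  · obtain ⟨ψ, hψ, hs, he⟩ := h.chart (c * t₀ + d)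
    refine ⟨ψ, hψ, hs, ?_⟩
    have hcont : Filter.Tendsto (fun t : ℝ => c * t + d) (𝓝 t₀) (𝓝 (c * t₀ + d)) :=
      Continuous.tendsto (by fun_prop) t₀
    filter_upwards [hcont.eventually he] with t ht
    rw [ht, ← intervalIntegral.smul_integral_comp_mul_add, ← intervalIntegral.integral_smul]
    simp only [Finset.smul_sum, mul_smul]

/-- Stopping a controlled curve at both ends of `[0,1]`. -/
theorem IsControlledCurve.exists_path (h : IsControlledCurve X b γ)
    (hm : ∀ j, AEStronglyMeasurable (b j) (volume.restrict (Set.Icc (0 : ℝ) 1)))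
    (hb : ∀ᵐ t ∂(volume.restrict (Set.Icc (0 : ℝ) 1)), ∑ j, b j t ^ 2 ≤ L ^ 2)
    [IsManifold (𝓡 D) 2 𝔐] :
    IsControlledPath X (fun j => (Set.Icc (0 : ℝ) 1).indicator (b j))
      (fun t => γ (Set.projIcc (0 : ℝ) 1 zero_le_one t)) L (γ 0) (γ 1) := by
  have hp : ∀ t ∈ Set.Icc (0 : ℝ) 1, ((Set.projIcc (0 : ℝ) 1 zero_le_one t : Set.Icc (0:ℝ) 1) : ℝ) = t :=
    fun t ht => by rw [Set.projIcc_of_mem _ ht]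
  have hL : ∀ t ≤ (0 : ℝ), ((Set.projIcc (0 : ℝ) 1 zero_le_one t : Set.Icc (0:ℝ) 1) : ℝ) = 0 :=
    fun t ht => by rw [Set.projIcc_of_le_left _ ht]
  have hR : ∀ t, (1 : ℝ) ≤ t → ((Set.projIcc (0 : ℝ) 1 zero_le_one t : Set.Icc (0:ℝ) 1) : ℝ) = 1 :=
    fun t ht => by rw [Set.projIcc_of_right_le _ ht]
  have hcont : Continuous (fun t => γ (Set.projIcc (0 : ℝ) 1 zero_le_one t)) :=
    (continuousOn_iff_continuous_domRestrict.1 h.1).comp continuous_projIcc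
  have hzero : ∀ (ψ : OpenPartialHomeomorph 𝔐 (EuclideanSpace ℝ (Fin D))) (u v : ℝ),
      (v ≤ u ∧ u ≤ 0 ∨ 1 ≤ u ∧ u ≤ v) →
      ∫ s in u..v, ∑ j, (Set.Icc (0 : ℝ) 1).indicator (b j) s •
        chartPushforward ψ (X j) (γ (Set.projIcc (0 : ℝ) 1 zero_le_one s)) = 0 := by
    intro ψ u v huv
    -- The extended control may be nonzero at the endpoints themselves, which form a null set.
    have h0 : ∀ᵐ s : ℝ, s ∉ ({0, 1} : Set ℝ) :=
      measure_eq_zero_iff_ae_notMem.1 ((Set.toFinite ({0, 1} : Set ℝ)).measure_zero volume)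
    refine (intervalIntegral.integral_congr_ae (g := fun _ => 0) ?_).trans
      intervalIntegral.integral_zero
    filter_upwards [h0] with s hs hsu
    refine Finset.sum_eq_zero fun j _ => ?_
    rw [Set.indicator_of_notMem, zero_smul]
    simp only [Set.mem_insert_iff, Set.mem_singleton_iff, not_or] at hs
    rintro ⟨h1, h2⟩
    rcases huv with ⟨h3, h4⟩ | ⟨h3, h4⟩
    · rw [Set.uIoc_of_ge h3] at hsu
      exact hs.1 (le_antisymm (hsu.2.trans h4) h1)
    · rw [Set.uIoc_of_le h4] at hsu
      linarith [hsu.1]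
  refine ⟨⟨hcont, fun j => ?_, ?_, fun t₀ => ?_⟩, fun t ht => ?_, fun t ht => ?_, fun t ht j => ?_,
    fun t ht j => ?_⟩
  · exact (aestronglyMeasurable_indicator_iff measurableSet_Icc).2 (hm j)
  · rw [ae_restrict_iff' measurableSet_Icc] at hb
    filter_upwards [hb] with t ht
    by_cases htI : t ∈ Set.Icc (0 : ℝ) 1
    · simpa [Set.indicator_of_mem htI] using ht htI
    · simpa [Set.indicator_of_notMem htI] using sq_nonneg L
  · rcases lt_or_ge t₀ 0 with h0 | h0
    · refine ⟨chartAt _ _, IsManifold.chart_mem_maximalAtlas (γ 0), ?_, ?_⟩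
      · simpa only [hL t₀ h0.le] using mem_chart_source _ (γ 0)
      · filter_upwards [Iio_mem_nhds h0] with t ht
        rw [intervalIntegral.integral_congr (g := fun _ => 0)]
        · simp [hL t₀ h0.le, hL t (le_of_lt ht)]
        · intro s hs
          refine Finset.sum_eq_zero fun j _ => ?_
          rw [Set.indicator_of_notMem, zero_smul]
          exact fun hh => absurd hh.1 (not_le.2 (hs.2.trans_lt (max_lt h0 ht)))
    rcases lt_or_ge 1 t₀ with h1 | h1
    · refine ⟨chartAt _ _, IsManifold.chart_mem_maximalAtlas (γ 1), ?_, ?_⟩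
      · simpa only [hR t₀ h1.le] using mem_chart_source _ (γ 1)
      · filter_upwards [Ioi_mem_nhds h1] with t ht
        rw [intervalIntegral.integral_congr (g := fun _ => 0)]
        · simp [hR t₀ h1.le, hR t (le_of_lt ht)]
        · intro s hs
          refine Finset.sum_eq_zero fun j _ => ?_
          rw [Set.indicator_of_notMem, zero_smul]
          exact fun hh => absurd hh.2 (not_le.2 ((lt_min h1 ht).trans_le hs.1))
    obtain ⟨ψ, hψ, hs, he⟩ := h.2 t₀ ⟨h0, h1⟩
    refine ⟨ψ, hψ, by simpa only [hp t₀ ⟨h0, h1⟩] using hs, ?_⟩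
    rw [eventually_nhdsWithin_iff] at he
    have hneg : ∀ᶠ t in 𝓝 t₀, t < 0 → t₀ = 0 := by
      rcases h0.eq_or_lt with h0 | h0
      · exact Filter.Eventually.of_forall fun _ _ => h0.symm
      · filter_upwards [Ioi_mem_nhds h0] with t ht ht'
        exact absurd ht' (not_lt.2 (le_of_lt ht))
    have hpos : ∀ᶠ t in 𝓝 t₀, 1 < t → t₀ = 1 := by
      rcases h1.eq_or_lt with h1 | h1
      · exact Filter.Eventually.of_forall fun _ _ => h1
      · filter_upwards [Iio_mem_nhds h1] with t ht ht'
        exact absurd ht' (not_lt.2 (le_of_lt ht))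
    filter_upwards [he, hneg, hpos] with t ht ht0 ht1
    by_cases htI : t ∈ Set.Icc (0 : ℝ) 1
    · simp only [hp t₀ ⟨h0, h1⟩, hp t htI]
      rw [(ht htI).2]
      congr 1
      refine intervalIntegral.integral_congr fun s hs => ?_
      have hsI : s ∈ Set.Icc (0 : ℝ) 1 :=
        ⟨(le_min h0 htI.1).trans hs.1, hs.2.trans (max_le h1 htI.2)⟩
      simp only [Set.indicator_of_mem hsI, hp s hsI]
    · rcases lt_or_ge t 0 with h2 | h2
      · obtain rfl := ht0 h2
        rw [hzero ψ _ _ (Or.inl ⟨h2.le, le_rfl⟩), hL t h2.le, hL 0 le_rfl, add_zero]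
      · have h3 : 1 < t := not_le.1 fun h3 => htI ⟨h2, h3⟩
        obtain rfl := ht1 h3
        rw [hzero ψ _ _ (Or.inr ⟨le_rfl, h3.le⟩), hR t h3.le, hR 1 le_rfl, add_zero]
  · simp only [hL t ht]
  · simp only [hR t ht]
  · exact Set.indicator_of_notMem (fun hh => absurd hh.1 (not_le.2 ht)) _
  · exact Set.indicator_of_notMem (fun hh => absurd hh.2 (not_le.2 ht)) _

theorem IsControlledLine.isControlledCurve (h : IsControlledLine X b γ L) :
    IsControlledCurve X b γ := by
  refine ⟨h.continuous.continuousOn, fun t₀ _ => ?_⟩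
  obtain ⟨ψ, hψ, hs, he⟩ := h.chart t₀
  refine ⟨ψ, hψ, hs, ?_⟩
  apply Filter.Eventually.filter_mono nhdsWithin_le_nhds
  filter_upwards [he, h.continuous.continuousAt.preimage_mem_nhds (ψ.open_source.mem_nhds hs)]
    with t h1 h2 using ⟨h2, h1⟩

/-- The essential supremum in the ball is strictly below 1, so `δ` times its square root is a speed
strictly below `δ`. -/
theorem exists_controlledPath_of_mem_ccBall [IsManifold (𝓡 D) 2 𝔐] {x y : 𝔐} {δ : ℝ} (hδ : 0 < δ)
    (h : y ∈ ccBall X x δ) :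
    ∃ L, 0 ≤ L ∧ L < δ ∧ ∃ b γ, IsControlledPath X b γ L x y := by
  obtain ⟨γ, a, rfl, rfl, hm, hlt, hγ⟩ := h
  set e := eLpNorm (fun t => ∑ j, |a j t| ^ 2) ⊤ (volume.restrict (Set.Icc (0 : ℝ) 1)) with he
  have he1 : e.toReal < 1 := by
    simpa using (ENNReal.toReal_lt_toReal hlt.ne_top ENNReal.one_ne_top).2 hlt
  refine ⟨δ * √e.toReal, by positivity, ?_, _, _,
    hγ.exists_path (L := δ * √e.toReal) (fun j => ?_) ?_⟩
  · have : √e.toReal < 1 := by rw [Real.sqrt_lt' one_pos]; simpa using he1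
    nlinarith
  · exact (hm j).1.mul_const δ
  · have := ae_le_eLpNormEssSup (f := fun t => ∑ j, |a j t| ^ 2)
      (μ := volume.restrict (Set.Icc (0 : ℝ) 1))
    rw [← eLpNorm_exponent_top, ← he] at this
    filter_upwards [this] with t ht
    have h1 : ∑ j, |a j t| ^ 2 ≤ e.toReal := by
      have h2 := ENNReal.toReal_mono hlt.ne_top ht
      rw [toReal_enorm] at h2
      exact (le_abs_self _).trans h2
    have h3 : ∑ j, (a j t * δ) ^ 2 = (∑ j, |a j t| ^ 2) * δ ^ 2 := by
      simp only [mul_pow, sq_abs, Finset.sum_mul]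
    rw [h3, mul_pow, Real.sq_sqrt ENNReal.toReal_nonneg, mul_comm]
    gcongr

theorem IsControlledLine.mem_ccBall (h : IsControlledLine X b γ L) {δ : ℝ} (hL : 0 ≤ L)
    (hδ : L < δ) : γ 1 ∈ ccBall X (γ 0) δ := by
  have hδ0 : 0 < δ := hL.trans_lt hδ
  have hbd : ∀ᵐ t ∂(volume.restrict (Set.Icc (0 : ℝ) 1)),
      ∑ j, |b j t / δ| ^ 2 ≤ (L / δ) ^ 2 := by
    apply ae_restrict_of_ae
    filter_upwards [h.bound] with t ht
    simp only [sq_abs, div_pow, ← Finset.sum_div]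
    gcongr
  refine ⟨γ, fun j t => b j t / δ, rfl, rfl, fun j => ?_, ?_, ?_⟩
  · refine memLp_top_of_bound ((h.measurable j).restrict.mul_const _) (L / δ) ?_
    filter_upwards [hbd] with t ht
    refine abs_le_of_sq_le_sq ?_ (by positivity)
    rw [← sq_abs]
    exact (Finset.single_le_sum (f := fun j => |b j t / δ| ^ 2) (fun i _ => by positivity)
      (Finset.mem_univ j)).trans ht
  · refine lt_of_le_of_lt (eLpNorm_le_of_ae_bound (C := (L / δ) ^ 2) ?_) ?_
    · filter_upwards [hbd] with t ht
      rwa [Real.norm_of_nonneg (Finset.sum_nonneg fun i _ => by positivity)]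
    · simp only [ENNReal.toReal_top, inv_zero, ENNReal.rpow_zero, one_mul]
      rw [← ENNReal.ofReal_one]
      refine (ENNReal.ofReal_lt_ofReal_iff one_pos).2 ?_
      have : L / δ < 1 := (div_lt_one hδ0).2 hδ
      have : 0 ≤ L / δ := by positivity
      nlinarith
  · simpa only [div_mul_cancel₀ _ hδ0.ne'] using h.isControlledCurve

/-- Replaces the balls by paths with a pointwise a.e. speed bound, the only form in which smallness
of `ρ` is used later. -/
theorem ccDist_lt_iff [IsManifold (𝓡 D) 2 𝔐] {x y : 𝔐} {r : ENNReal} :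
    ccDist X x y < r ↔ ∃ L : ℝ, 0 ≤ L ∧ ENNReal.ofReal L < r ∧
      ∃ b γ, IsControlledPath X b γ L x y := by
  constructor
  · intro h
    simp only [ccDist, iInf_lt_iff] at h
    obtain ⟨δ, hδ, hy, hr⟩ := h
    obtain ⟨L, hL, hLδ, h⟩ := exists_controlledPath_of_mem_ccBall hδ hy
    exact ⟨L, hL, (ENNReal.ofReal_le_ofReal hLδ.le).trans_lt hr, h⟩
  · rintro ⟨L, hL, hr, b, γ, h⟩
    obtain ⟨δ, hδ0, h1, h2⟩ := ENNReal.lt_iff_exists_real_btwn.1 hr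
    have hLδ : L < δ := ((ENNReal.ofReal_lt_ofReal_iff').1 h1).1
    refine lt_of_le_of_lt ?_ h2
    refine iInf_le_of_le δ (iInf_le_of_le (hL.trans_lt hLδ) (iInf_le_of_le ?_ le_rfl))
    have := h.toIsControlledLine.mem_ccBall hL hLδ
    rwa [h.eq_left 0 le_rfl, h.eq_right 1 le_rfl] at this

theorem IsControlledLine.ccDist_le [IsManifold (𝓡 D) 2 𝔐] (h : IsControlledLine X b γ L)
    (hL : 0 ≤ L) : ccDist X (γ 0) (γ 1) ≤ ENNReal.ofReal L := by
  refine le_of_forall_gt fun r hr => ?_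
  obtain ⟨δ, hδ0, h1, h2⟩ := ENNReal.lt_iff_exists_real_btwn.1 hr
  have hLδ : L < δ := ((ENNReal.ofReal_lt_ofReal_iff').1 h1).1
  exact lt_of_le_of_lt (iInf_le_of_le δ (iInf_le_of_le (hL.trans_lt hLδ)
    (iInf_le_of_le (h.mem_ccBall hL hLδ) le_rfl))) h2

/-- The part of the curve up to time `t`, traversed in unit time, has speed `t * L ≤ L`. -/
theorem IsControlledLine.ccDist_le_of_mem [IsManifold (𝓡 D) 2 𝔐] (h : IsControlledLine X b γ L)
    (hL : 0 ≤ L) {t : ℝ} (ht : t ∈ Set.Icc (0 : ℝ) 1) :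
    ccDist X (γ 0) (γ t) ≤ ENNReal.ofReal L := by
  rcases ht.1.eq_or_lt with rfl | h0
  · refine le_of_forall_gt fun r hr => ?_
    exact ccDist_lt_iff.2 ⟨0, le_rfl, by simpa using pos_of_gt hr, 0, fun _ => γ 0,
      ⟨⟨continuous_const, fun j => aestronglyMeasurable_zero, by simp, fun t₀ =>
        ⟨_, IsManifold.chart_mem_maximalAtlas (γ 0), mem_chart_source _ _, by simp⟩⟩,
        by simp, by simp, by simp, by simp⟩⟩
  · have := (h.comp_affine h0.ne' 0).ccDist_le (by positivity)
    simp only [mul_zero, mul_one, add_zero] at this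
    exact this.trans (ENNReal.ofReal_le_ofReal (mul_le_of_le_one_left hL ht.2))

theorem ccDist_self [IsManifold (𝓡 D) 2 𝔐] (x : 𝔐) : ccDist X x x = 0 := by
  refine nonpos_iff_eq_zero.1 (le_of_forall_gt fun r hr => ?_)
  exact ccDist_lt_iff.2 ⟨0, le_rfl, by simpa using hr, 0, fun _ => x,
    ⟨⟨continuous_const, fun j => aestronglyMeasurable_zero, by simp, fun t₀ =>
      ⟨_, IsManifold.chart_mem_maximalAtlas x, mem_chart_source _ _, by simp⟩⟩,
      by simp, by simp, by simp, by simp⟩⟩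

theorem ccDist_comm_le [IsManifold (𝓡 D) 2 𝔐] (x y : 𝔐) : ccDist X x y ≤ ccDist X y x := by
  refine le_of_forall_gt fun r hr => ?_
  obtain ⟨L, hL, hr, b, γ, h⟩ := ccDist_lt_iff.1 hr
  refine ccDist_lt_iff.2 ⟨L, hL, hr, fun j t => -1 * b j (-1 * t + 1), fun t => γ (-1 * t + 1),
    ⟨?_, ?_, ?_, ?_, ?_⟩⟩
  · have := h.toIsControlledLine.comp_affine (c := -1) (by norm_num) 1
    exact ⟨this.continuous, this.measurable, by simpa using this.bound, this.chart⟩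
  · exact fun t ht => h.eq_right _ (by linarith)
  · exact fun t ht => h.eq_left _ (by linarith)
  · intro t ht j
    simp only [h.control_right (-1 * t + 1) (by linarith) j, mul_zero]
  · intro t ht j
    simp only [h.control_left (-1 * t + 1) (by linarith) j, mul_zero]

theorem ccDist_comm [IsManifold (𝓡 D) 2 𝔐] (x y : 𝔐) : ccDist X x y = ccDist X y x :=
  le_antisymm (ccDist_comm_le x y) (ccDist_comm_le y x)

/-- Two controlled lines that agree and rest on a time interval can be joined there. -/
theorem IsControlledLine.join {b₁ b₂ : Fin q → ℝ → ℝ} {γ₁ γ₂ : ℝ → 𝔐}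
    (h₁ : IsControlledLine X b₁ γ₁ L) (h₂ : IsControlledLine X b₂ γ₂ L) {u v m : ℝ}
    (hum : u < m) (hmv : m < v) (hγ : ∀ t ∈ Set.Ioo u v, γ₁ t = γ₂ t)
    (hb₁ : ∀ t > u, ∀ j, b₁ j t = 0) (hb₂ : ∀ t < v, ∀ j, b₂ j t = 0) :
    IsControlledLine X (fun j t => b₁ j t + b₂ j t) (fun t => if t < m then γ₁ t else γ₂ t) L := by
  set γ : ℝ → 𝔐 := fun t => if t < m then γ₁ t else γ₂ t with hγdef
  have e₁ : ∀ t < v, γ t = γ₁ t := by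
    intro t ht
    simp only [hγdef]
    split_ifs with htm
    · rfl
    · exact (hγ t ⟨hum.trans_le (not_lt.1 htm), ht⟩).symm
  have e₂ : ∀ t > u, γ t = γ₂ t := by
    intro t ht
    simp only [hγdef]
    split_ifs with htm
    · exact hγ t ⟨ht, htm.trans hmv⟩
    · rfl
  refine ⟨?_, fun j => (h₁.measurable j).add (h₂.measurable j), ?_, fun t₀ => ?_⟩
  · rw [continuous_iff_continuousAt]
    intro t
    rcases lt_or_ge t v with ht | ht
    · refine h₁.continuous.continuousAt.congr ?_
      filter_upwards [Iio_mem_nhds ht] with s hs using (e₁ s hs).symm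
    · refine h₂.continuous.continuousAt.congr ?_
      filter_upwards [Ioi_mem_nhds (hum.trans (hmv.trans_le ht))] with s hs using (e₂ s hs).symm
  · filter_upwards [h₁.bound, h₂.bound] with t ht₁ ht₂
    rcases lt_or_ge t v with ht | ht
    · simpa only [hb₂ t ht, add_zero] using ht₁
    · simpa only [hb₁ t (hum.trans (hmv.trans_le ht)), zero_add] using ht₂
  · rcases lt_or_ge t₀ v with ht | ht
    · obtain ⟨ψ, hψ, hs, he⟩ := h₁.chart t₀
      refine ⟨ψ, hψ, by rwa [e₁ t₀ ht], ?_⟩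
      filter_upwards [he, Iio_mem_nhds ht] with t h3 htv
      rw [e₁ t htv, e₁ t₀ ht, h3]
      congr 1
      refine intervalIntegral.integral_congr fun s hs => ?_
      have hsv : s < v := hs.2.trans_lt (max_lt ht htv)
      simp only [e₁ s hsv, hb₂ s hsv, add_zero]
    · have ht : u < t₀ := hum.trans (hmv.trans_le ht)
      obtain ⟨ψ, hψ, hs, he⟩ := h₂.chart t₀
      refine ⟨ψ, hψ, by rwa [e₂ t₀ ht], ?_⟩
      filter_upwards [he, Ioi_mem_nhds ht] with t h3 htv
      rw [e₂ t htv, e₂ t₀ ht, h3]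
      congr 1
      refine intervalIntegral.integral_congr fun s hs => ?_
      have hsv : u < s := (lt_min ht htv).trans_le hs.1
      simp only [e₂ s hsv, hb₁ s hsv, zero_add]

theorem IsControlledLine.mono (h : IsControlledLine X b γ L) (hL : 0 ≤ L) {L' : ℝ} (hLL : L ≤ L') :
    IsControlledLine X b γ L' :=
  ⟨h.continuous, h.measurable, h.bound.mono fun _ ht => ht.trans (by gcongr), h.chart⟩

theorem ccDist_triangle [IsManifold (𝓡 D) 2 𝔐] (x y z : 𝔐) :
    ccDist X x z ≤ ccDist X x y + ccDist X y z := by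
  refine le_of_forall_gt fun r hr => ?_
  obtain ⟨r₁, h₁, hr⟩ := ENNReal.lt_iff_exists_add_pos_lt.1 hr
  have hfin := ENNReal.add_lt_top.1 (lt_of_le_of_lt le_self_add hr |>.trans_le le_top)
  have hpos : (0 : ENNReal) < (r₁ / 3 : NNReal) := by
    exact_mod_cast (by positivity : 0 < r₁ / 3)
  obtain ⟨L₁, hL₁, hr₁, b₁, γ₁, hp₁⟩ := ccDist_lt_iff.1
    (ENNReal.lt_add_right hfin.1.ne hpos.ne')
  obtain ⟨L₂, hL₂, hr₂, b₂, γ₂, hp₂⟩ := ccDist_lt_iff.1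
    (ENNReal.lt_add_right hfin.2.ne hpos.ne')
  -- The slack `r₁` is used in thirds: one for each of the two paths, one for `2 * e`.
  set e : ℝ := r₁ / 3 / 2 with he
  have h₁' : (0 : ℝ) < r₁ := by exact_mod_cast h₁
  have he0 : 0 < e := by positivity
  set L := L₁ + L₂ + 2 * e with hLdef
  have hLpos : 0 < L := by positivity
  have hrL : ENNReal.ofReal L < r := by
    rw [hLdef, ENNReal.ofReal_add (by positivity) (by positivity),
      ENNReal.ofReal_add (by positivity) (by positivity)]
    have : ENNReal.ofReal (2 * e) = (r₁ / 3 : NNReal) := by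
      rw [he, mul_div_cancel₀ _ two_ne_zero, ENNReal.ofReal]
      congr 1
      ext
      rw [Real.coe_toNNReal _ (by positivity)]
      simp
    rw [this]
    refine lt_of_le_of_lt (add_le_add (add_le_add hr₁.le hr₂.le) le_rfl) (lt_of_eq_of_lt ?_ hr)
    have h3 : (r₁ : ENNReal) = ((r₁ / 3 : NNReal) : ENNReal) + ((r₁ / 3 : NNReal) : ENNReal)
        + ((r₁ / 3 : NNReal) : ENNReal) := by
      norm_cast
      ext; push_cast; ring
    rw [h3]; ring
  refine ccDist_lt_iff.2 ⟨L, hLpos.le, hrL, ?_⟩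
  -- Each path gets a share of the unit time roughly proportional to its speed. The `e / 2` keeps
  -- the share positive when `L₁` or `L₂` is 0, and `l₁ + l₂ = 1 - e / L` leaves idle time in the
  -- middle, the overlap on which `IsControlledLine.join` glues.
  set l₁ := (L₁ + e / 2) / L with hl₁
  set l₂ := (L₂ + e / 2) / L with hl₂
  have hl₁0 : 0 < l₁ := by positivity
  have hl₂0 : 0 < l₂ := by positivity
  have hll : l₁ + l₂ < 1 := by
    rw [hl₁, hl₂, ← add_div, div_lt_one hLpos]
    linarith
  have key : ∀ {M l : ℝ}, 0 ≤ M → l = (M + e / 2) / L → l⁻¹ * M ≤ L := by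
    intro M l hM hl
    rw [hl, inv_div, div_mul_eq_mul_div, div_le_iff₀ (by positivity)]
    nlinarith
  have g₁ := ((hp₁.toIsControlledLine.comp_affine (inv_pos.2 hl₁0).ne' 0).mono (by positivity)
    (key hL₁ hl₁))
  have g₂ := ((hp₂.toIsControlledLine.comp_affine (inv_pos.2 hl₂0).ne' (1 - l₂⁻¹)).mono
    (by positivity) (key hL₂ hl₂))
  have hend₁ : ∀ t, l₁ ≤ t → 1 ≤ l₁⁻¹ * t + 0 := fun t ht => by
    rw [add_zero, inv_mul_eq_div, one_le_div hl₁0]; exact ht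
  have hend₁' : ∀ t, l₁ < t → 1 < l₁⁻¹ * t + 0 := fun t ht => by
    rw [add_zero, inv_mul_eq_div, one_lt_div hl₁0]; exact ht
  have hrw : ∀ t, l₂⁻¹ * t + (1 - l₂⁻¹) = (t - (1 - l₂)) / l₂ := fun t => by
    field_simp
    ring
  have hst₂ : ∀ t, t ≤ 1 - l₂ → l₂⁻¹ * t + (1 - l₂⁻¹) ≤ 0 := fun t ht => by
    rw [hrw]; exact div_nonpos_of_nonpos_of_nonneg (by linarith) hl₂0.le
  have hst₂' : ∀ t, t < 1 - l₂ → l₂⁻¹ * t + (1 - l₂⁻¹) < 0 := fun t ht => by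
    rw [hrw]; exact div_neg_of_neg_of_pos (by linarith) hl₂0
  have hm₁ : l₁ < (l₁ + (1 - l₂)) / 2 := by linarith
  have hm₂ : (l₁ + (1 - l₂)) / 2 < 1 - l₂ := by linarith
  refine ⟨_, _, ⟨g₁.join g₂ hm₁ hm₂ ?_ ?_ ?_, ?_, ?_, ?_, ?_⟩⟩
  · intro t ht
    simp only [hp₁.eq_right _ (hend₁ t ht.1.le), hp₂.eq_left _ (hst₂ t ht.2.le)]
  · intro t ht j
    simp only [hp₁.control_right _ (hend₁' t ht), mul_zero]
  · intro t ht j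
    simp only [hp₂.control_left _ (hst₂' t ht), mul_zero]
  · intro t ht
    simp only [if_pos (show t < (l₁ + (1 - l₂)) / 2 by linarith)]
    exact hp₁.eq_left _ (by rw [add_zero]; exact mul_nonpos_of_nonneg_of_nonpos (by positivity) ht)
  · intro t ht
    simp only [if_neg (show ¬ t < (l₁ + (1 - l₂)) / 2 by linarith)]
    exact hp₂.eq_right _ (by rw [hrw, one_le_div hl₂0]; linarith)
  · intro t ht j
    simp only [hp₂.control_left _ (hst₂' t (by linarith)), mul_zero, add_zero]
    rw [hp₁.control_left, mul_zero]
    simpa using mul_neg_of_pos_of_neg (inv_pos.2 hl₁0) ht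
  · intro t ht j
    simp only [hp₁.control_right _ (hend₁' t (by linarith)), mul_zero, zero_add]
    rw [hp₂.control_right, mul_zero]
    rw [hrw, one_lt_div hl₂0]; linarith

end CaratheodoryCurves

/-! ### Vector fields and Lie brackets in a chart -/

section ChartFields

variable {q D : ℕ} {𝔐 : Type*} [TopologicalSpace 𝔐]
  [ChartedSpace (EuclideanSpace ℝ (Fin D)) 𝔐]

/-- The vector field `ψ_* V` on the target of the chart `ψ`. -/
def chartField (ψ : OpenPartialHomeomorph 𝔐 (EuclideanSpace ℝ (Fin D)))
    (V : (x : 𝔐) → TangentSpace (𝓡 D) x) (y : EuclideanSpace ℝ (Fin D)) :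
    EuclideanSpace ℝ (Fin D) :=
  chartPushforward ψ V (ψ.symm y)

theorem mdifferentiable_of_mem_maximalAtlas_two [IsManifold (𝓡 D) 2 𝔐]
    {ψ : OpenPartialHomeomorph 𝔐 (EuclideanSpace ℝ (Fin D))}
    (hψ : ψ ∈ IsManifold.maximalAtlas (𝓡 D) 2 𝔐) : ψ.MDifferentiable (𝓡 D) (𝓡 D) :=
  ⟨(contMDiffOn_of_mem_maximalAtlas hψ).mdifferentiableOn two_ne_zero,
    (contMDiffOn_symm_of_mem_maximalAtlas hψ).mdifferentiableOn two_ne_zero⟩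

variable [IsManifold (𝓡 D) 2 𝔐] {ψ : OpenPartialHomeomorph 𝔐 (EuclideanSpace ℝ (Fin D))}

theorem mfderiv_chart_injective (hψ : ψ ∈ IsManifold.maximalAtlas (𝓡 D) 2 𝔐) {x : 𝔐}
    (hx : x ∈ ψ.source) : Function.Injective (mfderiv (𝓡 D) (𝓡 D) ψ x) := by
  intro v w hvw
  have h := (mdifferentiable_of_mem_maximalAtlas_two hψ).symm_comp_deriv hx
  have e := congrArg (mfderiv (𝓡 D) (𝓡 D) ψ.symm (ψ x)) hvw
  have hv := DFunLike.congr_fun h v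
  have hw := DFunLike.congr_fun h w
  exact (hv.symm.trans e).trans hw

/-- The derivatives of `ψ` and `ψ.symm` are mutually inverse. Through this identification the
regularity of pullbacks and the naturality of the bracket apply to `chartField`. -/
theorem mpullback_chart_symm (hψ : ψ ∈ IsManifold.maximalAtlas (𝓡 D) 2 𝔐)
    (V : (x : 𝔐) → TangentSpace (𝓡 D) x) {y : EuclideanSpace ℝ (Fin D)} (hy : y ∈ ψ.target) :
    VectorField.mpullback (𝓡 D) (𝓡 D) ψ.symm V y = chartField ψ V y := by
  have hd := mdifferentiable_of_mem_maximalAtlas_two hψ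
  rw [VectorField.mpullback_apply, chartField, chartPushforward]
  have h1 := hd.comp_symm_deriv hy
  have h2 := hd.symm_comp_deriv (ψ.map_target hy)
  rw [ψ.right_inv hy] at h2
  exact DFunLike.congr_fun (ContinuousLinearMap.inverse_eq
    (g := mfderiv (𝓡 D) (𝓡 D) ψ (ψ.symm y)) h2 h1) (V (ψ.symm y))

theorem isInvertible_mfderiv_chart_symm (hψ : ψ ∈ IsManifold.maximalAtlas (𝓡 D) 2 𝔐)
    {y : EuclideanSpace ℝ (Fin D)} (hy : y ∈ ψ.target) :
    (mfderiv (𝓡 D) (𝓡 D) ψ.symm y).IsInvertible := by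
  have hd := mdifferentiable_of_mem_maximalAtlas_two hψ
  have h1 := hd.comp_symm_deriv hy
  have h2 := hd.symm_comp_deriv (ψ.map_target hy)
  rw [ψ.right_inv hy] at h2
  exact ContinuousLinearMap.IsInvertible.of_inverse h2 h1

theorem IsC1VectorField.contDiffAt_chartField {V : (x : 𝔐) → TangentSpace (𝓡 D) x}
    (hV : IsC1VectorField V) (hψ : ψ ∈ IsManifold.maximalAtlas (𝓡 D) 2 𝔐)
    {y : EuclideanSpace ℝ (Fin D)} (hy : y ∈ ψ.target) : ContDiffAt ℝ 1 (chartField ψ V) y := by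
  have : IsManifold (𝓡 D) 1 𝔐 := IsManifold.of_le (n := 2) (by norm_num)
  have h := ContMDiffAt.mpullback_vectorField_preimage (n := 2) (m := 1) (I := 𝓡 D)
    (f := ψ.symm) (x₀ := y) (V := V) (hV (ψ.symm y))
    ((contMDiffOn_symm_of_mem_maximalAtlas hψ).contMDiffAt (ψ.open_target.mem_nhds hy))
    (isInvertible_mfderiv_chart_symm hψ hy) (by norm_num)
  have h2 := contMDiffAt_vectorSpace_iff_contDiffAt.1 h
  refine ContDiffAt.congr_of_eventuallyEq h2 ?_
  filter_upwards [ψ.open_target.mem_nhds hy] with z hz using (mpullback_chart_symm hψ V hz).symm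

theorem mlieBracket_vectorSpace_eq {E : Type*} [NormedAddCommGroup E] [NormedSpace ℝ E]
    (V W : E → E) (y : E) :
    VectorField.mlieBracket 𝓘(ℝ, E) V W y = VectorField.lieBracket ℝ V W y := by
  rw [← VectorField.lieBracketWithin_univ]
  exact congrFun (VectorField.mlieBracketWithin_eq_lieBracketWithin (𝕜 := ℝ) (V := V) (W := W)
    (s := Set.univ)) y

theorem lieBracket_chartField {V W : (x : 𝔐) → TangentSpace (𝓡 D) x}
    (hV : IsC1VectorField V) (hW : IsC1VectorField W)
    (hψ : ψ ∈ IsManifold.maximalAtlas (𝓡 D) 2 𝔐)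
    {y : EuclideanSpace ℝ (Fin D)} (hy : y ∈ ψ.target) :
    VectorField.lieBracket ℝ (chartField ψ V) (chartField ψ W) y =
      chartField ψ (VectorField.mlieBracket (𝓡 D) V W) y := by
  have : IsManifold (𝓡 D) (minSmoothness ℝ 2) 𝔐 := by simpa
  have h := VectorField.mpullback_mlieBracket (𝕜 := ℝ) (I := 𝓡 D) (I' := 𝓡 D) (f := ψ.symm) (n := 2)
    (x₀ := y) (V := V) (W := W) ((hV _).mdifferentiableAt one_ne_zero)
    ((hW _).mdifferentiableAt one_ne_zero)
    ((contMDiffOn_symm_of_mem_maximalAtlas hψ).contMDiffAt (ψ.open_target.mem_nhds hy)) (by simp)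
  rw [mpullback_chart_symm hψ _ hy] at h
  have e : ∀ V : (x : 𝔐) → TangentSpace (𝓡 D) x,
      chartField ψ V =ᶠ[𝓝 y] VectorField.mpullback (𝓡 D) (𝓡 D) ψ.symm V := fun V => by
    filter_upwards [ψ.open_target.mem_nhds hy] with z hz using (mpullback_chart_symm hψ V hz).symm
  refine ((e V).lieBracket_vectorField_eq (e W)).trans (Eq.trans ?_ h.symm)
  exact (mlieBracket_vectorSpace_eq (VectorField.mpullback (𝓡 D) (𝓡 D) ψ.symm V)
    (VectorField.mpullback (𝓡 D) (𝓡 D) ψ.symm W) y).symm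

theorem chartField_apply_chart (V : (x : 𝔐) → TangentSpace (𝓡 D) x) {x : 𝔐} (hx : x ∈ ψ.source) :
    chartField ψ V (ψ x) = chartPushforward ψ V x := by
  rw [chartField, ψ.left_inv hx]

theorem mfderiv_comp_chart {H : Type*} [NormedAddCommGroup H] [NormedSpace ℝ H]
    (hψ : ψ ∈ IsManifold.maximalAtlas (𝓡 D) 2 𝔐) {f : EuclideanSpace ℝ (Fin D) → H} {x : 𝔐}
    (hx : x ∈ ψ.source) (hf : DifferentiableAt ℝ f (ψ x)) (V : (x : 𝔐) → TangentSpace (𝓡 D) x) :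
    mfderiv (𝓡 D) 𝓘(ℝ, H) (f ∘ ψ) x (V x) = fderiv ℝ f (ψ x) (chartField ψ V (ψ x)) := by
  have h := mfderiv_comp_apply (I := 𝓡 D) (I' := 𝓡 D) (I'' := 𝓘(ℝ, H)) x
    (mdifferentiableAt_iff_differentiableAt.2 hf)
    ((mdifferentiable_of_mem_maximalAtlas_two hψ).mdifferentiableAt hx) (V x)
  rw [h, mfderiv_eq_fderiv, chartField_apply_chart V hx]
  rfl

end ChartFields

/-! ### Gronwall estimates along controlled curves -/

section Gronwall

variable {q D : ℕ} {𝔐 : Type*} [TopologicalSpace 𝔐]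
  [ChartedSpace (EuclideanSpace ℝ (Fin D)) 𝔐] [IsManifold (𝓡 D) 2 𝔐]
  {X : VectorFields q D 𝔐} {b : Fin q → ℝ → ℝ} {γ : ℝ → 𝔐} {L : ℝ}
  {H : Type*} [NormedAddCommGroup H] [NormedSpace ℝ H]

/-- The derivative of `F` along the vector field `V`. -/
def alongField (F : 𝔐 → H) (V : (x : 𝔐) → TangentSpace (𝓡 D) x) (x : 𝔐) : H :=
  mfderiv (𝓡 D) 𝓘(ℝ, H) F x (V x)

theorem IsControlledLine.ae_norm_le (h : IsControlledLine X b γ L) (hL : 0 ≤ L) :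
    ∀ᵐ t, ∀ j, ‖b j t‖ ≤ L := by
  filter_upwards [h.bound] with t ht j
  refine abs_le_of_sq_le_sq ?_ hL
  exact (Finset.single_le_sum (f := fun j => b j t ^ 2) (fun i _ => sq_nonneg _)
    (Finset.mem_univ j)).trans ht

theorem IsControlledLine.intervalIntegrable (h : IsControlledLine X b γ L) (hL : 0 ≤ L)
    (j : Fin q) (s t : ℝ) : IntervalIntegrable (b j) volume s t := by
  rw [intervalIntegrable_iff]
  refine IntegrableOn.of_bound (by simp) (h.measurable j).restrict L
    (ae_restrict_of_ae ?_)
  filter_upwards [h.ae_norm_le hL] with t ht using ht j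

theorem IsControlledLine.abs_integral_le (h : IsControlledLine X b γ L) (hL : 0 ≤ L)
    (j : Fin q) (s t : ℝ) : ‖∫ τ in s..t, b j τ‖ ≤ L * |t - s| := by
  refine intervalIntegral.norm_integral_le_of_norm_le_const_ae ?_
  filter_upwards [h.ae_norm_le hL] with t ht _ using ht j

/-- The control is only bounded and measurable, so the curve need not have a derivative at `s`.
Freezing the continuous fields at `γ s`, but not the control, costs only `o(t - s)`. -/
theorem IsControlledLine.exists_chart_isLittleO (h : IsControlledLine X b γ L) (hL : 0 ≤ L)
    (hX : ∀ j, IsC1VectorField (X j)) (s : ℝ) :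
    ∃ ψ ∈ IsManifold.maximalAtlas (𝓡 D) 2 𝔐, γ s ∈ ψ.source ∧
      (fun t => ψ (γ t) - ψ (γ s) - ∑ j, (∫ τ in s..t, b j τ) • chartPushforward ψ (X j) (γ s))
        =o[𝓝 s] fun t => t - s := by
  obtain ⟨ψ, hψ, hs, he⟩ := h.chart s
  refine ⟨ψ, hψ, hs, ?_⟩
  have hopen : IsOpen (γ ⁻¹' ψ.source) := ψ.open_source.preimage h.continuous
  have hw : ∀ j, ContinuousOn (fun t => chartPushforward ψ (X j) (γ t)) (γ ⁻¹' ψ.source) := by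
    intro j t ht
    have h1 : ContinuousAt (chartField ψ (X j)) (ψ (γ t)) :=
      ((hX j).contDiffAt_chartField hψ (ψ.map_source ht)).continuousAt
    have h2 : ContinuousAt (fun t => chartField ψ (X j) (ψ (γ t))) t :=
      ContinuousAt.comp (f := fun t => ψ (γ t)) h1
        ((ψ.continuousAt ht).comp h.continuous.continuousAt)
    refine (h2.congr ?_).continuousWithinAt
    filter_upwards [hopen.mem_nhds ht] with τ hτ using chartField_apply_chart _ hτ
  rw [Asymptotics.isLittleO_iff]
  intro ε hε
  obtain ⟨η, hη, hηq⟩ : ∃ η > 0, (q : ℝ) * (L * η) ≤ ε := by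
    refine ⟨ε / (q * L + 1), by positivity, ?_⟩
    rw [← mul_assoc, mul_div_assoc', div_le_iff₀ (by positivity)]
    nlinarith
  have hclose : ∀ᶠ t in 𝓝 s, ∀ j,
      ‖chartPushforward ψ (X j) (γ t) - chartPushforward ψ (X j) (γ s)‖ ≤ η := by
    rw [Filter.eventually_all]
    intro j
    have := ((hw j).continuousAt (hopen.mem_nhds hs)).tendsto
    filter_upwards [this (Metric.closedBall_mem_nhds _ hη)] with t ht
    exact mem_closedBall_iff_norm.1 ht
  obtain ⟨r, hr, hball⟩ := Metric.eventually_nhds_iff.1 (hclose.and (hopen.mem_nhds hs))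
  filter_upwards [he, Metric.ball_mem_nhds s hr] with t ht htr
  have huIcc : ∀ τ ∈ Set.uIcc s t, dist τ s < r := fun τ hτ =>
    lt_of_le_of_lt (by
      rw [Real.dist_eq, Real.dist_eq]
      exact Set.abs_sub_left_of_mem_uIcc hτ) htr
  have hsub : Set.uIcc s t ⊆ γ ⁻¹' ψ.source := fun τ hτ => (hball (huIcc τ hτ)).2
  have hi₁ : ∀ j ∈ Finset.univ, IntervalIntegrable
      (fun τ => b j τ • chartPushforward ψ (X j) (γ τ)) volume s t := fun j _ =>
    (h.intervalIntegrable hL j s t).smul_continuousOn ((hw j).mono hsub)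
  have hi₂ : ∀ j ∈ Finset.univ, IntervalIntegrable
      (fun τ => b j τ • chartPushforward ψ (X j) (γ s)) volume s t := fun j _ =>
    (h.intervalIntegrable hL j s t).smul_continuousOn continuousOn_const
  rw [ht, add_sub_cancel_left, intervalIntegral.integral_finsetSum hi₁, ← Finset.sum_sub_distrib]
  have hterm : ∀ j, ‖(∫ τ in s..t, b j τ • chartPushforward ψ (X j) (γ τ)) -
      (∫ τ in s..t, b j τ) • chartPushforward ψ (X j) (γ s)‖ ≤ (L * η) * |t - s| := by
    intro j
    rw [← intervalIntegral.integral_smul_const, ← intervalIntegral.integral_sub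
      (hi₁ j (Finset.mem_univ j)) (hi₂ j (Finset.mem_univ j))]
    refine intervalIntegral.norm_integral_le_of_norm_le_const_ae ?_
    filter_upwards [h.ae_norm_le hL] with τ hτ hτu
    rw [← smul_sub, norm_smul]
    exact mul_le_mul (hτ j) ((hball (huIcc τ (Set.uIoc_subset_uIcc hτu))).1 j) (norm_nonneg _) hL
  refine (norm_sum_le _ _).trans ((Finset.sum_le_sum fun j _ => hterm j).trans ?_)
  rw [Finset.sum_const, Finset.card_univ, Fintype.card_fin, nsmul_eq_mul, ← mul_assoc,
    Real.norm_eq_abs]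
  gcongr

/-- The curve equation is given in one unspecified chart for each time; the chain rule through that
chart yields an expansion in which the chart no longer appears. -/
theorem IsControlledLine.isLittleO (h : IsControlledLine X b γ L) (hL : 0 ≤ L)
    (hX : ∀ j, IsC1VectorField (X j)) {F : 𝔐 → H} {s : ℝ}
    (hF : MDifferentiableAt (𝓡 D) 𝓘(ℝ, H) F (γ s)) :
    (fun t => F (γ t) - F (γ s) -
      ∑ j, (∫ τ in s..t, b j τ) • alongField F (X j) (γ s))
        =o[𝓝 s] fun t => t - s := by
  obtain ⟨ψ, hψ, hs, hψo⟩ := h.exists_chart_isLittleO hL hX s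
  have hint : ∀ j, (fun t => ∫ τ in s..t, b j τ) =O[𝓝 s] fun t => t - s := fun j =>
    Asymptotics.IsBigO.of_bound L (Filter.Eventually.of_forall fun t => by
      simpa using h.abs_integral_le hL j s t)
  have hψO : (fun t => ψ (γ t) - ψ (γ s)) =O[𝓝 s] fun t => t - s := by
    have h1 : (fun t => ∑ j, (∫ τ in s..t, b j τ) • chartPushforward ψ (X j) (γ s))
        =O[𝓝 s] fun t => t - s := by
      refine Asymptotics.IsBigO.fun_sum fun j _ => ?_
      have := (hint j).smul (Asymptotics.isBigO_refl
        (fun _ : ℝ => chartPushforward ψ (X j) (γ s)) (𝓝 s))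
      refine this.trans (Asymptotics.IsBigO.of_bound ‖chartPushforward ψ (X j) (γ s)‖
        (Filter.Eventually.of_forall fun t => ?_))
      rw [norm_smul, mul_comm]
    simpa using hψo.isBigO.add h1
  have hd := mdifferentiable_of_mem_maximalAtlas_two hψ
  set f : EuclideanSpace ℝ (Fin D) → H := F ∘ ψ.symm with hf
  have hfd : DifferentiableAt ℝ f (ψ (γ s)) := by
    rw [← mdifferentiableAt_iff_differentiableAt]
    refine MDifferentiableAt.comp (I' := 𝓡 D) _ ?_ (hd.mdifferentiableAt_symm (ψ.map_source hs))
    rwa [ψ.left_inv hs]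
  have hFf : F =ᶠ[𝓝 (γ s)] f ∘ ψ := by
    filter_upwards [ψ.open_source.mem_nhds hs] with x hx
    simp [hf, ψ.left_inv hx]
  have hder : ∀ j, alongField F (X j) (γ s) =
      fderiv ℝ f (ψ (γ s)) (chartPushforward ψ (X j) (γ s)) := by
    intro j
    rw [alongField, hFf.mfderiv_eq, ← chartField_apply_chart (X j) hs]
    exact mfderiv_comp_chart hψ hs hfd (X j)
  have htend : Filter.Tendsto (fun t => ψ (γ t)) (𝓝 s) (𝓝 (ψ (γ s))) :=
    ((ψ.continuousAt hs).comp h.continuous.continuousAt).tendsto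
  have h1 := (hfd.hasFDerivAt.isLittleO.comp_tendsto htend).trans_isBigO hψO
  have h2 := ((fderiv ℝ f (ψ (γ s))).isBigO_comp _ (𝓝 s)).trans_isLittleO hψo
  refine (h1.add h2).congr' ?_ Filter.EventuallyEq.rfl
  filter_upwards [h.continuous.continuousAt.preimage_mem_nhds (ψ.open_source.mem_nhds hs)]
    with t ht
  simp only [Function.comp_apply, map_sub, map_sum, map_smul, hder]
  have e : ∀ x ∈ ψ.source, f (ψ x) = F x := fun x hx => by simp [hf, ψ.left_inv hx]
  rw [e _ ht, e _ hs]
  abel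

/-- The first-order expansion bounds the right difference quotients of `‖F (γ t)‖`, and Gronwall's
inequality in its Dini-derivative form needs nothing more. -/
theorem IsControlledLine.norm_le_gronwallBound (h : IsControlledLine X b γ L) (hL : 0 ≤ L)
    (hX : ∀ j, IsC1VectorField (X j)) {F : 𝔐 → H} {T : ℝ}
    (hc : ContinuousOn (fun t => F (γ t)) (Set.Icc 0 T))
    (hd : ∀ s ∈ Set.Ico 0 T, MDifferentiableAt (𝓡 D) 𝓘(ℝ, H) F (γ s)) {δ K ε : ℝ}
    (hbound : ∀ s ∈ Set.Ico 0 T,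
      L * ∑ j, ‖alongField F (X j) (γ s)‖ ≤ K * ‖F (γ s)‖ + ε)
    (h0 : ‖F (γ 0)‖ ≤ δ) :
    ∀ t ∈ Set.Icc 0 T, ‖F (γ t)‖ ≤ gronwallBound δ K ε t := by
  have := le_gronwallBound_of_liminf_deriv_right_le (f := fun t => ‖F (γ t)‖)
    (f' := fun s => L * ∑ j, ‖alongField F (X j) (γ s)‖)
    (continuous_norm.comp_continuousOn hc) ?_ h0 hbound
  · simpa using this
  intro s hs r hr
  apply Filter.Eventually.frequently
  have ho := (h.isLittleO hL hX (hd s hs)).mono (nhdsWithin_le_nhds (s := Set.Ioi s))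
  obtain ⟨η, hη, hηr⟩ := exists_between (sub_pos.2 hr)
  filter_upwards [(Asymptotics.isLittleO_iff.1 ho) hη, self_mem_nhdsWithin] with t ht hst
  have hst' : 0 < t - s := sub_pos.2 hst
  rw [inv_mul_lt_iff₀ hst']
  have h1 : ‖∑ j, (∫ τ in s..t, b j τ) • alongField F (X j) (γ s)‖ ≤
      (t - s) * (L * ∑ j, ‖alongField F (X j) (γ s)‖) := by
    refine (norm_sum_le _ _).trans ?_
    rw [Finset.mul_sum, Finset.mul_sum]
    refine Finset.sum_le_sum fun j _ => ?_
    rw [norm_smul, ← mul_assoc, mul_comm (t - s)]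
    gcongr
    simpa [abs_of_pos hst'] using h.abs_integral_le hL j s t
  have h2 := norm_sub_norm_le (F (γ t) - F (γ s))
    (∑ j, (∫ τ in s..t, b j τ) • alongField F (X j) (γ s))
  have h3 := norm_sub_norm_le (F (γ t)) (F (γ s))
  rw [Real.norm_of_nonneg hst'.le] at ht
  nlinarith

/-- Gronwall's inequality for a function of a chart. -/
theorem IsControlledLine.norm_le_gronwallBound_chart (h : IsControlledLine X b γ L) (hL : 0 ≤ L)
    (hX : ∀ j, IsC1VectorField (X j))
    {ψ : OpenPartialHomeomorph 𝔐 (EuclideanSpace ℝ (Fin D))}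
    (hψ : ψ ∈ IsManifold.maximalAtlas (𝓡 D) 2 𝔐)
    {f : EuclideanSpace ℝ (Fin D) → H} {T : ℝ} (hs : ∀ s ∈ Set.Icc 0 T, γ s ∈ ψ.source)
    (hf : ∀ s ∈ Set.Icc 0 T, DifferentiableAt ℝ f (ψ (γ s))) {δ K ε : ℝ}
    (hbound : ∀ s ∈ Set.Ico 0 T, L * ∑ j, ‖fderiv ℝ f (ψ (γ s)) (chartField ψ (X j) (ψ (γ s)))‖ ≤
      K * ‖f (ψ (γ s))‖ + ε)
    (h0 : ‖f (ψ (γ 0))‖ ≤ δ) :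
    ∀ t ∈ Set.Icc 0 T, ‖f (ψ (γ t))‖ ≤ gronwallBound δ K ε t := by
  refine h.norm_le_gronwallBound hL hX (F := f ∘ ψ) ?_ ?_ ?_ h0
  · intro t ht
    exact ((hf t ht).continuousAt.comp
      (f := fun t => ψ (γ t)) ((ψ.continuousAt (hs t ht)).comp
        h.continuous.continuousAt)).continuousWithinAt
  · intro s hs'
    have hs'' := Set.Ico_subset_Icc_self hs'
    exact MDifferentiableAt.comp (I' := 𝓡 D) _ (mdifferentiableAt_iff_differentiableAt.2 (hf s hs''))
      ((mdifferentiable_of_mem_maximalAtlas_two hψ).mdifferentiableAt (hs s hs''))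
  · intro s hs'
    have hs'' := Set.Ico_subset_Icc_self hs'
    have e : ∀ j, alongField (f ∘ ψ) (X j) (γ s) =
        fderiv ℝ f (ψ (γ s)) (chartField ψ (X j) (ψ (γ s))) :=
      fun j => mfderiv_comp_chart hψ (hs s hs'') (hf s hs'') (X j)
    simp only [e]
    exact hbound s hs'

/-- Short controlled curves that start at `z` stay near `z`. -/
theorem exists_forall_controlledLine_mem [T2Space 𝔐] (hX : ∀ j, IsC1VectorField (X j)) (z : 𝔐)
    {O : Set 𝔐} (hO : O ∈ 𝓝 z) :
    ∃ r > 0, ∀ (b : Fin q → ℝ → ℝ) (γ : ℝ → 𝔐) (L : ℝ), 0 ≤ L → L < r →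
      IsControlledLine X b γ L → γ 0 = z → ∀ t ∈ Set.Icc (0 : ℝ) 1, γ t ∈ O := by
  set ψ := chartAt (EuclideanSpace ℝ (Fin D)) z with hψdef
  have hψ : ψ ∈ IsManifold.maximalAtlas (𝓡 D) 2 𝔐 := IsManifold.chart_mem_maximalAtlas z
  have hz : z ∈ ψ.source := mem_chart_source _ z
  have hnhds : ψ.target ∩ ψ.symm ⁻¹' O ∈ 𝓝 (ψ z) := by
    refine Filter.inter_mem (ψ.open_target.mem_nhds (ψ.map_source hz)) ?_
    apply (ψ.continuousAt_symm (ψ.map_source hz)).preimage_mem_nhds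
    rwa [ψ.left_inv hz]
  obtain ⟨a, ha, hball⟩ := Metric.nhds_basis_closedBall.mem_iff.1 hnhds
  have hcomp : IsCompact (Metric.closedBall (ψ z) a) := isCompact_closedBall _ _
  have hcf : ∀ j, ContinuousOn (chartField ψ (X j)) (Metric.closedBall (ψ z) a) := fun j y hy =>
    ((hX j).contDiffAt_chartField hψ (hball hy).1).continuousAt.continuousWithinAt
  have hC : ∃ C > 0, ∀ y ∈ Metric.closedBall (ψ z) a, ∑ j, ‖chartField ψ (X j) y‖ ≤ C := by
    obtain ⟨C, hC⟩ := hcomp.exists_bound_of_continuousOn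
      (f := fun y => ∑ j, ‖chartField ψ (X j) y‖)
      (continuousOn_finsetSum _ fun j _ => (hcf j).norm)
    exact ⟨max C 1, by positivity, fun y hy =>
      (le_abs_self _).trans ((hC y hy).trans (le_max_left _ _))⟩
  obtain ⟨C, hC0, hC⟩ := hC
  -- In the chart the velocity is at most `L * C < a`, so the ball of radius `a` cannot be left in
  -- unit time.
  refine ⟨a / C, by positivity, fun b γ L hL hLr h h0 => ?_⟩
  set O' := ψ.source ∩ ψ ⁻¹' Metric.ball (ψ z) a with hO'
  have hO'open : IsOpen O' := ψ.isOpen_inter_preimage Metric.isOpen_ball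
  have hO'O : O' ⊆ O := fun x hx => by
    have := (hball (Metric.ball_subset_closedBall hx.2)).2
    rwa [Set.mem_preimage, ψ.left_inv hx.1] at this
  suffices hmain : ∀ t ∈ Set.Icc (0 : ℝ) 1, γ t ∈ O' from fun t ht => hO'O (hmain t ht)
  by_contra! hcon
  set S := Set.Icc (0 : ℝ) 1 ∩ γ ⁻¹' O'ᶜ with hS
  have hSne : S.Nonempty := let ⟨t, ht, ht'⟩ := hcon; ⟨t, ht, ht'⟩
  have hScomp : IsCompact S :=
    isCompact_Icc.inter_right (hO'open.isClosed_compl.preimage h.continuous)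
  -- `T` is the first exit time.
  obtain ⟨T, hTS, hTmin⟩ := hScomp.exists_isLeast hSne
  have hlt : ∀ t ∈ Set.Ico 0 T, γ t ∈ O' := by
    intro t ht
    by_contra hn
    exact absurd (hTmin ⟨⟨ht.1, ht.2.le.trans hTS.1.2⟩, hn⟩) (not_le.2 ht.2)
  have hT0 : 0 < T := by
    rcases hTS.1.1.eq_or_lt with h' | h'
    · exfalso
      apply hTS.2
      rw [← h', h0]
      exact ⟨hz, Metric.mem_ball_self ha⟩
    · exact h'
  -- The Hausdorff property makes this compact set closed, so the exit point `γ T` is still in the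
  -- chart domain, where the estimate applies to it.
  have hKclosed : IsClosed (ψ.symm '' Metric.closedBall (ψ z) a) :=
    (hcomp.image_of_continuousOn (ψ.continuousOn_symm.mono fun y hy => (hball hy).1)).isClosed
  have hTK : γ T ∈ ψ.symm '' Metric.closedBall (ψ z) a := by
    have hcl : T ∈ closure (Set.Ico 0 T) := by
      rw [closure_Ico hT0.ne]; exact ⟨hT0.le, le_rfl⟩
    have := map_mem_closure h.continuous hcl (t := ψ.symm '' Metric.closedBall (ψ z) a)
      fun t ht => ⟨ψ (γ t), Metric.ball_subset_closedBall (hlt t ht).2, ψ.left_inv (hlt t ht).1⟩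
    rwa [hKclosed.closure_eq] at this
  have hTsrc : γ T ∈ ψ.source := by
    obtain ⟨y, hy, hyT⟩ := hTK
    rw [← hyT]
    exact ψ.map_target (hball hy).1
  have hsrc : ∀ s ∈ Set.Icc 0 T, γ s ∈ ψ.source := by
    intro s hs
    rcases hs.2.eq_or_lt with h' | h'
    · rwa [h']
    · exact (hlt s ⟨hs.1, h'⟩).1
  have hg := h.norm_le_gronwallBound_chart hL hX hψ (f := fun y => y - ψ z) hsrc
    (fun s _ => by fun_prop) (δ := 0) (K := 0) (ε := L * C) ?_ (by simp [h0]) T ⟨hT0.le, le_rfl⟩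
  · apply hTS.2
    refine ⟨hTsrc, ?_⟩
    rw [Set.mem_preimage, mem_ball_iff_norm]
    refine hg.trans_lt ?_
    rw [gronwallBound_K0]
    have h1 : L * C < a := by rwa [← lt_div_iff₀ hC0]
    have : L * C * T ≤ L * C * 1 := by
      have := hTS.1.2
      gcongr
    linarith
  · intro s hs
    rw [zero_mul, zero_add, fderiv_sub_const, fderiv_fun_id]
    exact mul_le_mul_of_nonneg_left
      (hC _ (Metric.ball_subset_closedBall (hlt s hs).2)) hL

end Gronwall

/-! ### The total differential equation `DΘ = V(Θ)` -/

section Frobenius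

variable {E G : Type*} [NormedAddCommGroup E] [NormedSpace ℝ E]
  [NormedAddCommGroup G] [NormedSpace ℝ G]

/-- The solution is taken as a fixed point of the Picard operator in order to keep the fact that it
never leaves the ball, on which all later bounds rely. -/
theorem IsPicardLindelof.exists_hasDerivWithinAt_mem_closedBall [CompleteSpace G]
    {f : ℝ → G → G} {tmin tmax : ℝ} {t₀ : Set.Icc tmin tmax} {x₀ : G} {a L K : NNReal}
    (hf : IsPicardLindelof f t₀ x₀ a 0 L K) :
    ∃ α : ℝ → G, α t₀ = x₀ ∧ (∀ t, α t ∈ Metric.closedBall x₀ a) ∧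
      ∀ t ∈ Set.Icc tmin tmax, HasDerivWithinAt α (f t (α t)) (Set.Icc tmin tmax) t := by
  obtain ⟨α, hα⟩ := ODE.FunSpace.exists_isFixedPt_next hf (Metric.mem_closedBall_self le_rfl)
  refine ⟨α.compProj, by rw [ODE.FunSpace.compProj_val, ← hα, ODE.FunSpace.next_apply₀],
    fun t => α.compProj_mem_closedBall hf.mul_max_le, fun t ht ↦ ?_⟩
  refine (ODE.hasDerivWithinAt_picard_Icc t₀.2 hf.continuousOn_uncurry
    α.continuous_compProj.continuousOn (fun _ _ ↦ α.compProj_mem_closedBall hf.mul_max_le)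
    x₀ ht).congr_of_mem ?_ ht
  intro t' ht'
  nth_rw 1 [← hα]
  rw [ODE.FunSpace.compProj_of_mem ht', ODE.FunSpace.next_apply]

theorem gronwallBound_zero_le {K ε t : ℝ} (hK : 0 < K) (hε : 0 ≤ ε) (ht : t ≤ 1) :
    gronwallBound 0 K ε t ≤ ε * (Real.exp K / K) := by
  rw [gronwallBound_of_K_ne_0 hK.ne']
  have : Real.exp (K * t) ≤ Real.exp K := Real.exp_le_exp.2 (by nlinarith)
  simp only [zero_mul, zero_add]
  calc ε / K * (Real.exp (K * t) - 1) ≤ ε / K * Real.exp K := by gcongr; linarith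
    _ = ε * (Real.exp K / K) := by ring

theorem norm_le_of_hasDerivWithinAt_Icc {f f' : ℝ → G} {K ε : ℝ} (hK : 0 < K) (hε : 0 ≤ ε)
    (hf : ∀ t ∈ Set.Icc (0 : ℝ) 1, HasDerivWithinAt f (f' t) (Set.Icc 0 1) t) (h0 : f 0 = 0)
    (bound : ∀ t ∈ Set.Ico (0 : ℝ) 1, ‖f' t‖ ≤ K * ‖f t‖ + ε) {t : ℝ} (ht : t ∈ Set.Icc (0 : ℝ) 1) :
    ‖f t‖ ≤ ε * (Real.exp K / K) := by
  have := norm_le_gronwallBound_of_norm_deriv_right_le (f := f) (f' := f') (δ := 0) (K := K)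
    (ε := ε) (a := 0) (b := 1) (fun t ht => (hf t ht).continuousWithinAt)
    (fun t ht => (hf t (Set.Ico_subset_Icc_self ht)).mono_of_mem_nhdsWithin
      (Filter.mem_of_superset (Icc_mem_nhdsGE_of_mem ⟨ht.1, ht.2⟩) le_rfl)) (by simp [h0]) bound t ht
  rw [sub_zero] at this
  exact this.trans (gronwallBound_zero_le hK hε ht.2)

/-- Solutions of `θ' = V(θ) u` depend differentiably on `u` with derivative `V(θ(1))`, if `V` is
integrable along them. -/
theorem hasFDerivAt_of_integrable {V : G → E →L[ℝ] G} {B : Set G} (hB : Convex ℝ B)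
    (hBc : IsCompact B) (hVd : ∀ x ∈ B, DifferentiableAt ℝ V x)
    (hVc : ContinuousOn (fderiv ℝ V) B) {r : ℝ} {θ : E → ℝ → G} {p : G}
    (h0 : ∀ u ∈ Metric.ball (0 : E) r, θ u 0 = p)
    (hθB : ∀ u ∈ Metric.ball (0 : E) r, ∀ t ∈ Set.Icc (0 : ℝ) 1, θ u t ∈ B)
    (hθ : ∀ u ∈ Metric.ball (0 : E) r, ∀ t ∈ Set.Icc (0 : ℝ) 1,
      HasDerivWithinAt (θ u) (V (θ u t) u) (Set.Icc 0 1) t)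
    (hint : ∀ u ∈ Metric.ball (0 : E) r, ∀ t ∈ Set.Icc (0 : ℝ) 1, ∀ v w,
      fderiv ℝ V (θ u t) (V (θ u t) v) w = fderiv ℝ V (θ u t) (V (θ u t) w) v)
    {u : E} (hu : u ∈ Metric.ball (0 : E) r) :
    HasFDerivAt (fun u => θ u 1) (V (θ u 1)) u := by
  obtain ⟨C, hC⟩ := hBc.exists_bound_of_continuousOn (f := V)
    (fun x hx => (hVd x hx).continuousAt.continuousWithinAt)
  obtain ⟨C₁, hC₁⟩ := hBc.exists_bound_of_continuousOn (f := fderiv ℝ V) hVc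
  have hr : 0 < r := by
    have := (norm_nonneg u).trans_lt (mem_ball_zero_iff.1 hu)
    exact this
  have h1 : (1 : ℝ) ∈ Set.Icc (0 : ℝ) 1 := ⟨zero_le_one, le_rfl⟩
  have hC0 : 0 ≤ C := (norm_nonneg _).trans (hC _ (hθB u hu 1 h1))
  have hC₁0 : 0 ≤ C₁ := (norm_nonneg _).trans (hC₁ _ (hθB u hu 1 h1))
  have hLip : ∀ x ∈ B, ∀ y ∈ B, ‖V y - V x‖ ≤ C₁ * ‖y - x‖ := fun x hx y hy =>
    hB.norm_image_sub_le_of_norm_fderiv_le hVd hC₁ hx hy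
  -- The `+ 1` only makes `K` positive, so that one form of the Gronwall bound applies.
  set K := C₁ * r + 1 with hKdef
  have hK : 0 < K := by positivity
  set Q := Real.exp K / K with hQdef
  have hQ : 0 < Q := by positivity
  have hΔ : ∀ v, u + v ∈ Metric.ball (0 : E) r → ∀ t ∈ Set.Icc (0 : ℝ) 1,
      ‖θ (u + v) t - θ u t‖ ≤ C * ‖v‖ * Q := by
    intro v hv t ht
    refine norm_le_of_hasDerivWithinAt_Icc hK (by positivity)
      (fun t ht => (hθ _ hv t ht).sub (hθ u hu t ht)) (by rw [Pi.sub_apply, h0 _ hv, h0 u hu, sub_self]) ?_ ht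
    intro t ht
    have ht' := Set.Ico_subset_Icc_self ht
    have e : V (θ (u + v) t) (u + v) - V (θ u t) u =
        (V (θ (u + v) t) - V (θ u t)) u + V (θ (u + v) t) v := by
      simp only [map_add, sub_apply]; abel
    rw [e]
    refine (norm_add_le _ _).trans (add_le_add ?_ ?_)
    · refine (ContinuousLinearMap.le_opNorm _ _).trans ?_
      refine (mul_le_mul (hLip _ (hθB u hu t ht') _ (hθB _ hv t ht')) (mem_ball_zero_iff.1 hu).le
        (norm_nonneg _) (by positivity)).trans ?_
      rw [Pi.sub_apply, hKdef]
      nlinarith [norm_nonneg (θ (u + v) t - θ u t)]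
    · exact (ContinuousLinearMap.le_opNorm _ _).trans
        (mul_le_mul_of_nonneg_right (hC _ (hθB _ hv t ht')) (norm_nonneg _))
  have huc : UniformContinuousOn (fderiv ℝ V) B := hBc.uniformContinuousOn_of_continuous hVc
  have hunif : ∀ η > 0, ∃ d > 0, ∀ x ∈ B, ∀ y ∈ B, ‖y - x‖ < d →
      ‖V y - V x - fderiv ℝ V x (y - x)‖ ≤ η * ‖y - x‖ := by
    intro η hη
    obtain ⟨d, hd, hdη⟩ := (Metric.uniformContinuousOn_iff_le (f := fderiv ℝ V)).1 huc η hη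
    refine ⟨d, hd, fun x hx y hy hxy => ?_⟩
    refine (hB.inter (convex_closedBall x d)).norm_image_sub_le_of_norm_fderiv_le'
      (fun z hz => hVd z hz.1) (fun z hz => ?_) ⟨hx, Metric.mem_closedBall_self hd.le⟩
      ⟨hy, mem_closedBall_iff_norm.2 hxy.le⟩
    rw [← dist_eq_norm]
    exact hdη z hz.1 x hx hz.2
  rw [hasFDerivAt_iff_isLittleO_nhds_zero, Asymptotics.isLittleO_iff]
  intro ε hε
  -- Scaling by `S` makes the Taylor error contribute at most `ε / 2 * ‖v‖` at time 1; the other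
  -- half is for the quadratic error.
  set S := r * C * Q * Q + 1 with hS
  have hSpos : 0 < S := by positivity
  obtain ⟨d, hd, hdη⟩ := hunif (ε / 2 / S) (by positivity)
  have hev1 : ∀ᶠ v : E in 𝓝 0, u + v ∈ Metric.ball (0 : E) r := by
    have : Filter.Tendsto (fun v : E => u + v) (𝓝 0) (𝓝 u) := by
      simpa only [add_zero] using (show Continuous fun v : E => u + v by fun_prop).tendsto 0
    exact this (Metric.isOpen_ball.mem_nhds hu)
  have hsmall : ∀ c : ℝ, 0 ≤ c → ∀ d > 0, ∀ᶠ v : E in 𝓝 0, c * ‖v‖ < d := by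
    intro c hc d hd
    have : Filter.Tendsto (fun v : E => c * ‖v‖) (𝓝 0) (𝓝 0) := by
      simpa only [norm_zero, mul_zero] using (show Continuous fun v : E => c * ‖v‖ by fun_prop).tendsto 0
    exact this (Iio_mem_nhds hd)
  filter_upwards [hev1, hsmall (C * Q) (by positivity) d hd,
    hsmall (C₁ * C * Q * Q) (by positivity) (ε / 2) (by positivity)] with v hv hvd hvε
  -- By integrability `t • V (θ u t) v` solves the linearized equation, so it is the candidate for
  -- the first variation of `θ u t`. Gronwall is applied to the remainder.
  have hderiv : ∀ t ∈ Set.Icc (0 : ℝ) 1,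
      HasDerivWithinAt (fun t => θ (u + v) t - θ u t - t • V (θ u t) v)
        (V (θ (u + v) t) (u + v) - V (θ u t) u -
          (t • fderiv ℝ V (θ u t) (V (θ u t) u) v + (1 : ℝ) • V (θ u t) v)) (Set.Icc 0 1) t := by
    intro t ht
    refine ((hθ _ hv t ht).sub (hθ u hu t ht)).sub ?_
    have h2 : HasDerivWithinAt (fun t => V (θ u t)) (fderiv ℝ V (θ u t) (V (θ u t) u))
        (Set.Icc 0 1) t :=
      (hVd _ (hθB u hu t ht)).hasFDerivAt.comp_hasDerivWithinAt t (hθ u hu t ht)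
    have h3 : HasDerivWithinAt (fun t => V (θ u t) v) (fderiv ℝ V (θ u t) (V (θ u t) u) v)
        (Set.Icc 0 1) t := by
      simpa using h2.clm_apply (hasDerivWithinAt_const t _ v)
    exact (hasDerivWithinAt_id t _).smul h3
  have hfin := norm_le_of_hasDerivWithinAt_Icc hK
    (ε := ε / 2 / S * (C * ‖v‖ * Q) * r + C₁ * (C * ‖v‖ * Q) * ‖v‖) (by positivity) hderiv
    (by simp [h0 _ hv, h0 u hu]) ?_ h1
  · simp only [one_smul] at hfin
    refine hfin.trans ?_
    have : (ε / 2 / S * (C * ‖v‖ * Q) * r + C₁ * (C * ‖v‖ * Q) * ‖v‖) * Q =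
        (ε / 2 * ((r * C * Q * Q) / S) + (C₁ * C * Q * Q) * ‖v‖) * ‖v‖ := by ring
    rw [this]
    gcongr
    have : (r * C * Q * Q) / S ≤ 1 := (div_le_one hSpos).2 (by linarith)
    nlinarith
  · intro t ht
    have ht' := Set.Ico_subset_Icc_self ht
    set x := θ u t with hx
    set y := θ (u + v) t with hy
    have hxB : x ∈ B := hθB u hu t ht'
    have hyB : y ∈ B := hθB _ hv t ht'
    have hyx : ‖y - x‖ ≤ C * ‖v‖ * Q := hΔ v hv t ht'
    -- After exchanging `u` and `v` by integrability, the first term is linear in the remainder, the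
    -- second is a Taylor error and the third is quadratic in `v`.
    have e : V y (u + v) - V x u - (t • fderiv ℝ V x (V x u) v + (1 : ℝ) • V x v) =
        fderiv ℝ V x (y - x - t • V x v) u + (V y - V x - fderiv ℝ V x (y - x)) u +
          (V y - V x) v := by
      rw [hint u hu t ht' u v]
      simp only [map_add, map_sub, map_smul, sub_apply, one_smul,
        smul_apply, ← hx]
      abel
    rw [e]
    have hur : ‖u‖ ≤ r := (mem_ball_zero_iff.1 hu).le
    rw [← add_assoc]
    refine (norm_add₃_le).trans (add_le_add_three ?_ ?_ ?_)
    · refine (ContinuousLinearMap.le_opNorm _ _).trans ?_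
      have h4 := (ContinuousLinearMap.le_opNorm (fderiv ℝ V x) (y - x - t • V x v)).trans
        (mul_le_mul_of_nonneg_right (hC₁ x hxB) (norm_nonneg _))
      refine (mul_le_mul h4 hur (norm_nonneg _) (by positivity)).trans ?_
      rw [hKdef]
      nlinarith [norm_nonneg (y - x - t • V x v)]
    · refine (ContinuousLinearMap.le_opNorm _ _).trans ?_
      refine mul_le_mul ((hdη x hxB y hyB ?_).trans ?_) hur (norm_nonneg _) (by positivity)
      · refine hyx.trans_lt ?_
        rwa [mul_right_comm]
      · gcongr
    · refine (ContinuousLinearMap.le_opNorm _ _).trans ?_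
      refine mul_le_mul_of_nonneg_right ((hLip x hxB y hyB).trans ?_) (norm_nonneg _)
      gcongr

/-- Bootstrapping: `DΘ = V(Θ)` is continuous because `Θ` is, so `Θ` is `C^1`; then `V(Θ)` is `C^1`,
so `Θ` is `C^2`. -/
theorem contDiffOn_two_of_hasFDerivAt {V : G → E →L[ℝ] G} {U : Set G}
    (hV : ContDiffOn ℝ 1 V U) {Θ : E → G} {S : Set E} (hS : IsOpen S) (hΘU : ∀ u ∈ S, Θ u ∈ U)
    (hΘ : ∀ u ∈ S, HasFDerivAt Θ (V (Θ u)) u) : ContDiffOn ℝ 2 Θ S := by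
  have hd : DifferentiableOn ℝ Θ S := fun u hu => (hΘ u hu).differentiableAt.differentiableWithinAt
  have he : ∀ u ∈ S, fderiv ℝ Θ u = V (Θ u) := fun u hu => (hΘ u hu).fderiv
  have h1 : ContDiffOn ℝ 1 Θ S := by
    rw [show (1 : WithTop ℕ∞) = 0 + 1 by norm_num, contDiffOn_succ_iff_fderiv_of_isOpen hS]
    refine ⟨hd, by simp, contDiffOn_zero.2 ?_⟩
    exact (hV.continuousOn.comp hd.continuousOn hΘU).congr he
  rw [show (2 : WithTop ℕ∞) = 1 + 1 by norm_num, contDiffOn_succ_iff_fderiv_of_isOpen hS]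
  exact ⟨hd, by simp, (hV.comp h1 hΘU).congr he⟩

/-- The local Frobenius theorem: the total differential equation `DΘ = V(Θ)`, `Θ(0) = p`, has a
solution if the integrability condition holds on all curves that solve `θ' = V(θ) u`. -/
theorem exists_frobenius_solution [FiniteDimensional ℝ G] {V : G → E →L[ℝ] G} {U : Set G}
    (hU : IsOpen U) {p : G} (hp : p ∈ U) (hV : ContDiffOn ℝ 1 V U) (P : Set G) {ρ : ℝ} (hρ : 0 < ρ)
    (hP : ∀ u : E, ‖u‖ < ρ → ∀ θ : ℝ → G, θ 0 = p → (∀ t ∈ Set.Icc (0 : ℝ) 1, θ t ∈ U) →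
      (∀ t ∈ Set.Icc (0 : ℝ) 1, HasDerivWithinAt θ (V (θ t) u) (Set.Icc 0 1) t) →
      ∀ t ∈ Set.Icc (0 : ℝ) 1, θ t ∈ P)
    (hint : ∀ x ∈ U ∩ P, ∀ v w, fderiv ℝ V x (V x v) w = fderiv ℝ V x (V x w) v) :
    ∃ r > 0, ∃ Θ : E → G, Θ 0 = p ∧ (∀ u ∈ Metric.ball 0 r, Θ u ∈ U ∩ P) ∧
      (∀ u ∈ Metric.ball 0 r, HasFDerivAt Θ (V (Θ u)) u) ∧ ContDiffOn ℝ 2 Θ (Metric.ball 0 r) := by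
  have : CompleteSpace G := FiniteDimensional.complete ℝ G
  have : ProperSpace G := FiniteDimensional.proper ℝ G
  obtain ⟨a, ha, haU⟩ := Metric.nhds_basis_closedBall.mem_iff.1 (hU.mem_nhds hp)
  set B := Metric.closedBall p a with hBdef
  have hBc : IsCompact B := isCompact_closedBall _ _
  have hB : Convex ℝ B := convex_closedBall _ _
  have hVd : ∀ x ∈ B, DifferentiableAt ℝ V x := fun x hx =>
    (hV.contDiffAt (hU.mem_nhds (haU hx))).differentiableAt one_ne_zero
  have hVc : ContinuousOn (fderiv ℝ V) B :=
    (hV.continuousOn_fderiv_of_isOpen hU le_rfl).mono haU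
  obtain ⟨C, hC⟩ := hBc.exists_bound_of_continuousOn (f := V)
    (fun x hx => (hVd x hx).continuousAt.continuousWithinAt)
  obtain ⟨C₁, hC₁⟩ := hBc.exists_bound_of_continuousOn (f := fderiv ℝ V) hVc
  have hpB : p ∈ B := Metric.mem_closedBall_self ha.le
  have hC0 : 0 ≤ C := (norm_nonneg _).trans (hC p hpB)
  have hC₁0 : 0 ≤ C₁ := (norm_nonneg _).trans (hC₁ p hpB)
  -- For `‖u‖ < r` the speed `C * ‖u‖` is at most `a`, so the solution exists in `B` for unit time;
  -- the bound `ρ` keeps it in `P`.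
  set r := min ρ (a / (C + 1)) with hrdef
  have hr : 0 < r := lt_min hρ (by positivity)
  have hrC : C * r ≤ a := by
    have : r ≤ a / (C + 1) := min_le_right _ _
    rw [le_div_iff₀ (by positivity)] at this
    nlinarith
  have hex : ∀ u : E, ∃ θ : ℝ → G, u ∈ Metric.ball (0 : E) r → θ 0 = p ∧ (∀ t, θ t ∈ B) ∧
      ∀ t ∈ Set.Icc (0 : ℝ) 1, HasDerivWithinAt θ (V (θ t) u) (Set.Icc 0 1) t := by
    intro u
    by_cases hu : u ∈ Metric.ball (0 : E) r
    · have hur : ‖u‖ ≤ r := (mem_ball_zero_iff.1 hu).le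
      have hPL : IsPicardLindelof (fun _ x => V x u) (tmin := 0) (tmax := 1)
          ⟨0, le_rfl, zero_le_one⟩ p ⟨a, ha.le⟩ 0 ⟨C * r, by positivity⟩ ⟨C₁ * r, by positivity⟩ := by
        refine IsPicardLindelof.of_time_independent (fun x hx => ?_) ?_ ?_
        · exact (ContinuousLinearMap.le_opNorm _ _).trans
            (mul_le_mul (hC x hx) hur (norm_nonneg _) hC0)
        · refine LipschitzOnWith.of_dist_le_mul fun x hx y hy => ?_
          rw [dist_eq_norm, dist_eq_norm, ← sub_apply]
          refine (ContinuousLinearMap.le_opNorm _ _).trans ?_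
          have := hB.norm_image_sub_le_of_norm_fderiv_le hVd hC₁ hy hx
          refine (mul_le_mul this hur (norm_nonneg _) (by positivity)).trans (le_of_eq ?_)
          change _ = C₁ * r * _
          ring
        · change C * r * max ((1 : ℝ) - 0) (0 - 0) ≤ a - 0
          simpa using hrC
      obtain ⟨α, h0, hb, hd⟩ := hPL.exists_hasDerivWithinAt_mem_closedBall
      exact ⟨α, fun _ => ⟨h0, hb, hd⟩⟩
    · exact ⟨fun _ => p, fun h => absurd h hu⟩
  choose θ hθ using hex
  have hθP : ∀ u ∈ Metric.ball (0 : E) r, ∀ t ∈ Set.Icc (0 : ℝ) 1, θ u t ∈ P := fun u hu =>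
    hP u ((mem_ball_zero_iff.1 hu).trans_le (min_le_left _ _)) (θ u) (hθ u hu).1
      (fun t _ => haU ((hθ u hu).2.1 t)) (hθ u hu).2.2
  have hΘ : ∀ u ∈ Metric.ball (0 : E) r, HasFDerivAt (fun u => θ u 1) (V (θ u 1)) u :=
    fun u hu => hasFDerivAt_of_integrable hB hBc hVd hVc (fun u hu => (hθ u hu).1)
      (fun u hu t _ => (hθ u hu).2.1 t) (fun u hu => (hθ u hu).2.2)
      (fun u hu t ht v w => hint _ ⟨haU ((hθ u hu).2.1 t), hθP u hu t ht⟩ v w) hu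
  refine ⟨r, hr, fun u => θ u 1, ?_, fun u hu => ⟨haU ((hθ u hu).2.1 1),
    hθP u hu 1 ⟨zero_le_one, le_rfl⟩⟩, hΘ, contDiffOn_two_of_hasFDerivAt hV Metric.isOpen_ball
    (fun u hu => haU ((hθ u hu).2.1 1)) hΘ⟩
  have h0r : (0 : E) ∈ Metric.ball (0 : E) r := Metric.mem_ball_self hr
  have hz := norm_le_of_hasDerivWithinAt_Icc (f := fun t => θ 0 t - p) (f' := fun _ => 0)
    one_pos le_rfl (fun t ht => by simpa using ((hθ 0 h0r).2.2 t ht).sub_const p)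
    (by simp [(hθ 0 h0r).1]) (fun t _ => by simp) (t := 1) ⟨zero_le_one, le_rfl⟩
  simpa [sub_eq_zero] using hz

end Frobenius

/-! ### Normalized frames and the transversal components of the fields -/

section Frames

variable {q : ℕ} {E G : Type*} [NormedAddCommGroup E] [NormedSpace ℝ E]
  [NormedAddCommGroup G] [NormedSpace ℝ G]

/-- The combination `u ↦ ∑ k, ℓ_k(u) A_k(x)` of the vector fields `A_k`. -/
def fieldCombination (A : Fin q → G → G) (ℓ : Fin q → E →L[ℝ] ℝ) (x : G) : E →L[ℝ] G :=
  ∑ k, (ℓ k).smulRight (A k x)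

theorem fieldCombination_apply (A : Fin q → G → G) (ℓ : Fin q → E →L[ℝ] ℝ) (x : G) (u : E) :
    fieldCombination A ℓ x u = ∑ k, ℓ k u • A k x := by
  simp [fieldCombination]

/-- Combinations of the `C^1` vector fields `A_k` on an open set `U` that are mapped to a basis by
a linear projection `π`. -/
structure AdaptedFrame (A : Fin q → G → G) (E : Type*) [NormedAddCommGroup E] [NormedSpace ℝ E] where
  U : Set G
  isOpen : IsOpen U
  contDiffOn : ∀ k, ContDiffOn ℝ 1 (A k) U
  π : G →L[ℝ] E
  ℓ : Fin q → E →L[ℝ] ℝ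
  C : ℝ
  invertible : ∀ x ∈ U, (π ∘L fieldCombination A ℓ x).IsInvertible
  norm_le : ∀ x ∈ U, ‖(π ∘L fieldCombination A ℓ x).inverse‖ ≤ C

namespace AdaptedFrame

variable {A : Fin q → G → G} (F : AdaptedFrame A E)

/-- The coefficients of the normalized frame. -/
def coeff (x : G) : E →L[ℝ] E := (F.π ∘L fieldCombination A F.ℓ x).inverse

/-- The normalized frame, which satisfies `π ∘ V = id`. -/
def V (x : G) : E →L[ℝ] G := fieldCombination A F.ℓ x ∘L F.coeff x

/-- The component of `A_j` that is transversal to the frame. -/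
def R (j : Fin q) (x : G) : G := A j x - F.V x (F.π (A j x))

variable {F} {x : G}

theorem π_fieldCombination_coeff (hx : x ∈ F.U) (u : E) :
    F.π (fieldCombination A F.ℓ x (F.coeff x u)) = u := by
  obtain ⟨e, he⟩ := F.invertible x hx
  have h := DFunLike.congr_fun he (F.coeff x u)
  have h2 : F.coeff x u = e.symm u := by
    rw [coeff, ← he, ContinuousLinearMap.inverse_equiv]; rfl
  rw [ContinuousLinearMap.comp_apply] at h
  rw [← h, h2]
  exact e.apply_symm_apply u

theorem coeff_π_fieldCombination (hx : x ∈ F.U) (u : E) :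
    F.coeff x (F.π (fieldCombination A F.ℓ x u)) = u := by
  obtain ⟨e, he⟩ := F.invertible x hx
  have h := DFunLike.congr_fun he u
  rw [ContinuousLinearMap.comp_apply] at h
  rw [← h, coeff, ← he, ContinuousLinearMap.inverse_equiv]
  exact e.symm_apply_apply u

theorem π_V (hx : x ∈ F.U) (u : E) : F.π (F.V x u) = u := π_fieldCombination_coeff hx u

theorem V_apply (x : G) (u : E) : F.V x u = ∑ k, F.ℓ k (F.coeff x u) • A k x :=
  fieldCombination_apply A F.ℓ x _

theorem V_π_fieldCombination (hx : x ∈ F.U) (u : E) :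
    F.V x (F.π (fieldCombination A F.ℓ x u)) = fieldCombination A F.ℓ x u := by
  rw [V, ContinuousLinearMap.comp_apply, coeff_π_fieldCombination hx]

theorem contDiffOn_fieldCombination : ContDiffOn ℝ 1 (fieldCombination A F.ℓ) F.U := by
  unfold fieldCombination
  refine ContDiffOn.sum fun k _ => ?_
  exact (ContinuousLinearMap.smulRightL ℝ E G (F.ℓ k)).contDiff.comp_contDiffOn (F.contDiffOn k)

theorem contDiffOn_coeff [CompleteSpace E] : ContDiffOn ℝ 1 F.coeff F.U := by
  intro x hx
  obtain ⟨e, he⟩ := F.invertible x hx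
  have h1 : ContDiffAt ℝ 1 (fun y => F.π ∘L fieldCombination A F.ℓ y) x :=
    contDiffAt_const.clm_comp (contDiffOn_fieldCombination.contDiffAt (F.isOpen.mem_nhds hx))
  have h2 : ContDiffAt ℝ 1 ContinuousLinearMap.inverse (F.π ∘L fieldCombination A F.ℓ x) := by
    rw [← he]; exact contDiffAt_map_inverse e
  exact (h2.comp x h1).contDiffWithinAt

theorem contDiffOn_V [CompleteSpace E] : ContDiffOn ℝ 1 F.V F.U :=
  contDiffOn_fieldCombination.clm_comp contDiffOn_coeff

theorem differentiableAt_V [CompleteSpace E] (hx : x ∈ F.U) : DifferentiableAt ℝ F.V x :=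
  (contDiffOn_V.contDiffAt (F.isOpen.mem_nhds hx)).differentiableAt one_ne_zero

theorem differentiableAt_field (F : AdaptedFrame A E) (hx : x ∈ F.U) (k : Fin q) :
    DifferentiableAt ℝ (A k) x :=
  ((F.contDiffOn k).contDiffAt (F.isOpen.mem_nhds hx)).differentiableAt one_ne_zero

/-- The projection to `ker π` along the frame. -/
def proj (F : AdaptedFrame A E) (x : G) : G →L[ℝ] G := ContinuousLinearMap.id ℝ G - F.V x ∘L F.π

theorem proj_apply (x y : G) : F.proj x y = y - F.V x (F.π y) := rfl

theorem proj_field (j : Fin q) (x : G) : F.proj x (A j x) = F.R j x := rfl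

theorem fderiv_fieldCombination_apply (hx : x ∈ F.U) (a : G) (u : E) :
    fderiv ℝ (fieldCombination A F.ℓ) x a u = ∑ k, F.ℓ k u • fderiv ℝ (A k) x a := by
  have hd : DifferentiableAt ℝ (fieldCombination A F.ℓ) x :=
    (contDiffOn_fieldCombination.contDiffAt (F.isOpen.mem_nhds hx)).differentiableAt one_ne_zero
  have h1 : HasFDerivAt (fun y => fieldCombination A F.ℓ y u)
      ((fderiv ℝ (fieldCombination A F.ℓ) x).flip u) x := by
    simpa using hd.hasFDerivAt.clm_apply (hasFDerivAt_const u x)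
  have h2 : HasFDerivAt (fun y => fieldCombination A F.ℓ y u)
      (∑ k, F.ℓ k u • fderiv ℝ (A k) x) x := by
    simp only [fieldCombination_apply]
    exact HasFDerivAt.fun_sum fun k _ => (F.differentiableAt_field hx k).hasFDerivAt.const_smul _
  have := DFunLike.congr_fun (h1.unique h2) a
  simpa using this

/-- The derivative of the normalized frame in terms of derivatives of the vector fields. -/
theorem fderiv_V_apply [CompleteSpace E] (hx : x ∈ F.U) (a : G) (u : E) :
    fderiv ℝ F.V x a u = F.proj x (∑ k, F.ℓ k (F.coeff x u) • fderiv ℝ (A k) x a) := by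
  set w := F.coeff x u with hw
  have hT : DifferentiableAt ℝ (fieldCombination A F.ℓ) x :=
    (contDiffOn_fieldCombination.contDiffAt (F.isOpen.mem_nhds hx)).differentiableAt one_ne_zero
  have hTw : HasFDerivAt (fun y => fieldCombination A F.ℓ y w)
      ((fderiv ℝ (fieldCombination A F.ℓ) x).flip w) x := by
    simpa using hT.hasFDerivAt.clm_apply (hasFDerivAt_const w x)
  -- Differentiating `V(π(T w)) = T w`, where `T` is the unnormalized frame and `w` is frozen at its
  -- value at `x`, avoids differentiating the inverse in `V`.
  have h1 := (differentiableAt_V hx).hasFDerivAt.clm_apply (F.π.hasFDerivAt.comp x hTw)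
  have h2 := h1.congr_of_eventuallyEq (f₁ := fun y => fieldCombination A F.ℓ y w) (by
    filter_upwards [F.isOpen.mem_nhds hx] with y hy using (V_π_fieldCombination hy w).symm)
  have h3 := DFunLike.congr_fun (h2.unique hTw) a
  simp only [add_apply, ContinuousLinearMap.comp_apply,
    ContinuousLinearMap.flip_apply, Function.comp_apply] at h3
  rw [π_fieldCombination_coeff hx, fderiv_fieldCombination_apply hx] at h3
  rw [proj_apply, ← h3, map_add, map_add, π_V hx]
  have h4 : F.π (fderiv ℝ F.V x a u) = 0 := by
    have h5 : HasFDerivAt (fun y => F.π (F.V y u)) (F.π ∘L (fderiv ℝ F.V x).flip u) x := by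
      have := (differentiableAt_V hx).hasFDerivAt.clm_apply (hasFDerivAt_const u x)
      exact F.π.hasFDerivAt.comp x (by simpa using this)
    have h6 := h5.congr_of_eventuallyEq (f₁ := fun _ => u) (by
      filter_upwards [F.isOpen.mem_nhds hx] with y hy using (π_V hy u).symm)
    simpa using DFunLike.congr_fun (h6.unique (hasFDerivAt_const u x)) a
  rw [h4]
  simp

theorem hasFDerivAt_R [CompleteSpace E] (hx : x ∈ F.U) (j : Fin q) :
    HasFDerivAt (F.R j) (fderiv ℝ (A j) x - (F.V x ∘L F.π ∘L fderiv ℝ (A j) x +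
      (fderiv ℝ F.V x).flip (F.π (A j x)))) x := by
  have hA := (F.differentiableAt_field hx j).hasFDerivAt
  exact hA.sub ((differentiableAt_V hx).hasFDerivAt.clm_apply (F.π.hasFDerivAt.comp x hA))

theorem proj_sum_field (d : Fin q → ℝ) (x : G) :
    F.proj x (∑ l, d l • A l x) = ∑ l, d l • F.R l x := by
  simp only [map_sum, map_smul, proj_field]

/-- The bracket relation exchanges the derivative of `A_j` along `A_k` for that of `A_k` along
`A_j`, and likewise for the `A_i` in the frame part of `A_j`. Since `A_j` minus its frame part is
`R_j` and the projection maps `A_l` to `R_l`, every term is linear in the `R`'s. The `c`'s enter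
only through their values at `x`. -/
theorem fderiv_R_apply [CompleteSpace E] (hx : x ∈ F.U) {c : Fin q → Fin q → Fin q → ℝ}
    (hc : ∀ i j, VectorField.lieBracket ℝ (A i) (A j) x = ∑ l, c i j l • A l x) (j k : Fin q) :
    fderiv ℝ (F.R j) x (A k x) = F.proj x (fderiv ℝ (A k) x (F.R j x)) + ∑ l, c k j l • F.R l x -
      ∑ i, F.ℓ i (F.coeff x (F.π (A j x))) • ∑ l, c k i l • F.R l x := by
  have hb : ∀ i, fderiv ℝ (A i) x (A k x) = fderiv ℝ (A k) x (A i x) + ∑ l, c k i l • A l x := by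
    intro i
    rw [← hc k i, VectorField.lieBracket]
    abel
  rw [(hasFDerivAt_R hx j).fderiv]
  have e : (fderiv ℝ (A j) x - (F.V x ∘L F.π ∘L fderiv ℝ (A j) x +
      (fderiv ℝ F.V x).flip (F.π (A j x)))) (A k x) =
      F.proj x (fderiv ℝ (A j) x (A k x)) - fderiv ℝ F.V x (A k x) (F.π (A j x)) := by
    simp [proj_apply, sub_sub]
  rw [e, fderiv_V_apply hx, hb j, map_add, proj_sum_field]
  have hR : fderiv ℝ (A k) x (F.R j x) = fderiv ℝ (A k) x (A j x) -
      ∑ i, F.ℓ i (F.coeff x (F.π (A j x))) • fderiv ℝ (A k) x (A i x) := by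
    rw [R, V_apply]
    simp only [map_sub, map_sum, map_smul]
  simp only [hR, hb, smul_add, Finset.sum_add_distrib, map_add, map_sub, map_sum, map_smul,
    proj_field]
  abel

/-- The frame is integrable at points where all the fields lie in its span. -/
theorem integrable [CompleteSpace E] (hx : x ∈ F.U) {c : Fin q → Fin q → Fin q → ℝ}
    (hc : ∀ i j, VectorField.lieBracket ℝ (A i) (A j) x = ∑ l, c i j l • A l x)
    (hR : ∀ j, F.R j x = 0) (v w : E) :
    fderiv ℝ F.V x (F.V x v) w = fderiv ℝ F.V x (F.V x w) v := by
  -- The brackets are combinations of the `A_l`, which the projection maps to `R_l = 0`.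
  have hb : ∀ i k, F.proj x (fderiv ℝ (A i) x (A k x)) = F.proj x (fderiv ℝ (A k) x (A i x)) := by
    intro i k
    have h1 : fderiv ℝ (A i) x (A k x) = fderiv ℝ (A k) x (A i x) + ∑ l, c k i l • A l x := by
      rw [← hc k i, VectorField.lieBracket]
      abel
    rw [h1, map_add, proj_sum_field]
    simp [hR]
  rw [fderiv_V_apply hx, fderiv_V_apply hx, V_apply x v, V_apply x w]
  simp only [map_sum, map_smul, Finset.smul_sum]
  rw [Finset.sum_comm]
  refine Finset.sum_congr rfl fun k _ => Finset.sum_congr rfl fun i _ => ?_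
  rw [hb i k, smul_comm]

theorem V_injective (hx : x ∈ F.U) : Function.Injective (F.V x) :=
  Function.LeftInverse.injective (π_V hx)

theorem span_eq_range_V (hR : ∀ j, F.R j x = 0) :
    Submodule.span ℝ (Set.range fun j => A j x) = LinearMap.range (F.V x : E →ₗ[ℝ] G) := by
  apply le_antisymm
  · rw [Submodule.span_le]
    rintro _ ⟨j, rfl⟩
    exact ⟨F.π (A j x), (sub_eq_zero.1 (hR j)).symm⟩
  · rintro _ ⟨u, rfl⟩
    have : F.V x u = _ := V_apply x u
    rw [ContinuousLinearMap.coe_coe, this]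
    exact Submodule.sum_mem _ fun k _ => Submodule.smul_mem _ _ (Submodule.subset_span ⟨k, rfl⟩)

/-- Where the `R_j` vanish, the span of the fields is the range of the injective `V x`. Propagating
`R = 0` therefore propagates the rank. -/
theorem finrank_span (hx : x ∈ F.U) (hR : ∀ j, F.R j x = 0) :
    Module.finrank ℝ (Submodule.span ℝ (Set.range fun j => A j x)) = Module.finrank ℝ E := by
  rw [span_eq_range_V hR]
  exact LinearMap.finrank_range_of_inj (V_injective hx)

theorem span_π_eq_top (hx : x ∈ F.U) :
    Submodule.span ℝ (Set.range fun j => F.π (A j x)) = ⊤ := by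
  rw [eq_top_iff]
  rintro u -
  rw [← π_V hx u, V_apply, map_sum]
  refine Submodule.sum_mem _ fun k _ => ?_
  rw [map_smul]
  exact Submodule.smul_mem _ _ (Submodule.subset_span ⟨k, rfl⟩)

/-- Near a point with all `R_j` controlled brackets, the derivatives of the `R_j` along the fields
are dominated by the `R_j`. -/
theorem exists_bound_fderiv_R [CompleteSpace E] (hx : x ∈ F.U) {Cc : ℝ} (hCc : 0 ≤ Cc) :
    ∃ K ≥ 0, ∀ᶠ y in 𝓝 x, ∀ c : Fin q → Fin q → Fin q → ℝ, (∀ i j l, |c i j l| ≤ Cc) →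
      (∀ i j, VectorField.lieBracket ℝ (A i) (A j) y = ∑ l, c i j l • A l y) →
      ∀ k, ‖fderiv ℝ (fun y j => F.R j y) y (A k y)‖ ≤ K * ‖fun j => F.R j y‖ := by
  have hcont : ContinuousAt (fun y => (‖F.proj y‖, ∑ k, ‖fderiv ℝ (A k) y‖,
      ∑ j, ∑ i, ‖F.ℓ i (F.coeff y (F.π (A j y)))‖)) x := by
    have hn := F.isOpen.mem_nhds hx
    have hV : ContinuousAt F.V x := (contDiffOn_V.contDiffAt hn).continuousAt
    have hco : ContinuousAt F.coeff x := (contDiffOn_coeff.contDiffAt hn).continuousAt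
    have hA : ∀ k, ContinuousAt (A k) x := fun k => ((F.contDiffOn k).contDiffAt hn).continuousAt
    have hdA : ∀ k, ContinuousAt (fderiv ℝ (A k)) x := fun k =>
      ((F.contDiffOn k).continuousOn_fderiv_of_isOpen F.isOpen le_rfl).continuousAt hn
    refine ContinuousAt.prodMk ?_ (ContinuousAt.prodMk ?_ ?_)
    · exact (continuousAt_const.sub (hV.clm_comp continuousAt_const)).norm
    · exact tendsto_finsetSum _ fun k _ => (hdA k).norm
    · refine tendsto_finsetSum _ fun j _ => tendsto_finsetSum _ fun i _ => ?_
      exact ((F.ℓ i).continuous.continuousAt.comp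
        (hco.clm_apply (F.π.continuous.continuousAt.comp (hA j)))).norm
  -- The values at `x` plus 1 are bounds near `x`, on a neighbourhood that does not depend on the
  -- coefficients `c`.
  set b := (‖F.proj x‖ + 1, ∑ k, ‖fderiv ℝ (A k) x‖ + 1,
      ∑ j, ∑ i, ‖F.ℓ i (F.coeff x (F.π (A j x)))‖ + 1) with hb
  have hb1 : 0 ≤ b.1 := by positivity
  have hb2 : 0 ≤ b.2.1 := by simp only [hb]; positivity
  have hb3 : 0 ≤ b.2.2 := by simp only [hb]; positivity
  refine ⟨b.1 * b.2.1 + q * Cc + b.2.2 * (q * Cc), by positivity, ?_⟩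
  have e1 : ∀ᶠ y in 𝓝 x, ‖F.proj y‖ ≤ b.1 :=
    (hcont.fst.eventually_lt_const (lt_add_one _)).mono fun _ h => h.le
  have e2 : ∀ᶠ y in 𝓝 x, ∑ k, ‖fderiv ℝ (A k) y‖ ≤ b.2.1 :=
    (hcont.snd.fst.eventually_lt_const (lt_add_one _)).mono fun _ h => h.le
  have e3 : ∀ᶠ y in 𝓝 x, ∑ j, ∑ i, ‖F.ℓ i (F.coeff y (F.π (A j y)))‖ ≤ b.2.2 :=
    (hcont.snd.snd.eventually_lt_const (lt_add_one _)).mono fun _ h => h.le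
  filter_upwards [e1, e2, e3, F.isOpen.mem_nhds hx] with y h1 h2 h3 hy c hcC hc k
  set N := ‖fun j => F.R j y‖ with hN
  have hRN : ∀ j, ‖F.R j y‖ ≤ N := norm_le_pi_norm (fun j => F.R j y)
  have hN0 : 0 ≤ N := norm_nonneg _
  have hd : HasFDerivAt (fun y j => F.R j y)
      (ContinuousLinearMap.pi fun j => fderiv ℝ (F.R j) y) y :=
    hasFDerivAt_pi.2 fun j => (hasFDerivAt_R hy j).differentiableAt.hasFDerivAt
  rw [hd.fderiv, pi_norm_le_iff_of_nonneg (by positivity)]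
  intro j
  change ‖fderiv ℝ (F.R j) y (A k y)‖ ≤ _
  rw [fderiv_R_apply hy hc]
  have hsum : ∀ i, ‖∑ l, c k i l • F.R l y‖ ≤ q * Cc * N := by
    intro i
    refine (norm_sum_le _ _).trans ((Finset.sum_le_sum (g := fun _ => Cc * N) fun l _ => ?_).trans
      (le_of_eq ?_))
    · rw [norm_smul]
      exact mul_le_mul (hcC k i l) (hRN l) (norm_nonneg _) hCc
    · simp [mul_assoc]
  have t1 : ‖F.proj y (fderiv ℝ (A k) y (F.R j y))‖ ≤ b.1 * b.2.1 * N := by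
    refine (ContinuousLinearMap.le_opNorm _ _).trans ?_
    rw [mul_assoc]
    refine mul_le_mul h1 ((ContinuousLinearMap.le_opNorm _ _).trans ?_) (norm_nonneg _) hb1
    refine mul_le_mul (le_trans ?_ h2) (hRN j) (norm_nonneg _) hb2
    exact Finset.single_le_sum (f := fun k => ‖fderiv ℝ (A k) y‖) (fun _ _ => norm_nonneg _)
      (Finset.mem_univ k)
  have t3 : ‖∑ i, F.ℓ i (F.coeff y (F.π (A j y))) • ∑ l, c k i l • F.R l y‖ ≤
      b.2.2 * (q * Cc * N) := by
    refine (norm_sum_le _ _).trans ?_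
    calc ∑ i, ‖F.ℓ i (F.coeff y (F.π (A j y))) • ∑ l, c k i l • F.R l y‖
        ≤ ∑ i, ‖F.ℓ i (F.coeff y (F.π (A j y)))‖ * (q * Cc * N) :=
          Finset.sum_le_sum fun i _ => by
            rw [norm_smul]; exact mul_le_mul_of_nonneg_left (hsum i) (norm_nonneg _)
      _ = (∑ i, ‖F.ℓ i (F.coeff y (F.π (A j y)))‖) * (q * Cc * N) := by rw [Finset.sum_mul]
      _ ≤ b.2.2 * (q * Cc * N) := by
          refine mul_le_mul_of_nonneg_right (le_trans ?_ h3) (by positivity)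
          exact Finset.single_le_sum (f := fun j => ∑ i, ‖F.ℓ i (F.coeff y (F.π (A j y)))‖)
            (fun _ _ => by positivity) (Finset.mem_univ j)
  refine (norm_sub_le _ _).trans ((add_le_add ((norm_add_le _ _).trans
    (add_le_add t1 (hsum j))) t3).trans (le_of_eq ?_))
  ring

end AdaptedFrame

/-- `ℓ` expresses a basis of the span at `p` through the `A_k p`, and `π` is a linear left inverse
of that basis. Then `π` after the frame is the identity at `p`; invertibility and a bound for the
inverse persist nearby. -/
theorem exists_adaptedFrame [FiniteDimensional ℝ G] {A : Fin q → G → G} {W : Set G} (hW : IsOpen W)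
    (hA : ∀ k, ContDiffOn ℝ 1 (A k) W) {p : G} (hp : p ∈ W) {n : ℕ}
    (hn : Module.finrank ℝ (Submodule.span ℝ (Set.range fun j => A j p)) = n) :
    ∃ F : AdaptedFrame A (EuclideanSpace ℝ (Fin n)), p ∈ F.U ∧ F.U ⊆ W ∧ ∀ j, F.R j p = 0 := by
  set S := Submodule.span ℝ (Set.range fun j => A j p) with hS
  have hfin : Module.finrank ℝ (EuclideanSpace ℝ (Fin n)) = Module.finrank ℝ S := by simp [hn]
  let φ : EuclideanSpace ℝ (Fin n) ≃ₗ[ℝ] S := LinearEquiv.ofFinrankEq _ _ hfin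
  have hran : LinearMap.range (Fintype.linearCombination ℝ (fun j => A j p)) = S :=
    Fintype.range_linearCombination ℝ _
  have hmem : ∀ w, Fintype.linearCombination ℝ (fun j => A j p) w ∈ S := fun w => by
    rw [← hran]; exact ⟨w, rfl⟩
  obtain ⟨g, hg⟩ := ((Fintype.linearCombination ℝ (fun j => A j p)).codRestrict S
    hmem).exists_rightInverse_of_surjective (by
      rw [LinearMap.range_eq_top]
      rintro ⟨y, hy⟩
      rw [← hran] at hy
      obtain ⟨w, hw⟩ := hy
      exact ⟨w, Subtype.ext hw⟩)
  obtain ⟨f, hf⟩ := (S.subtype ∘ₗ φ.toLinearMap).exists_leftInverse_of_injective (by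
    rw [LinearMap.ker_eq_bot]
    exact S.injective_subtype.comp φ.injective)
  let ℓ : Fin q → EuclideanSpace ℝ (Fin n) →L[ℝ] ℝ := fun k =>
    LinearMap.toContinuousLinearMap (LinearMap.proj k ∘ₗ g ∘ₗ φ.toLinearMap)
  let π : G →L[ℝ] EuclideanSpace ℝ (Fin n) := LinearMap.toContinuousLinearMap f
  have hT : ∀ u, fieldCombination A ℓ p u = φ u := by
    intro u
    rw [fieldCombination_apply]
    exact congrArg Subtype.val (DFunLike.congr_fun hg (φ u))
  have hπT : π ∘L fieldCombination A ℓ p = ContinuousLinearMap.id ℝ _ := by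
    ext1 u
    rw [ContinuousLinearMap.comp_apply, hT]
    exact DFunLike.congr_fun hf u
  have hcont : ContinuousOn (fun x => π ∘L fieldCombination A ℓ x) W := by
    refine continuousOn_const.clm_comp ?_
    unfold fieldCombination
    exact continuousOn_finsetSum _ fun k _ =>
      (ContinuousLinearMap.smulRightL ℝ _ G (ℓ k)).continuous.comp_continuousOn (hA k).continuousOn
  have hinv : ContinuousAt ContinuousLinearMap.inverse
      (ContinuousLinearMap.id ℝ (EuclideanSpace ℝ (Fin n))) :=
    (contDiffAt_map_inverse (n := 0) (𝕜 := ℝ)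
      (ContinuousLinearEquiv.refl ℝ (EuclideanSpace ℝ (Fin n)))).continuousAt
  have hQ : ∀ᶠ T : EuclideanSpace ℝ (Fin n) →L[ℝ] EuclideanSpace ℝ (Fin n) in
      𝓝 (ContinuousLinearMap.id ℝ _), T.IsInvertible ∧ ‖T.inverse‖ ≤
        ‖(ContinuousLinearMap.id ℝ (EuclideanSpace ℝ (Fin n))).inverse‖ + 1 := by
    refine Filter.Eventually.and ?_ ((hinv.norm.eventually_lt_const (lt_add_one _)).mono
      fun _ h => h.le)
    have := ContinuousLinearEquiv.nhds (ContinuousLinearEquiv.refl ℝ (EuclideanSpace ℝ (Fin n)))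
    filter_upwards [this] with T hT
    exact hT
  obtain ⟨O, hO, hOopen, hOid⟩ := eventually_nhds_iff.1 hQ
  let F : AdaptedFrame A (EuclideanSpace ℝ (Fin n)) := ⟨W ∩ (fun x => π ∘L fieldCombination A ℓ x) ⁻¹' O, hcont.isOpen_inter_preimage hW hOopen,
    fun k => (hA k).mono Set.inter_subset_left, π, ℓ, _, fun x hx => (hO _ hx.2).1,
    fun x hx => (hO _ hx.2).2⟩
  have hpF : p ∈ F.U := ⟨hp, by rw [Set.mem_preimage, hπT]; exact hOid⟩
  refine ⟨F, hpF, Set.inter_subset_left, fun j => ?_⟩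
  · obtain ⟨u, hu⟩ := φ.surjective ⟨A j p, Submodule.subset_span ⟨j, rfl⟩⟩
    have h1 : fieldCombination A ℓ p u = A j p := by rw [hT, hu]
    rw [AdaptedFrame.R, ← h1, sub_eq_zero]
    exact (AdaptedFrame.V_π_fieldCombination hpF u).symm

end Frames

/-! ### Controlled curves that stay in `M` and tangent to the frame -/

section Leaves

variable {q D : ℕ} {𝔐 : Type*} [TopologicalSpace 𝔐]
  [ChartedSpace (EuclideanSpace ℝ (Fin D)) 𝔐] [IsManifold (𝓡 D) 2 𝔐]
  {X : VectorFields q D 𝔐} {x₀ : 𝔐} {M : Set (RhoFiniteSet X x₀)}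

/-- An integral curve of the fields in a chart, with continuous controls, is a controlled path. -/
theorem exists_controlledPath_of_hasDerivWithinAt (hX : ∀ j, IsC1VectorField (X j))
    {ψ : OpenPartialHomeomorph 𝔐 (EuclideanSpace ℝ (Fin D))}
    (hψ : ψ ∈ IsManifold.maximalAtlas (𝓡 D) 2 𝔐) {θ : ℝ → EuclideanSpace ℝ (Fin D)}
    (hθ : ∀ t ∈ Set.Icc (0 : ℝ) 1, θ t ∈ ψ.target) {b : Fin q → ℝ → ℝ}
    (hb : ∀ j, ContinuousOn (b j) (Set.Icc 0 1))
    (hd : ∀ t ∈ Set.Icc (0 : ℝ) 1,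
      HasDerivWithinAt θ (∑ j, b j t • chartField ψ (X j) (θ t)) (Set.Icc 0 1) t)
    {L : ℝ} (hL : ∀ t ∈ Set.Icc (0 : ℝ) 1, ∑ j, b j t ^ 2 ≤ L ^ 2) :
    ∃ b' γ, IsControlledPath X b' γ L (ψ.symm (θ 0)) (ψ.symm (θ 1)) ∧
      ∀ t ∈ Set.Icc (0 : ℝ) 1, γ t = ψ.symm (θ t) := by
  have hθc : ContinuousOn θ (Set.Icc 0 1) := fun t ht => (hd t ht).continuousWithinAt
  have hcurve : IsControlledCurve X b (fun t => ψ.symm (θ t)) := by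
    refine ⟨ψ.continuousOn_symm.comp hθc hθ, fun t₀ ht₀ => ⟨ψ, hψ, ψ.map_target (hθ t₀ ht₀), ?_⟩⟩
    filter_upwards [self_mem_nhdsWithin] with t ht
    refine ⟨ψ.map_target (hθ t ht), ?_⟩
    have hsub : Set.uIcc t₀ t ⊆ Set.Icc 0 1 := Set.uIcc_subset_Icc ht₀ ht
    have hcont : ContinuousOn (fun s => ∑ j, b j s • chartField ψ (X j) (θ s)) (Set.Icc 0 1) := by
      refine continuousOn_finsetSum _ fun j _ => (hb j).smul fun s hs => ?_
      exact ((hX j).contDiffAt_chartField hψ (hθ s hs)).continuousAt.comp_continuousWithinAt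
        (hθc s hs)
    have hftc : ∫ s in t₀..t, ∑ j, b j s • chartField ψ (X j) (θ s) = θ t - θ t₀ := by
      refine intervalIntegral.integral_eq_sub_of_hasDeriv_right (hθc.mono hsub) (fun s hs => ?_)
        ((hcont.mono hsub).intervalIntegrable)
      have hs1 : s ∈ Set.Ioo (0 : ℝ) 1 :=
        ⟨(le_min ht₀.1 ht.1).trans_lt hs.1, hs.2.trans_le (max_le ht₀.2 ht.2)⟩
      exact ((hd s (Set.Ioo_subset_Icc_self hs1)).hasDerivAt
        (Icc_mem_nhds hs1.1 hs1.2)).hasDerivWithinAt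
    rw [ψ.right_inv (hθ t ht), ψ.right_inv (hθ t₀ ht₀)]
    simp only [chartField] at hftc
    rw [hftc]
    abel
  refine ⟨_, _, hcurve.exists_path (L := L)
    (fun j => (hb j).aestronglyMeasurable measurableSet_Icc) ?_, fun t ht => ?_⟩
  · filter_upwards [ae_restrict_mem measurableSet_Icc] with t ht using hL t ht
  · simp only [Set.projIcc_of_mem _ ht]

namespace AdaptedFrame

variable {E G : Type*} [NormedAddCommGroup E] [NormedSpace ℝ E] [NormedAddCommGroup G]
  [NormedSpace ℝ G] {A : Fin q → G → G}

/-- A bound for the controls that move with unit speed along the frame. -/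
def speed (F : AdaptedFrame A E) : ℝ := (∑ k, ‖F.ℓ k‖) * |F.C|

theorem speed_nonneg (F : AdaptedFrame A E) : 0 ≤ F.speed := by unfold speed; positivity

theorem sum_sq_control_le (F : AdaptedFrame A E) {x : G} (hx : x ∈ F.U) (u : E) :
    ∑ k, F.ℓ k (F.coeff x u) ^ 2 ≤ (F.speed * ‖u‖) ^ 2 := by
  have h1 : ∀ k, |F.ℓ k (F.coeff x u)| ≤ ‖F.ℓ k‖ * (|F.C| * ‖u‖) := fun k =>
    ((F.ℓ k).le_opNorm _).trans (mul_le_mul_of_nonneg_left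
      (((F.coeff x).le_opNorm u).trans (mul_le_mul_of_nonneg_right
        ((F.norm_le x hx).trans (le_abs_self _)) (norm_nonneg _))) (norm_nonneg _))
  calc ∑ k, F.ℓ k (F.coeff x u) ^ 2 = ∑ k, |F.ℓ k (F.coeff x u)| ^ 2 := by simp only [sq_abs]
    _ ≤ (∑ k, |F.ℓ k (F.coeff x u)|) ^ 2 :=
      Finset.sum_sq_le_sq_sum_of_nonneg fun k _ => abs_nonneg _
    _ ≤ (∑ k, ‖F.ℓ k‖ * (|F.C| * ‖u‖)) ^ 2 := by
      gcongr with k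
      exact h1 k
    _ = (F.speed * ‖u‖) ^ 2 := by rw [← Finset.sum_mul, speed, mul_assoc]

end AdaptedFrame

/-- Motion along the frame in direction `u` uses the controls `ℓ_k(coeff u)`. This is how distances
in the parameter space bound `ρ`. -/
theorem exists_controlledPath_of_frame {E : Type*} [NormedAddCommGroup E] [NormedSpace ℝ E]
    [CompleteSpace E] (hX : ∀ j, IsC1VectorField (X j))
    {ψ : OpenPartialHomeomorph 𝔐 (EuclideanSpace ℝ (Fin D))}
    (hψ : ψ ∈ IsManifold.maximalAtlas (𝓡 D) 2 𝔐)
    {F : AdaptedFrame (fun j => chartField ψ (X j)) E} (hF : F.U ⊆ ψ.target)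
    {θ : ℝ → EuclideanSpace ℝ (Fin D)} {u : E} (hθ : ∀ t ∈ Set.Icc (0 : ℝ) 1, θ t ∈ F.U)
    (hd : ∀ t ∈ Set.Icc (0 : ℝ) 1, HasDerivWithinAt θ (F.V (θ t) u) (Set.Icc 0 1) t) :
    ∃ b γ, IsControlledPath X b γ (F.speed * ‖u‖) (ψ.symm (θ 0)) (ψ.symm (θ 1)) ∧
      ∀ t ∈ Set.Icc (0 : ℝ) 1, γ t = ψ.symm (θ t) := by
  refine exists_controlledPath_of_hasDerivWithinAt hX hψ (fun t ht => hF (hθ t ht))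
    (b := fun k t => F.ℓ k (F.coeff (θ t) u)) (fun k => ?_) (fun t ht => ?_)
    fun t ht => F.sum_sq_control_le (hθ t ht) u
  · have h1 : ContinuousOn (fun t => F.coeff (θ t)) (Set.Icc 0 1) :=
      (AdaptedFrame.contDiffOn_coeff (F := F)).continuousOn.comp
        (fun t ht => (hd t ht).continuousWithinAt) hθ
    exact (F.ℓ k).continuous.comp_continuousOn (h1.clm_apply continuousOn_const)
  · rw [← AdaptedFrame.V_apply]
    exact hd t ht

theorem inclusion_injective : Function.Injective (inclusion M) := by
  rintro ⟨⟨x, hx⟩, hx'⟩ ⟨⟨y, hy⟩, hy'⟩ h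
  obtain rfl : x = y := h
  rfl

theorem RhoFiniteSet.isOpen_iff {U : Set (RhoFiniteSet X x₀)} :
    IsOpen U ↔ ∀ z ∈ U, ∃ r : ENNReal, 0 < r ∧
      ∀ w : RhoFiniteSet X x₀, ccDist X z.point w.point < r → w ∈ U := Iff.rfl

theorem RhoFiniteSet.continuous_point [T2Space 𝔐] (hX : ∀ j, IsC1VectorField (X j)) :
    Continuous (RhoFiniteSet.point : RhoFiniteSet X x₀ → 𝔐) := by
  refine continuous_def.2 fun O hO => RhoFiniteSet.isOpen_iff.2 fun z hz => ?_
  obtain ⟨r, hr, h⟩ := exists_forall_controlledLine_mem hX z.point (hO.mem_nhds hz)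
  refine ⟨ENNReal.ofReal r, by simpa using hr, fun w hw => ?_⟩
  obtain ⟨L, hL, hLr, b, γ, hγ⟩ := ccDist_lt_iff.1 hw
  have := h b γ L hL (ENNReal.ofReal_lt_ofReal_iff'.1 hLr).1 hγ.toIsControlledLine
    (hγ.eq_left 0 le_rfl) 1 ⟨zero_le_one, le_rfl⟩
  rwa [hγ.eq_right 1 le_rfl] at this

theorem continuous_inclusion_of_isC1 [T2Space 𝔐] (hX : ∀ j, IsC1VectorField (X j)) :
    Continuous (inclusion M) :=
  (RhoFiniteSet.continuous_point hX).comp continuous_subtype_val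

/-- Short controlled lines that start at a point `p` of `M` stay in a given neighbourhood of `p` in
`M`. -/
theorem exists_forall_controlledLine_mem_nhds (hM : IsOpen M) (p : M) {U : Set M} (hU : U ∈ 𝓝 p) :
    ∃ r > 0, ∀ (b : Fin q → ℝ → ℝ) (γ : ℝ → 𝔐) (L : ℝ), 0 ≤ L → L < r →
      IsControlledLine X b γ L → γ 0 = inclusion M p →
      ∀ t ∈ Set.Icc (0 : ℝ) 1, ∃ m ∈ U, inclusion M m = γ t := by
  obtain ⟨O, hOU, hO, hpO⟩ := mem_nhds_iff.1 (mem_nhds_subtype_iff_nhdsWithin.1 hU |>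
    fun h => mem_nhdsWithin_iff_eventually.1 h |>.and (hM.mem_nhds p.2))
  obtain ⟨r, hr, h⟩ := RhoFiniteSet.isOpen_iff.1 hO _ hpO
  obtain ⟨r', -, hr'0, hr'⟩ := ENNReal.lt_iff_exists_real_btwn.1 hr
  refine ⟨r', by simpa using hr'0, fun b γ L hL hLr hγ h0 t ht => ?_⟩
  have h1 : ccDist X p.1.point (γ t) ≤ ENNReal.ofReal L := by
    have := hγ.ccDist_le_of_mem hL ht
    rwa [h0] at this
  have hfin : ccDist X x₀ (γ t) < ⊤ :=
    (ccDist_triangle _ p.1.point _).trans_lt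
      (ENNReal.add_lt_top.2 ⟨p.1.finite, h1.trans_lt ENNReal.ofReal_lt_top⟩)
  have h2 := hOU (h ⟨γ t, hfin⟩ (h1.trans_lt
    ((ENNReal.ofReal_le_ofReal hLr.le).trans_lt hr')))
  obtain ⟨m, hm, hme⟩ := h2.1 h2.2
  exact ⟨m, hm, congrArg RhoFiniteSet.point hme⟩

/-- The bracket relations of the fields, at the points of `M`, in a chart. -/
theorem lieBracket_chartField_eq_sum (hX : ∀ j, IsC1VectorField (X j))
    {c : Fin q → Fin q → Fin q → M → ℝ}
    (hbracket : ∀ i j, ∀ p : M, VectorField.mlieBracket (𝓡 D) (X i) (X j) (inclusion M p) =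
      ∑ k, c i j k p • X k (inclusion M p))
    {ψ : OpenPartialHomeomorph 𝔐 (EuclideanSpace ℝ (Fin D))}
    (hψ : ψ ∈ IsManifold.maximalAtlas (𝓡 D) 2 𝔐) {m : M} (hm : inclusion M m ∈ ψ.source)
    (i j : Fin q) :
    VectorField.lieBracket ℝ (chartField ψ (X i)) (chartField ψ (X j)) (ψ (inclusion M m)) =
      ∑ k, c i j k m • chartField ψ (X k) (ψ (inclusion M m)) := by
  rw [lieBracket_chartField (hX i) (hX j) hψ (ψ.map_source hm)]
  simp only [chartField_apply_chart _ hm]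
  rw [chartPushforward, hbracket]
  exact (map_sum (mfderiv (𝓡 D) (𝓡 D) ψ (inclusion M m)) _ _).trans
    (Finset.sum_congr rfl fun k _ => map_smul _ _ _)

/-- If all the fields lie in the span of an adapted frame at a point of `M`, then they do so along
short controlled lines. -/
theorem exists_forall_controlledLine_R_eq_zero [T2Space 𝔐] {E : Type*} [NormedAddCommGroup E]
    [NormedSpace ℝ E] [CompleteSpace E] (hX : ∀ j, IsC1VectorField (X j)) (hM : IsOpen M)
    {c : Fin q → Fin q → Fin q → M → ℝ} (hc : ∀ i j k, IsLocallyBounded (c i j k))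
    (hbracket : ∀ i j, ∀ p : M, VectorField.mlieBracket (𝓡 D) (X i) (X j) (inclusion M p) =
      ∑ k, c i j k p • X k (inclusion M p))
    {ψ : OpenPartialHomeomorph 𝔐 (EuclideanSpace ℝ (Fin D))}
    (hψ : ψ ∈ IsManifold.maximalAtlas (𝓡 D) 2 𝔐)
    {F : AdaptedFrame (fun j => chartField ψ (X j)) E} {p : M} (hp : inclusion M p ∈ ψ.source)
    (hpF : ψ (inclusion M p) ∈ F.U) (hR : ∀ j, F.R j (ψ (inclusion M p)) = 0)
    {U : Set M} (hU : U ∈ 𝓝 p) :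
    ∃ r > 0, ∀ (b : Fin q → ℝ → ℝ) (γ : ℝ → 𝔐) (L : ℝ), 0 ≤ L → L < r →
      IsControlledLine X b γ L → γ 0 = inclusion M p →
      ∀ t ∈ Set.Icc (0 : ℝ) 1, ∃ m ∈ U, inclusion M m = γ t ∧ γ t ∈ ψ.source ∧ ψ (γ t) ∈ F.U ∧
        ∀ j, F.R j (ψ (γ t)) = 0 := by
  choose Uc hUc Cc hCc using fun i j k => hc i j k p
  set C₀ := ∑ i, ∑ j, ∑ k, |Cc i j k| with hC₀
  have hC₀le : ∀ i j k, Cc i j k ≤ C₀ := fun i j k => by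
    refine (le_abs_self _).trans ?_
    refine (Finset.single_le_sum (f := fun k => |Cc i j k|) (fun _ _ => abs_nonneg _)
      (Finset.mem_univ k)).trans ?_
    refine (Finset.single_le_sum (f := fun j => ∑ k, |Cc i j k|) (fun _ _ => by positivity)
      (Finset.mem_univ j)).trans ?_
    exact Finset.single_le_sum (f := fun i => ∑ j, ∑ k, |Cc i j k|) (fun _ _ => by positivity)
      (Finset.mem_univ i)
  obtain ⟨K, hK, hKev⟩ := F.exists_bound_fderiv_R hpF (Cc := C₀) (by positivity)
  have hι : Continuous (inclusion M) := continuous_inclusion_of_isC1 hX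
  have hψι : ContinuousAt (fun m => ψ (inclusion M m)) p :=
    (ψ.continuousAt hp).comp hι.continuousAt
  have hUc' : ∀ᶠ m in 𝓝 p, ∀ i j k, m ∈ Uc i j k := by
    simp only [Filter.eventually_all]
    exact hUc
  have hUs : ∀ᶠ m in 𝓝 p, inclusion M m ∈ ψ.source ∧ ψ (inclusion M m) ∈ F.U :=
    (hι.continuousAt.eventually (ψ.open_source.mem_nhds hp)).and
      (hψι.eventually (F.isOpen.mem_nhds hpF))
  -- The neighbourhood is taken in `M`, because the `c`'s are defined and bounded only there; short
  -- controlled curves are known to remain in it.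
  have hN := (Filter.eventually_mem_set.2 hU).and (hUs.and ((hψι.eventually hKev).and hUc'))
  obtain ⟨r, hr, h⟩ := exists_forall_controlledLine_mem_nhds hM p hN
  refine ⟨r, hr, fun b γ L hL hLr hγ h0 => ?_⟩
  have hγN := h b γ L hL hLr hγ h0
  have hsrc : ∀ s ∈ Set.Icc (0 : ℝ) 1, γ s ∈ ψ.source ∧ ψ (γ s) ∈ F.U := fun s hs => by
    obtain ⟨m, hm, hms⟩ := hγN s hs
    rw [← hms]
    exact hm.2.1
  have hg := hγ.norm_le_gronwallBound_chart hL hX hψ (f := fun y j => F.R j y) (T := 1)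
    (fun s hs => (hsrc s hs).1)
    (fun s hs => differentiableAt_pi.2 fun j =>
      (AdaptedFrame.hasFDerivAt_R (hsrc s hs).2 j).differentiableAt)
    -- `K` bounds the derivative along each of the `q` fields. With zero initial value and no
    -- inhomogeneity, Gronwall gives `R = 0`.
    (δ := 0) (K := L * (q * K)) (ε := 0) ?_ ?_
  · intro t ht
    obtain ⟨m, hm, hmt⟩ := hγN t ht
    refine ⟨m, hm.1, hmt, (hsrc t ht).1, (hsrc t ht).2, fun j => ?_⟩
    have h1 := hg t ht
    rw [gronwallBound_ε0_δ0] at h1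
    exact congrFun (norm_le_zero_iff.1 h1) j
  · intro s hs
    obtain ⟨m, hm, hms⟩ := hγN s (Set.Ico_subset_Icc_self hs)
    rw [add_zero, mul_assoc]
    refine mul_le_mul_of_nonneg_left ?_ hL
    have hk := hm.2.2.1 (fun i j k => c i j k m)
      (fun i j k => (hCc i j k m (hm.2.2.2 i j k)).trans (hC₀le i j k))
      (lieBracket_chartField_eq_sum hX hbracket hψ hm.2.1.1)
    rw [hms] at hk
    refine (Finset.sum_le_sum fun k _ => hk k).trans (le_of_eq ?_)
    simp [mul_assoc]
  · rw [h0, show (fun j => F.R j (ψ (inclusion M p))) = 0 from funext hR, norm_zero]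

end Leaves

/-! ### Construction of the charts of `M` -/

section LeafCharts

variable {q D : ℕ} {𝔐 : Type*} [TopologicalSpace 𝔐]
  [ChartedSpace (EuclideanSpace ℝ (Fin D)) 𝔐] [IsManifold (𝓡 D) 2 𝔐]
  {X : VectorFields q D 𝔐} {x₀ : 𝔐}

/-- The dimension of the span of the vector fields at a point. -/
def fieldRank (X : VectorFields q D 𝔐) (x : 𝔐) : ℕ :=
  Module.finrank ℝ (Submodule.span ℝ (Set.range fun j => X j x))

theorem finrank_span_chartField
    {ψ : OpenPartialHomeomorph 𝔐 (EuclideanSpace ℝ (Fin D))}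
    (hψ : ψ ∈ IsManifold.maximalAtlas (𝓡 D) 2 𝔐) {x : 𝔐} (hx : x ∈ ψ.source) :
    Module.finrank ℝ (Submodule.span ℝ (Set.range fun j => chartField ψ (X j) (ψ x))) =
      fieldRank X x := by
  let f : TangentSpace (𝓡 D) x →ₗ[ℝ] EuclideanSpace ℝ (Fin D) :=
    ((mfderiv (𝓡 D) (𝓡 D) ψ x : TangentSpace (𝓡 D) x →L[ℝ] TangentSpace (𝓡 D) (ψ x)) :
      TangentSpace (𝓡 D) x →ₗ[ℝ] TangentSpace (𝓡 D) (ψ x))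
  have hf : Function.Injective f := mfderiv_chart_injective hψ hx
  have h1 : (Set.range fun j => chartField ψ (X j) (ψ x)) = f '' Set.range fun j => X j x := by
    rw [← Set.range_comp]
    congr 1
    ext1 j
    exact chartField_apply_chart (X j) hx
  rw [h1, Submodule.span_image, fieldRank]
  exact (Submodule.equivMapOfInjective f hf _).finrank_eq.symm

/-- A chart of `M` that is obtained from a solution `Θ` of the total differential equation of an
adapted frame. -/
structure LeafChart (M : Set (RhoFiniteSet X x₀)) (n : ℕ) where
  toChart : OpenPartialHomeomorph M (EuclideanSpace ℝ (Fin n))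
  ψ : OpenPartialHomeomorph 𝔐 (EuclideanSpace ℝ (Fin D))
  ψ_mem : ψ ∈ IsManifold.maximalAtlas (𝓡 D) 2 𝔐
  F : AdaptedFrame (fun j => chartField ψ (X j)) (EuclideanSpace ℝ (Fin n))
  base : EuclideanSpace ℝ (Fin n)
  Θ : EuclideanSpace ℝ (Fin n) → EuclideanSpace ℝ (Fin D)
  mem_source : ∀ m ∈ toChart.source, inclusion M m ∈ ψ.source
  mem_U : ∀ m ∈ toChart.source, ψ (inclusion M m) ∈ F.U
  R_eq_zero : ∀ m ∈ toChart.source, ∀ j, F.R j (ψ (inclusion M m)) = 0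
  chart_apply : ∀ m, toChart m = F.π (ψ (inclusion M m)) - base
  Θ_apply : ∀ u ∈ toChart.target, Θ u = ψ (inclusion M (toChart.symm u))
  contDiffOn_Θ : ContDiffOn ℝ 2 Θ toChart.target
  hasFDerivAt_Θ : ∀ u ∈ toChart.target, HasFDerivAt Θ (F.V (Θ u)) u

theorem exists_leafChart [T2Space 𝔐] {M : Set (RhoFiniteSet X x₀)}
    (hX : ∀ j, IsC1VectorField (X j)) (hM : IsOpen M)
    {c : Fin q → Fin q → Fin q → M → ℝ} (hc : ∀ i j k, IsLocallyBounded (c i j k))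
    (hbracket : ∀ i j, ∀ p : M, VectorField.mlieBracket (𝓡 D) (X i) (X j) (inclusion M p) =
      ∑ k, c i j k p • X k (inclusion M p)) (p : M) {n : ℕ}
    (hn : fieldRank X (inclusion M p) = n) :
    ∃ C : LeafChart M n, p ∈ C.toChart.source := by
  set ψ := chartAt (EuclideanSpace ℝ (Fin D)) (inclusion M p) with hψdef
  have hψ : ψ ∈ IsManifold.maximalAtlas (𝓡 D) 2 𝔐 := IsManifold.chart_mem_maximalAtlas _
  have hp : inclusion M p ∈ ψ.source := mem_chart_source _ _
  set p₀ := ψ (inclusion M p) with hp₀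
  have hι : Continuous (inclusion M) := continuous_inclusion_of_isC1 hX
  obtain ⟨F, hpF, hFt, hRp⟩ := exists_adaptedFrame (A := fun j => chartField ψ (X j))
    ψ.open_target (fun j y hy => ((hX j).contDiffAt_chartField hψ hy).contDiffWithinAt)
    (ψ.map_source hp) ((finrank_span_chartField hψ hp).trans hn)
  obtain ⟨r₁, hr₁, h₁⟩ := exists_forall_controlledLine_R_eq_zero hX hM hc hbracket hψ hp hpF hRp
    (Filter.univ_mem (f := 𝓝 p))
  have hspeed := F.speed_nonneg
  -- The set `P` consists of chart images of points of `M` with `R = 0`: integrability of the frame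
  -- is available only there.
  obtain ⟨r, hr, Θ, hΘ0, hΘP, hΘd, hΘ2⟩ := exists_frobenius_solution (V := F.V) F.isOpen hpF
    AdaptedFrame.contDiffOn_V
    {x | ∃ m : M, inclusion M m ∈ ψ.source ∧ ψ (inclusion M m) = x ∧ ∀ j, F.R j x = 0}
    (ρ := r₁ / (F.speed + 1)) (by positivity)
    (by
      intro u hu θ hθ0 hθU hθd t ht
      obtain ⟨b, γ, hγ, hγt⟩ := exists_controlledPath_of_frame hX hψ hFt hθU hθd
      have hlt : F.speed * ‖u‖ < r₁ := by
        rw [lt_div_iff₀ (by positivity)] at hu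
        nlinarith [norm_nonneg u]
      obtain ⟨m, -, hm, hms, -, hmR⟩ := h₁ b γ _ (by positivity) hlt hγ.toIsControlledLine
        (by rw [hγ.eq_left 0 le_rfl, hθ0, ψ.left_inv hp]) t ht
      have e : ψ (γ t) = θ t := by rw [hγt t ht, ψ.right_inv (hFt (hθU t ht))]
      exact ⟨m, hm ▸ hms, by rw [hm, e], fun j => e ▸ hmR j⟩)
    (by
      rintro x ⟨hxU, m, hm, rfl, hR⟩ v w
      exact AdaptedFrame.integrable hxU
        (c := fun i j k => c i j k m) (lieBracket_chartField_eq_sum hX hbracket hψ hm) hR v w)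
  -- `σ` is the lift of `Θ` to `M`; it will be the inverse of the chart.
  have hσ : ∀ u, ∃ m : M, u ∈ Metric.ball (0 : EuclideanSpace ℝ (Fin n)) r →
      inclusion M m ∈ ψ.source ∧ ψ (inclusion M m) = Θ u := by
    intro u
    by_cases hu : u ∈ Metric.ball (0 : EuclideanSpace ℝ (Fin n)) r
    · obtain ⟨m, h, h', -⟩ := (hΘP u hu).2
      exact ⟨m, fun _ => ⟨h, h'⟩⟩
    · exact ⟨p, fun h => absurd h hu⟩
  choose σ hσs hσΘ using hσ
  have hΘR : ∀ u ∈ Metric.ball (0 : EuclideanSpace ℝ (Fin n)) r, ∀ j, F.R j (Θ u) = 0 :=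
    fun u hu => let ⟨_, _, _, h⟩ := (hΘP u hu).2; h
  have hσι : ∀ u ∈ Metric.ball (0 : EuclideanSpace ℝ (Fin n)) r,
      inclusion M (σ u) = ψ.symm (Θ u) := fun u hu => by
    rw [← hσΘ u hu, ψ.left_inv (hσs u hu)]
  have h0r : (0 : EuclideanSpace ℝ (Fin n)) ∈ Metric.ball 0 r := Metric.mem_ball_self hr
  have hσ0 : σ 0 = p := inclusion_injective (by rw [hσι 0 h0r, hΘ0, ψ.left_inv hp])
  -- Since `π ∘ V = id`, the map `π ∘ Θ - id` has zero derivative.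
  have hπΘ : ∀ u ∈ Metric.ball (0 : EuclideanSpace ℝ (Fin n)) r, F.π (Θ u) - F.π p₀ = u := by
    intro u hu
    have hd : ∀ v ∈ Metric.ball (0 : EuclideanSpace ℝ (Fin n)) r,
        HasFDerivWithinAt (fun v => F.π (Θ v) - v)
          (0 : EuclideanSpace ℝ (Fin n) →L[ℝ] EuclideanSpace ℝ (Fin n)) (Metric.ball 0 r) v := by
      intro v hv
      have h1 := (F.π.hasFDerivAt.comp v (hΘd v hv)).sub (hasFDerivAt_id v)
      have h2 : F.π ∘L F.V (Θ v) - ContinuousLinearMap.id ℝ _ = 0 := by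
        ext1 w
        simp [AdaptedFrame.π_V (hΘP v hv).1]
      rw [h2] at h1
      exact h1.hasFDerivWithinAt
    have := (convex_ball (0 : EuclideanSpace ℝ (Fin n)) r).norm_image_sub_le_of_norm_hasFDerivWithin_le
      hd (C := 0) (fun v _ => by simp) h0r hu
    rw [zero_mul, norm_le_zero_iff, hΘ0, sub_zero] at this
    rw [sub_eq_zero] at this
    rw [← this]
    exact sub_sub_cancel _ _
  have hφσ : ∀ u ∈ Metric.ball (0 : EuclideanSpace ℝ (Fin n)) r,
      F.π (ψ (inclusion M (σ u))) - F.π p₀ = u := fun u hu => by rw [hσΘ u hu, hπΘ u hu]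
  -- `Θ` maps the segment from `u₀` to `u` to a controlled curve of speed at most `F.speed * ‖u -
  -- u₀‖`, so `σ u` is `ρ`-close to `σ u₀`.
  have hσcont : ContinuousOn σ (Metric.ball 0 r) := by
    intro u₀ hu₀
    refine ContinuousAt.continuousWithinAt ?_
    rw [ContinuousAt, Filter.tendsto_def]
    intro U hU
    obtain ⟨r₂, hr₂, h₂⟩ := exists_forall_controlledLine_mem_nhds hM (σ u₀) hU
    have hball : Metric.ball u₀ (r₂ / (F.speed + 1)) ∈ 𝓝 u₀ :=
      Metric.ball_mem_nhds _ (by positivity)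
    filter_upwards [hball, Metric.isOpen_ball.mem_nhds hu₀] with u hu hur
    have hseg : ∀ t ∈ Set.Icc (0 : ℝ) 1, u₀ + t • (u - u₀) ∈
        Metric.ball (0 : EuclideanSpace ℝ (Fin n)) r := fun t ht =>
      (convex_ball _ _).add_smul_sub_mem hu₀ hur ht
    obtain ⟨b, γ, hγ, -⟩ := exists_controlledPath_of_frame hX hψ hFt
      (θ := fun t => Θ (u₀ + t • (u - u₀))) (u := u - u₀) (fun t ht => (hΘP _ (hseg t ht)).1)
      (fun t ht => by
        have h1 : HasDerivWithinAt (fun t : ℝ => u₀ + t • (u - u₀)) (u - u₀) (Set.Icc 0 1) t := by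
          simpa using ((hasDerivWithinAt_id t (Set.Icc 0 1)).smul_const (u - u₀)).const_add u₀
        exact (hΘd _ (hseg t ht)).comp_hasDerivWithinAt t h1)
    simp only [zero_smul, one_smul, add_zero, add_sub_cancel] at hγ
    have hlt : F.speed * ‖u - u₀‖ < r₂ := by
      have := mem_ball_iff_norm.1 hu
      rw [lt_div_iff₀ (by positivity)] at this
      nlinarith [norm_nonneg (u - u₀)]
    obtain ⟨m, hmU, hm⟩ := h₂ b γ _ (by positivity) hlt hγ.toIsControlledLine
      (by rw [hγ.eq_left 0 le_rfl, hσι u₀ hu₀]) 1 ⟨zero_le_one, le_rfl⟩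
    rw [hγ.eq_right 1 le_rfl, ← hσι u hur] at hm
    rw [Set.mem_preimage, ← inclusion_injective hm]
    exact hmU
  -- A short controlled curve from a point of the image must be shown to end in the image. The
  -- defect `x - Θ(π x - π p₀)` vanishes exactly where `x` is the value of `Θ` at its own
  -- projection, and Gronwall keeps it zero.
  have hopen : IsOpen (σ '' Metric.ball 0 r) := by
    suffices h : IsOpen (Subtype.val '' (σ '' Metric.ball 0 r)) by
      have := h.preimage (continuous_subtype_val (p := (· ∈ M)))
      rwa [Set.preimage_image_eq _ Subtype.val_injective] at this
    rw [RhoFiniteSet.isOpen_iff]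
    rintro _ ⟨_, ⟨u₀, hu₀, rfl⟩, rfl⟩
    have hx₀U := (hΘP u₀ hu₀).1
    have hVat : ContDiffAt ℝ 1 F.V (Θ u₀) :=
      AdaptedFrame.contDiffOn_V.contDiffAt (F.isOpen.mem_nhds hx₀U)
    obtain ⟨κ, T, hT, hLip⟩ := hVat.exists_lipschitzOnWith
    set Ca := ∑ k, ‖F.π (chartField ψ (X k) (Θ u₀))‖ + 1 with hCa
    have hCa0 : 0 ≤ Ca := by positivity
    have hACa : ∀ᶠ x in 𝓝 (Θ u₀), ∀ k, ‖F.π (chartField ψ (X k) x)‖ ≤ Ca := by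
      have hcont : ContinuousAt (fun x => ∑ k, ‖F.π (chartField ψ (X k) x)‖) (Θ u₀) :=
        tendsto_finsetSum _ fun k _ => (F.π.continuous.continuousAt.comp
          ((F.contDiffOn k).contDiffAt (F.isOpen.mem_nhds hx₀U)).continuousAt).norm
      filter_upwards [hcont.eventually_lt_const (lt_add_one _)] with x hx k
      exact (Finset.single_le_sum (f := fun k => ‖F.π (chartField ψ (X k) x)‖)
        (fun _ _ => norm_nonneg _) (Finset.mem_univ k)).trans hx.le
    have hψι : ContinuousAt (fun m => ψ (inclusion M m)) (σ u₀) :=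
      (ψ.continuousAt (hσs u₀ hu₀)).comp hι.continuousAt
    have hφc : ContinuousAt (fun m => F.π (ψ (inclusion M m)) - F.π p₀) (σ u₀) :=
      (F.π.continuous.continuousAt.comp hψι).sub continuousAt_const
    have hψe : ψ (inclusion M (σ u₀)) = Θ u₀ := hσΘ u₀ hu₀
    have hφe : F.π (ψ (inclusion M (σ u₀))) - F.π p₀ = u₀ := hφσ u₀ hu₀
    have hΘφ : ContinuousAt (fun m => Θ (F.π (ψ (inclusion M m)) - F.π p₀)) (σ u₀) :=
      ContinuousAt.comp (f := fun m => F.π (ψ (inclusion M m)) - F.π p₀) (g := Θ)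
        (by rw [hφe]; exact (hΘd u₀ hu₀).continuousAt) hφc
    have e1 : ∀ᶠ m in 𝓝 (σ u₀), ψ (inclusion M m) ∈ T :=
      hψι.eventually (p := fun x => x ∈ T) (by beta_reduce; rw [hψe]; exact hT)
    have e2 : ∀ᶠ m in 𝓝 (σ u₀), F.π (ψ (inclusion M m)) - F.π p₀ ∈ Metric.ball 0 r :=
      hφc.eventually (p := fun x => x ∈ Metric.ball 0 r) (by beta_reduce; rw [hφe]; exact Metric.isOpen_ball.mem_nhds hu₀)
    have e3 : ∀ᶠ m in 𝓝 (σ u₀), Θ (F.π (ψ (inclusion M m)) - F.π p₀) ∈ T :=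
      hΘφ.eventually (p := fun x => x ∈ T) (by beta_reduce; rw [hφe]; exact hT)
    have e4 : ∀ᶠ m in 𝓝 (σ u₀), ∀ k, ‖F.π (chartField ψ (X k) (ψ (inclusion M m)))‖ ≤ Ca :=
      hψι.eventually (p := fun x => ∀ k, ‖F.π (chartField ψ (X k) x)‖ ≤ Ca)
        (by beta_reduce; rw [hψe]; exact hACa)
    obtain ⟨r₂, hr₂, h₂⟩ := exists_forall_controlledLine_R_eq_zero hX hM hc hbracket hψ
      (hσs u₀ hu₀) (hψe ▸ hx₀U) (hψe ▸ hΘR u₀ hu₀) (e1.and (e2.and (e3.and e4)))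
    refine ⟨ENNReal.ofReal r₂, by simpa using hr₂, fun w hw => ?_⟩
    obtain ⟨L, hL, hLr, b, γ, hγ⟩ := ccDist_lt_iff.1 hw
    have hγN := h₂ b γ L hL (ENNReal.ofReal_lt_ofReal_iff'.1 hLr).1 hγ.toIsControlledLine
      (hγ.eq_left 0 le_rfl)
    have hball : ∀ s ∈ Set.Icc (0 : ℝ) 1, F.π (ψ (γ s)) - F.π p₀ ∈ Metric.ball 0 r := by
      intro s hs
      obtain ⟨m, hm, hms, -⟩ := hγN s hs
      rw [← hms]
      exact hm.2.1
    have hder : ∀ s ∈ Set.Icc (0 : ℝ) 1, HasFDerivAt (fun x => x - Θ (F.π x - F.π p₀))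
        (ContinuousLinearMap.id ℝ _ - F.V (Θ (F.π (ψ (γ s)) - F.π p₀)) ∘L F.π) (ψ (γ s)) := by
      intro s hs
      exact (hasFDerivAt_id _).sub ((hΘd _ (hball s hs)).comp (ψ (γ s))
        (F.π.hasFDerivAt.sub_const (F.π p₀)))
    have hg := hγ.toIsControlledLine.norm_le_gronwallBound_chart hL hX hψ
      (f := fun x => x - Θ (F.π x - F.π p₀)) (T := 1)
      (fun s hs => (let ⟨_, _, _, h, _⟩ := hγN s hs; h))
      (fun s hs => (hder s hs).differentiableAt)
      (δ := 0) (K := L * (q * (κ * Ca))) (ε := 0) ?_ ?_ 1 ⟨zero_le_one, le_rfl⟩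
    · rw [gronwallBound_ε0_δ0, hγ.eq_right 1 le_rfl, norm_le_zero_iff, sub_eq_zero] at hg
      obtain ⟨m, -, hm, hms, -⟩ := hγN 1 ⟨zero_le_one, le_rfl⟩
      have hb1 := hball 1 ⟨zero_le_one, le_rfl⟩
      rw [hγ.eq_right 1 le_rfl] at hb1 hms hm
      have : inclusion M (σ (F.π (ψ w.point) - F.π p₀)) = inclusion M m := by
        rw [hσι _ hb1, ← hg, ψ.left_inv hms, hm]
      refine ⟨σ _, ⟨_, hb1, rfl⟩, ?_⟩
      rw [inclusion_injective this]
      obtain ⟨⟨y, hy⟩, hy'⟩ := m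
      obtain ⟨w, hw'⟩ := w
      obtain rfl : y = w := hm
      rfl
    · intro s hs
      have hs' := Set.Ico_subset_Icc_self hs
      obtain ⟨m, hm, hms, -, -, hR⟩ := hγN s hs'
      obtain ⟨hm1, -, hm3, hm4⟩ := hm
      rw [hms] at hm1 hm3 hm4
      rw [add_zero, mul_assoc]
      refine mul_le_mul_of_nonneg_left ?_ hL
      rw [(hder s hs').fderiv]
      refine (Finset.sum_le_sum (g := fun _ => κ * Ca * ‖ψ (γ s) - Θ (F.π (ψ (γ s)) - F.π p₀)‖)
        fun k _ => ?_).trans (le_of_eq ?_)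
      -- As `R = 0` on the curve, each field is `V(π X_k)`. The defect's derivative along it is thus
      -- a difference of two values of `V`, which the Lipschitz constant bounds by the defect
      -- itself.
      · have hk : chartField ψ (X k) (ψ (γ s)) =
            F.V (ψ (γ s)) (F.π (chartField ψ (X k) (ψ (γ s)))) := sub_eq_zero.1 (hR k)
        have e : (ContinuousLinearMap.id ℝ (EuclideanSpace ℝ (Fin D)) -
              F.V (Θ (F.π (ψ (γ s)) - F.π p₀)) ∘L F.π)
            (chartField ψ (X k) (ψ (γ s))) = (F.V (ψ (γ s)) - F.V (Θ (F.π (ψ (γ s)) - F.π p₀)))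
              (F.π (chartField ψ (X k) (ψ (γ s)))) := by
          rw [sub_apply, sub_apply, ← hk]
          rfl
        rw [e]
        refine (ContinuousLinearMap.le_opNorm _ _).trans ?_
        have h5 := hLip.dist_le_mul _ hm1 _ hm3
        rw [dist_eq_norm, dist_eq_norm] at h5
        refine (mul_le_mul h5 (hm4 k) (norm_nonneg _) (by positivity)).trans (le_of_eq ?_)
        ring
      · simp [mul_assoc]
    · rw [hγ.eq_left 0 le_rfl]
      change ‖ψ (inclusion M (σ u₀)) - Θ (F.π (ψ (inclusion M (σ u₀))) - F.π p₀)‖ ≤ 0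
      rw [hφe, hψe, sub_self, norm_zero]
  refine ⟨⟨⟨⟨⟨fun m => F.π (ψ (inclusion M m)) - F.π p₀, σ, σ '' Metric.ball 0 r,
    Metric.ball 0 r, ?_, fun u hu => ⟨u, hu, rfl⟩, ?_, hφσ⟩, ?_, hσcont⟩, hopen, Metric.isOpen_ball⟩, ψ, hψ, F, F.π p₀,
    Θ, ?_, ?_, ?_, fun m => rfl, fun u hu => (hσΘ u hu).symm, hΘ2, hΘd⟩, ⟨0, h0r, hσ0⟩⟩
  · rintro _ ⟨u, hu, rfl⟩
    rwa [hφσ u hu]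
  · rintro _ ⟨u, hu, rfl⟩
    rw [hφσ u hu]
  · rintro _ ⟨u, hu, rfl⟩
    exact ((F.π.continuous.continuousAt.comp ((ψ.continuousAt (hσs u hu)).comp
      hι.continuousAt)).sub continuousAt_const).continuousWithinAt
  · rintro _ ⟨u, hu, rfl⟩
    exact hσs u hu
  · rintro _ ⟨u, hu, rfl⟩
    rw [hσΘ u hu]
    exact (hΘP u hu).1
  · rintro _ ⟨u, hu, rfl⟩
    rw [hσΘ u hu]
    exact hΘR u hu

theorem LeafChart.fieldRank_eq {M : Set (RhoFiniteSet X x₀)} {n : ℕ} (C : LeafChart M n) {m : M}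
    (hm : m ∈ C.toChart.source) : fieldRank X (inclusion M m) = n := by
  rw [← finrank_span_chartField C.ψ_mem (C.mem_source m hm),
    AdaptedFrame.finrank_span (C.mem_U m hm) (C.R_eq_zero m hm)]
  simp

end LeafCharts

/-! ### Second countability of `M` -/

section SecondCountable

/-- Every open member that meets `s` contains a point of a countable dense subset of `s`, and each
such point lies in finitely many members. -/
theorem LocallyFinite.countable_setOf_inter_nonempty {α ι : Type*} [TopologicalSpace α]
    {V : ι → Set α} (hV : LocallyFinite V) (ho : ∀ i, IsOpen (V i)) {s : Set α}
    [TopologicalSpace.SeparableSpace s] :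
    {j | (s ∩ V j).Nonempty}.Countable := by
  obtain ⟨d, hd, hdense⟩ := TopologicalSpace.exists_countable_dense s
  refine (hd.biUnion (t := fun (x : s) (_ : x ∈ d) => {j | (x : α) ∈ V j})
    fun x _ => (hV.point_finite (x : α)).countable).mono ?_
  rintro j ⟨x, hxs, hxj⟩
  obtain ⟨y, hy, hyd⟩ := hdense.inter_open_nonempty _
    ((ho j).preimage (continuous_subtype_val (p := (· ∈ s)))) ⟨⟨x, hxs⟩, hxj⟩
  exact Set.mem_biUnion hyd hy

/-- A connected paracompact space that is locally second countable is second countable. -/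
theorem secondCountableTopology_of_locally {α : Type*} [TopologicalSpace α] [ParacompactSpace α]
    [PreconnectedSpace α]
    (h : ∀ x : α, ∃ U : Set α, IsOpen U ∧ x ∈ U ∧ SecondCountableTopology U) :
    SecondCountableTopology α := by
  choose U hUo hxU hU using h
  obtain ⟨V, hVo, hVc, hVf, hVU⟩ := precise_refinement U hUo
    (Set.eq_univ_of_forall fun x => Set.mem_iUnion.2 ⟨x, hxU x⟩)
  have hV : ∀ i, SecondCountableTopology (V i) := fun i =>
    (Topology.IsEmbedding.inclusion (hVU i)).secondCountableTopology
  rcases isEmpty_or_nonempty α with hα | ⟨⟨x₁⟩⟩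
  · infer_instance
  -- `T n` indexes the members reached from those containing `x₁` by a chain of `n` overlaps.
  let T : ℕ → Set α := fun n => Nat.rec {i | x₁ ∈ V i}
    (fun _ t => ⋃ i ∈ t, {j | (V i ∩ V j).Nonempty}) n
  have hT : ∀ n, (T n).Countable := by
    intro n
    induction n with
    | zero => exact (hVf.point_finite x₁).countable
    | succ n ih =>
      exact ih.biUnion fun i _ => hVf.countable_setOf_inter_nonempty hVo
  have hcount : (⋃ n, T n).Countable := Set.countable_iUnion hT
  -- A member that meets the union has its index in some next `T (n + 1)`, so members covering the
  -- complement are disjoint from the union.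
  have hclopen : IsClopen (⋃ i ∈ ⋃ n, T n, V i) := by
    refine ⟨⟨?_⟩, isOpen_biUnion fun i _ => hVo i⟩
    refine isOpen_iff_forall_mem_open.2 fun x hx => ?_
    obtain ⟨j, hj⟩ := Set.mem_iUnion.1 (hVc ▸ Set.mem_univ x)
    refine ⟨V j, fun y hy hy' => hx ?_, hVo j, hj⟩
    obtain ⟨i, hi, hyi⟩ := Set.mem_iUnion₂.1 hy'
    obtain ⟨n, hn⟩ := Set.mem_iUnion.1 hi
    exact Set.mem_biUnion (Set.mem_iUnion.2 ⟨n + 1, Set.mem_biUnion hn ⟨y, hyi, hy⟩⟩) hj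
  have huniv : ⋃ i ∈ ⋃ n, T n, V i = Set.univ := by
    refine hclopen.eq_univ ?_
    obtain ⟨j, hj⟩ := Set.mem_iUnion.1 (hVc ▸ Set.mem_univ x₁)
    exact ⟨x₁, Set.mem_biUnion (Set.mem_iUnion.2 ⟨0, hj⟩) hj⟩
  have := hcount.to_subtype
  rw [Set.biUnion_eq_iUnion] at huniv
  exact TopologicalSpace.secondCountableTopology_of_countable_cover
    (fun i : ⋃ n, T n => hVo i) huniv

variable {q D : ℕ} {𝔐 : Type*} [TopologicalSpace 𝔐]
  [ChartedSpace (EuclideanSpace ℝ (Fin D)) 𝔐] [IsManifold (𝓡 D) 2 𝔐]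
  {X : VectorFields q D 𝔐} {x₀ : 𝔐}

/-- Passes to the subspace `M` and makes it paracompact. -/
instance RhoFiniteSet.pseudoMetrizableSpace :
    TopologicalSpace.PseudoMetrizableSpace (RhoFiniteSet X x₀) := by
  let m : PseudoEMetricSpace (RhoFiniteSet X x₀) :=
    { edist := fun z w => ccDist X z.point w.point
      edist_self := fun z => ccDist_self _
      edist_comm := fun z w => ccDist_comm _ _
      edist_triangle := fun z w v => ccDist_triangle _ _ _ }
  have e : instTopologicalSpaceRhoFiniteSet X x₀ =
      m.toUniformSpace.toTopologicalSpace := by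
    ext U
    rw [RhoFiniteSet.isOpen_iff, EMetric.isOpen_iff]
    refine forall₂_congr fun z _ => exists_congr fun r => and_congr_right fun _ =>
      forall_congr' fun w => ?_
    rw [Metric.mem_eball, edist_comm]
    rfl
  rw [e]
  exact UniformSpace.pseudoMetrizableSpace

variable {M : Set (RhoFiniteSet X x₀)}

theorem t2Space_of_isC1VectorField [T2Space 𝔐] (hX : ∀ j, IsC1VectorField (X j)) : T2Space M :=
  T2Space.of_injective_continuous inclusion_injective (continuous_inclusion_of_isC1 hX)

theorem secondCountableTopology_of_leafCharts (hMconn : IsConnected M)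
    (h : ∀ p : M, ∃ (n : ℕ) (C : LeafChart M n), p ∈ C.toChart.source) :
    SecondCountableTopology M := by
  have := isPreconnected_iff_preconnectedSpace.1 hMconn.isPreconnected
  have : ParacompactSpace M := by
    let := TopologicalSpace.pseudoMetrizableSpacePseudoMetric M
    infer_instance
  refine secondCountableTopology_of_locally fun p => ?_
  obtain ⟨n, C, hp⟩ := h p
  exact ⟨C.toChart.source, C.toChart.open_source, hp,
    C.toChart.toHomeomorphSourceTarget.secondCountableTopology⟩

end SecondCountable

/-! ### Recovering the regularity of a vector field from charts -/

section ChartFieldConverse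

variable {D : ℕ} {𝔐 : Type*} [TopologicalSpace 𝔐]
  [ChartedSpace (EuclideanSpace ℝ (Fin D)) 𝔐] [IsManifold (𝓡 D) 2 𝔐]
  {ψ : OpenPartialHomeomorph 𝔐 (EuclideanSpace ℝ (Fin D))}

theorem mpullback_chartField (hψ : ψ ∈ IsManifold.maximalAtlas (𝓡 D) 2 𝔐)
    (V : (x : 𝔐) → TangentSpace (𝓡 D) x) {x : 𝔐} (hx : x ∈ ψ.source) :
    VectorField.mpullback (𝓡 D) (𝓡 D) ψ (chartField ψ V) x = V x := by
  have hd := mdifferentiable_of_mem_maximalAtlas_two hψ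
  have h1 := hd.symm_comp_deriv hx
  have h2 := hd.comp_symm_deriv (ψ.map_source hx)
  rw [ψ.left_inv hx] at h2
  refine (DFunLike.congr_fun (ContinuousLinearMap.inverse_eq h2 h1) _).trans ?_
  exact (congrArg (mfderiv (𝓡 D) (𝓡 D) ψ.symm (ψ x)) (chartField_apply_chart V hx)).trans
    (DFunLike.congr_fun h1 (V x))

theorem isC1VectorField_of_chartField {V : (x : 𝔐) → TangentSpace (𝓡 D) x}
    (h : ∀ x, ∃ ψ ∈ IsManifold.maximalAtlas (𝓡 D) 2 𝔐, x ∈ ψ.source ∧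
      ContDiffAt ℝ 1 (chartField ψ V) (ψ x)) : IsC1VectorField V := by
  have : IsManifold (𝓡 D) 1 𝔐 := IsManifold.of_le (n := 2) (by norm_num)
  intro x
  obtain ⟨ψ, hψ, hx, hc⟩ := h x
  have hd := mdifferentiable_of_mem_maximalAtlas_two hψ
  have h1 := hd.symm_comp_deriv hx
  have h2 := hd.comp_symm_deriv (ψ.map_source hx)
  rw [ψ.left_inv hx] at h2
  have h := ContMDiffAt.mpullback_vectorField_preimage (n := 2) (m := 1) (I := 𝓡 D) (I' := 𝓡 D)
    (f := ψ) (x₀ := x) (V := chartField ψ V) (contMDiffAt_vectorSpace_iff_contDiffAt.2 hc)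
    ((contMDiffOn_of_mem_maximalAtlas hψ).contMDiffAt (ψ.open_source.mem_nhds hx))
    (ContinuousLinearMap.IsInvertible.of_inverse h2 h1) (by norm_num)
  refine h.congr_of_eventuallyEq ?_
  filter_upwards [ψ.open_source.mem_nhds hx] with z hz
  rw [mpullback_chartField hψ V hz]

end ChartFieldConverse

/-! ### The `C^2` structure given by the leaf charts -/

section LeafStructure

variable {q D n : ℕ} {𝔐 : Type*} [TopologicalSpace 𝔐]
  [ChartedSpace (EuclideanSpace ℝ (Fin D)) 𝔐] [IsManifold (𝓡 D) 2 𝔐]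
  {X : VectorFields q D 𝔐} {x₀ : 𝔐} {M : Set (RhoFiniteSet X x₀)}

namespace LeafChart

variable (C : LeafChart M n)

theorem contMDiffAt_inclusion_symm {u : EuclideanSpace ℝ (Fin n)} (hu : u ∈ C.toChart.target) :
    ContMDiffAt (𝓡 n) (𝓡 D) 2 (inclusion M ∘ C.toChart.symm) u := by
  have hm := C.toChart.map_target hu
  have h1 : ContMDiffAt (𝓡 n) (𝓡 D) 2 (C.ψ.symm ∘ C.Θ) u := by
    refine ContMDiffAt.comp u ((contMDiffOn_symm_of_mem_maximalAtlas C.ψ_mem).contMDiffAt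
      (C.ψ.open_target.mem_nhds ?_)) (C.contDiffOn_Θ.contDiffAt
        (C.toChart.open_target.mem_nhds hu)).contMDiffAt
    rw [C.Θ_apply u hu]
    exact C.ψ.map_source (C.mem_source _ hm)
  refine h1.congr_of_eventuallyEq ?_
  filter_upwards [C.toChart.open_target.mem_nhds hu] with v hv
  rw [Function.comp_apply, Function.comp_apply, C.Θ_apply v hv,
    C.ψ.left_inv (C.mem_source _ (C.toChart.map_target hv))]

/-- A leaf chart is `x ↦ π(ψ x) - base` restricted to `M`, so regularity of the composition into the
ambient manifold is enough. Both the transition maps and uniqueness rest on this. -/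
theorem contMDiffAt_chart_comp {E H N : Type*} [NormedAddCommGroup E] [NormedSpace ℝ E]
    [TopologicalSpace H] {I : ModelWithCorners ℝ E H} [TopologicalSpace N] [ChartedSpace H N]
    {f : N → M} {x : N} (hx : f x ∈ C.toChart.source)
    (hf : ContMDiffAt I (𝓡 D) 2 (inclusion M ∘ f) x) :
    ContMDiffAt I (𝓡 n) 2 (C.toChart ∘ f) x := by
  have h1 : ContMDiffAt I (𝓡 D) 2 (C.ψ ∘ (inclusion M ∘ f)) x :=
    ((contMDiffOn_of_mem_maximalAtlas C.ψ_mem).contMDiffAt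
      (C.ψ.open_source.mem_nhds (C.mem_source _ hx))).comp x hf
  have h2 : ContMDiffAt I (𝓡 n) 2 ((fun y => C.F.π y - C.base) ∘ (C.ψ ∘ (inclusion M ∘ f))) x :=
    (C.F.π.contDiff.sub contDiff_const).contDiffAt.contMDiffAt.comp x h1
  convert h2 using 1
  ext1 y
  exact C.chart_apply (f y)

variable {C}

theorem contDiffOn_transition (C C' : LeafChart M n) :
    ContDiffOn ℝ 2 (C'.toChart ∘ C.toChart.symm) (C.toChart.symm ≫ₕ C'.toChart).source := by
  intro u hu
  rw [OpenPartialHomeomorph.trans_source] at hu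
  exact (contMDiffAt_iff_contDiffAt.1 (C'.contMDiffAt_chart_comp hu.2
    (C.contMDiffAt_inclusion_symm hu.1))).contDiffWithinAt

variable [ChartedSpace (EuclideanSpace ℝ (Fin n)) M] [IsManifold (𝓡 n) 2 M]

theorem contMDiffAt_inclusion
    (hC : C.toChart ∈ IsManifold.maximalAtlas (𝓡 n) 2 M) {m : M} (hm : m ∈ C.toChart.source) :
    ContMDiffAt (𝓡 n) (𝓡 D) 2 (inclusion M) m := by
  have h := (C.contMDiffAt_inclusion_symm (C.toChart.map_source hm)).comp m
    ((contMDiffOn_of_mem_maximalAtlas hC).contMDiffAt (C.toChart.open_source.mem_nhds hm))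
  refine h.congr_of_eventuallyEq ?_
  filter_upwards [C.toChart.open_source.mem_nhds hm] with v hv
  simp [C.toChart.left_inv hv]

/-- The chain rule for `ψ ∘ ι = Θ ∘ chart`, with `DΘ = V(Θ)`; it reduces statements on the
differential of the inclusion to the injective map `V`. -/
theorem mfderiv_chart_mfderiv_inclusion
    (hC : C.toChart ∈ IsManifold.maximalAtlas (𝓡 n) 2 M) {m : M} (hm : m ∈ C.toChart.source)
    (v : TangentSpace (𝓡 n) m) :
    mfderiv (𝓡 D) (𝓡 D) C.ψ (inclusion M m) (mfderiv (𝓡 n) (𝓡 D) (inclusion M) m v) =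
      C.F.V (C.ψ (inclusion M m)) (mfderiv (𝓡 n) (𝓡 n) C.toChart m v) := by
  have hu := C.toChart.map_source hm
  have h1 := mfderiv_comp_apply m ((mdifferentiable_of_mem_maximalAtlas_two
    C.ψ_mem).mdifferentiableAt (C.mem_source m hm))
    ((contMDiffAt_inclusion hC hm).mdifferentiableAt two_ne_zero) v
  have hΘ := C.hasFDerivAt_Θ _ hu
  have h2 := mfderiv_comp_apply m hΘ.differentiableAt.mdifferentiableAt
    ((mdifferentiable_of_mem_maximalAtlas_two hC).mdifferentiableAt hm) v
  have h3 : C.ψ ∘ inclusion M =ᶠ[𝓝 m] C.Θ ∘ C.toChart := by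
    filter_upwards [C.toChart.open_source.mem_nhds hm] with y hy
    rw [Function.comp_apply, Function.comp_apply, C.Θ_apply _ (C.toChart.map_source hy),
      C.toChart.left_inv hy]
  rw [← h1]
  refine (DFunLike.congr_fun h3.mfderiv_eq v).trans (h2.trans ?_)
  rw [mfderiv_eq_fderiv, hΘ.fderiv, C.Θ_apply _ hu, C.toChart.left_inv hm]
  rfl

theorem mfderiv_inclusion_injective
    (hC : C.toChart ∈ IsManifold.maximalAtlas (𝓡 n) 2 M) {m : M} (hm : m ∈ C.toChart.source) :
    Function.Injective (mfderiv (𝓡 n) (𝓡 D) (inclusion M) m) := by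
  intro v w hvw
  have h := (mfderiv_chart_mfderiv_inclusion hC hm v).symm.trans
    ((congrArg (mfderiv (𝓡 D) (𝓡 D) C.ψ (inclusion M m)) hvw).trans
      (mfderiv_chart_mfderiv_inclusion hC hm w))
  exact mfderiv_chart_injective hC hm (AdaptedFrame.V_injective (C.mem_U m hm) h)

/-- `R_j = 0` says that `X_j = V(π X_j)` in the chart, and `V` and the derivative of `ψ` are
injective. So the lift of `X_j` to `M` has coordinates `π X_j`. -/
theorem mfderiv_inclusion_eq_iff
    (hC : C.toChart ∈ IsManifold.maximalAtlas (𝓡 n) 2 M) {m : M} (hm : m ∈ C.toChart.source) {j : Fin q}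
    {v : TangentSpace (𝓡 n) m} :
    mfderiv (𝓡 n) (𝓡 D) (inclusion M) m v = X j (inclusion M m) ↔
      mfderiv (𝓡 n) (𝓡 n) C.toChart m v =
        C.F.π (chartField C.ψ (X j) (C.ψ (inclusion M m))) := by
  have h1 : C.F.V (C.ψ (inclusion M m)) (C.F.π (chartField C.ψ (X j) (C.ψ (inclusion M m)))) =
      mfderiv (𝓡 D) (𝓡 D) C.ψ (inclusion M m) (X j (inclusion M m)) :=
    (sub_eq_zero.1 (C.R_eq_zero m hm j)).symm.trans
      (chartField_apply_chart (X j) (C.mem_source m hm))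
  have h2 := mfderiv_chart_mfderiv_inclusion hC hm v
  constructor
  · intro h
    exact AdaptedFrame.V_injective (C.mem_U m hm) (h2.symm.trans
      ((congrArg (mfderiv (𝓡 D) (𝓡 D) C.ψ (inclusion M m)) h).trans h1.symm))
  · intro h
    exact mfderiv_chart_injective C.ψ_mem (C.mem_source m hm)
      (h2.trans ((congrArg (C.F.V (C.ψ (inclusion M m))) h).trans h1))

theorem exists_mfderiv_inclusion_eq
    (hC : C.toChart ∈ IsManifold.maximalAtlas (𝓡 n) 2 M) {m : M} (hm : m ∈ C.toChart.source) (j : Fin q) :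
    ∃ v : TangentSpace (𝓡 n) m, mfderiv (𝓡 n) (𝓡 D) (inclusion M) m v = X j (inclusion M m) := by
  have h := (mdifferentiable_of_mem_maximalAtlas_two hC).comp_symm_deriv (C.toChart.map_source hm)
  rw [C.toChart.left_inv hm] at h
  exact ⟨_, (mfderiv_inclusion_eq_iff hC hm).2 (DFunLike.congr_fun h
    (C.F.π (chartField C.ψ (X j) (C.ψ (inclusion M m)))))⟩

theorem span_eq_top
    (hC : C.toChart ∈ IsManifold.maximalAtlas (𝓡 n) 2 M) {m : M} (hm : m ∈ C.toChart.source) {Y : Fin q → TangentSpace (𝓡 n) m}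
    (hY : ∀ j, mfderiv (𝓡 n) (𝓡 D) (inclusion M) m (Y j) = X j (inclusion M m)) :
    Submodule.span ℝ (Set.range Y) = ⊤ := by
  let f : TangentSpace (𝓡 n) m →ₗ[ℝ] EuclideanSpace ℝ (Fin n) :=
    ((mfderiv (𝓡 n) (𝓡 n) C.toChart m :
      TangentSpace (𝓡 n) m →L[ℝ] TangentSpace (𝓡 n) (C.toChart m)) :
      TangentSpace (𝓡 n) m →ₗ[ℝ] TangentSpace (𝓡 n) (C.toChart m))
  have hf : Function.Injective f := mfderiv_chart_injective hC hm
  have h1 : f '' Set.range Y =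
      Set.range fun j => C.F.π (chartField C.ψ (X j) (C.ψ (inclusion M m))) := by
    rw [← Set.range_comp]
    congr 1
    ext1 j
    exact (mfderiv_inclusion_eq_iff hC hm).1 (hY j)
  refine Submodule.map_injective_of_injective hf ?_
  rw [← Submodule.span_image, h1, AdaptedFrame.span_π_eq_top (C.mem_U m hm)]
  symm
  rw [Submodule.map_top, LinearMap.range_eq_top]
  have : FiniteDimensional ℝ (TangentSpace (𝓡 n) m) :=
    inferInstanceAs (FiniteDimensional ℝ (EuclideanSpace ℝ (Fin n)))
  exact (LinearMap.injective_iff_surjective_of_finrank_eq_finrank rfl).1 hf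

/-- In the leaf chart the lifted field is `u ↦ π(X_j(Θ u))`, with `X_j` of class `C^1` and `Θ` of
class `C^2`. -/
theorem contDiffAt_chartField
    (hC : C.toChart ∈ IsManifold.maximalAtlas (𝓡 n) 2 M) {Y : (m : M) → TangentSpace (𝓡 n) m} {j : Fin q}
    (hX : IsC1VectorField (X j))
    (hY : ∀ m, mfderiv (𝓡 n) (𝓡 D) (inclusion M) m (Y m) = X j (inclusion M m)) {m : M}
    (hm : m ∈ C.toChart.source) : ContDiffAt ℝ 1 (chartField C.toChart Y) (C.toChart m) := by
  have hu := C.toChart.map_source hm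
  have h1 : ContDiffAt ℝ 1 (fun u => C.F.π (chartField C.ψ (X j) (C.Θ u))) (C.toChart m) := by
    refine C.F.π.contDiff.contDiffAt.comp _ (ContDiffAt.comp (g := chartField C.ψ (X j)) _
      (hX.contDiffAt_chartField C.ψ_mem ?_) ((C.contDiffOn_Θ.contDiffAt (C.toChart.open_target.mem_nhds hu)).of_le (by norm_num)))
    rw [C.Θ_apply _ hu, C.toChart.left_inv hm]
    exact C.ψ.map_source (C.mem_source m hm)
  refine h1.congr_of_eventuallyEq ?_
  filter_upwards [C.toChart.open_target.mem_nhds hu] with u hu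
  rw [C.Θ_apply _ hu]
  exact (mfderiv_inclusion_eq_iff hC (C.toChart.map_target hu)).1 (hY _)

end LeafChart

theorem exists_chartedSpace_leafChart (h : ∀ p : M, ∃ C : LeafChart M n, p ∈ C.toChart.source) :
    ∃ (_ : ChartedSpace (EuclideanSpace ℝ (Fin n)) M) (_ : IsManifold (𝓡 n) 2 M),
      ∀ p : M, ∃ C : LeafChart M n, C.toChart ∈ IsManifold.maximalAtlas (𝓡 n) 2 M ∧
        p ∈ C.toChart.source := by
  choose C hC using h
  let i : ChartedSpace (EuclideanSpace ℝ (Fin n)) M :=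
    { atlas := Set.range fun p => (C p).toChart
      chartAt := fun p => (C p).toChart
      mem_chart_source := hC
      chart_mem_atlas := fun p => ⟨p, rfl⟩ }
  have i' : IsManifold (𝓡 n) 2 M := by
    refine isManifold_of_contDiffOn _ _ _ ?_
    rintro _ _ ⟨p, rfl⟩ ⟨p', rfl⟩
    simpa using LeafChart.contDiffOn_transition (C p) (C p')
  exact ⟨i, i', fun p => ⟨C p, IsManifold.subset_maximalAtlas ⟨p, rfl⟩, hC p⟩⟩

end LeafStructure

/-! ### Uniqueness of the structure -/

section Uniqueness

/-- One inequality is injectivity of the derivative. For the other, a locally Lipschitz map does not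
raise Hausdorff dimension, and its image here is open and nonempty. This takes the place of
invariance of domain. -/
theorem OpenPartialHomeomorph.finrank_eq_of_contDiffOn {E F : Type*} [NormedAddCommGroup E]
    [NormedSpace ℝ E] [FiniteDimensional ℝ E] [NormedAddCommGroup F] [NormedSpace ℝ F]
    [FiniteDimensional ℝ F] (g : OpenPartialHomeomorph E F) (hg : ContDiffOn ℝ 1 g g.source)
    {x : E} (hx : x ∈ g.source) (hinj : Function.Injective (fderiv ℝ g x)) :
    Module.finrank ℝ E = Module.finrank ℝ F := by
  apply le_antisymm
  · exact LinearMap.finrank_le_finrank_of_injective (f := (fderiv ℝ g x : E →ₗ[ℝ] F)) hinj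
  · have h1 : dimH (g '' g.source) ≤ dimH g.source :=
      dimH_image_le_of_locally_lipschitzOn fun y hy => by
        obtain ⟨K, t, ht, hK⟩ :=
          (hg.contDiffAt (g.open_source.mem_nhds hy)).exists_lipschitzOnWith
        exact ⟨K, t, mem_nhdsWithin_of_mem_nhds ht, hK⟩
    rw [g.image_source_eq_target, Real.dimH_of_nonempty_interior, Real.dimH_of_nonempty_interior]
      at h1
    · exact_mod_cast h1
    · exact ⟨x, by rwa [g.open_source.interior_eq]⟩
    · exact ⟨g x, by rw [g.open_target.interior_eq]; exact g.map_source hx⟩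

theorem OpenPartialHomeomorph.contDiffAt_symm_of_injective {E F : Type*} [NormedAddCommGroup E]
    [NormedSpace ℝ E] [FiniteDimensional ℝ E] [NormedAddCommGroup F] [NormedSpace ℝ F]
    [FiniteDimensional ℝ F] (g : OpenPartialHomeomorph E F) {k : ℕ∞ω} (hk : 1 ≤ k)
    (hg : ContDiffOn ℝ k g g.source) {x : E} (hx : x ∈ g.source)
    (hinj : Function.Injective (fderiv ℝ g x)) : ContDiffAt ℝ k g.symm (g x) := by
  have hdim := g.finrank_eq_of_contDiffOn (hg.of_le hk) hx hinj
  have hat := hg.contDiffAt (g.open_source.mem_nhds hx)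
  let e : E ≃L[ℝ] F := (LinearEquiv.ofInjectiveOfFinrankEq (fderiv ℝ g x : E →ₗ[ℝ] F) hinj
    hdim).toContinuousLinearEquiv
  have he : (e : E →L[ℝ] F) = fderiv ℝ g x := by ext v; rfl
  refine g.contDiffAt_symm (f₀' := e) (g.map_source hx) ?_ ?_
  · rw [he, g.left_inv hx]
    exact (hat.differentiableAt (one_pos.trans_le hk).ne').hasFDerivAt
  · rwa [g.left_inv hx]

variable {q D n n' : ℕ} {𝔐 : Type*} [TopologicalSpace 𝔐]
  [ChartedSpace (EuclideanSpace ℝ (Fin D)) 𝔐] [IsManifold (𝓡 D) 2 𝔐]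
  {X : VectorFields q D 𝔐} {x₀ : 𝔐} {M : Set (RhoFiniteSet X x₀)}
  [ChartedSpace (EuclideanSpace ℝ (Fin n)) M] [IsManifold (𝓡 n) 2 M]

/-- Leaf charts are restrictions of ambient maps; continuity of `f` for the topology of `M` is what
keeps it in a single leaf chart locally. -/
theorem contMDiff_of_contMDiff_inclusion_comp
    (h : ∀ p : M, ∃ C : LeafChart M n, C.toChart ∈ IsManifold.maximalAtlas (𝓡 n) 2 M ∧
      p ∈ C.toChart.source)
    {E H N : Type*} [NormedAddCommGroup E] [NormedSpace ℝ E]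
    [TopologicalSpace H] {I : ModelWithCorners ℝ E H} [TopologicalSpace N] [ChartedSpace H N]
    {f : N → M} (hfc : Continuous f) (hf : ContMDiff I (𝓡 D) 2 (inclusion M ∘ f)) :
    ContMDiff I (𝓡 n) 2 f := by
  intro x
  obtain ⟨C, hC, hx⟩ := h (f x)
  have h1 := (contMDiffOn_symm_of_mem_maximalAtlas hC).contMDiffAt
    (C.toChart.open_target.mem_nhds (C.toChart.map_source hx))
  refine (h1.comp x (C.contMDiffAt_chart_comp hx (hf x))).congr_of_eventuallyEq ?_
  filter_upwards [hfc.continuousAt.preimage_mem_nhds (C.toChart.open_source.mem_nhds hx)] with y hy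
  exact (C.toChart.left_inv hy).symm

/-- The inverse function theorem in charts. The dimensions are not assumed equal: this follows from
`e` being a homeomorphism with injective differential. -/
theorem contMDiff_symm_of_injective_mfderiv {N M : Type*} [TopologicalSpace N]
    [TopologicalSpace M] [ChartedSpace (EuclideanSpace ℝ (Fin n)) M] [IsManifold (𝓡 n) 2 M]
    [ChartedSpace (EuclideanSpace ℝ (Fin n')) N] [IsManifold (𝓡 n') 2 N] (e : N ≃ₜ M)
    (he : ContMDiff (𝓡 n') (𝓡 n) 2 e)
    (hinj : ∀ x, Function.Injective (mfderiv (𝓡 n') (𝓡 n) e x)) :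
    ContMDiff (𝓡 n) (𝓡 n') 2 e.symm := by
  intro p
  set φ := chartAt (EuclideanSpace ℝ (Fin n')) (e.symm p)
  set χ := chartAt (EuclideanSpace ℝ (Fin n)) p
  have hφ : φ ∈ IsManifold.maximalAtlas (𝓡 n') 2 N := IsManifold.chart_mem_maximalAtlas _
  have hχ : χ ∈ IsManifold.maximalAtlas (𝓡 n) 2 M := IsManifold.chart_mem_maximalAtlas _
  have hpφ : e.symm p ∈ φ.source := mem_chart_source _ _
  have hpχ : p ∈ χ.source := mem_chart_source _ _
  set g : OpenPartialHomeomorph (EuclideanSpace ℝ (Fin n')) (EuclideanSpace ℝ (Fin n)) :=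
    φ.symm ≫ₕ (e.toOpenPartialHomeomorph ≫ₕ χ) with hg
  have hgs : ∀ u, u ∈ g.source ↔ u ∈ φ.target ∧ e (φ.symm u) ∈ χ.source := fun u => by
    simp [hg]
  have hgc : ContDiffOn ℝ 2 g g.source := by
    intro u hu
    rw [hgs] at hu
    refine ContDiffAt.contDiffWithinAt (contMDiffAt_iff_contDiffAt.1 ?_)
    exact ContMDiffAt.comp (g := χ) (f := e ∘ φ.symm) (I' := 𝓡 n) u
      ((contMDiffOn_of_mem_maximalAtlas hχ).contMDiffAt (χ.open_source.mem_nhds hu.2)) ((he _).comp u ((contMDiffOn_symm_of_mem_maximalAtlas hφ).contMDiffAt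
        (φ.open_target.mem_nhds hu.1)))
  have hu : φ (e.symm p) ∈ g.source := by
    rw [hgs, φ.left_inv hpφ, e.apply_symm_apply]
    exact ⟨φ.map_source hpφ, hpχ⟩
  have hgp : g (φ (e.symm p)) = χ p := by
    change χ (e (φ.symm (φ (e.symm p)))) = χ p
    rw [φ.left_inv hpφ, e.apply_symm_apply]
  have hginj : Function.Injective (fderiv ℝ g (φ (e.symm p))) := by
    intro v w hvw
    rw [← mfderiv_eq_fderiv] at hvw
    have hd := mdifferentiable_of_mem_maximalAtlas_two hφ
    have hd' := mdifferentiable_of_mem_maximalAtlas_two hχ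
    have key : ∀ v : EuclideanSpace ℝ (Fin n'),
        mfderiv (𝓡 n') (𝓡 n) g (φ (e.symm p)) v =
          mfderiv (𝓡 n) (𝓡 n) χ (e (φ.symm (φ (e.symm p))))
            (mfderiv (𝓡 n') (𝓡 n) e (φ.symm (φ (e.symm p)))
              (mfderiv (𝓡 n') (𝓡 n') φ.symm (φ (e.symm p)) v)) := by
      intro v
      have h1 : MDifferentiableAt (𝓡 n') (𝓡 n') φ.symm (φ (e.symm p)) :=
        hd.mdifferentiableAt_symm (φ.map_source hpφ)
      have h2 : MDifferentiableAt (𝓡 n') (𝓡 n) e (φ.symm (φ (e.symm p))) :=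
        (he _).mdifferentiableAt two_ne_zero
      have h3 : MDifferentiableAt (𝓡 n) (𝓡 n) χ (e (φ.symm (φ (e.symm p)))) :=
        hd'.mdifferentiableAt ((hgs _).1 hu).2
      exact (mfderiv_comp_apply (φ (e.symm p)) h3 (h2.comp _ h1) v).trans
        (congrArg _ (mfderiv_comp_apply (φ (e.symm p)) h2 h1 v))
    have h4 := hinj _ (mfderiv_chart_injective hχ ((hgs _).1 hu).2
      ((key v).symm.trans (hvw.trans (key w))))
    exact (isInvertible_mfderiv_chart_symm hφ (φ.map_source hpφ)).injective h4
  have hsymm := g.contDiffAt_symm_of_injective (by norm_num) hgc hu hginj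
  rw [hgp] at hsymm
  have h1 : ContMDiffAt (𝓡 n) (𝓡 n') 2 (φ.symm ∘ (g.symm ∘ χ)) p := by
    refine ContMDiffAt.comp p ?_ (hsymm.contMDiffAt.comp p
      ((contMDiffOn_of_mem_maximalAtlas hχ).contMDiffAt (χ.open_source.mem_nhds hpχ)))
    refine (contMDiffOn_symm_of_mem_maximalAtlas hφ).contMDiffAt (φ.open_target.mem_nhds ?_)
    rw [Function.comp_apply, ← hgp, g.left_inv hu]
    exact φ.map_source hpφ
  refine h1.congr_of_eventuallyEq ?_
  filter_upwards [χ.open_source.mem_nhds hpχ,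
    e.symm.continuous.continuousAt.preimage_mem_nhds (φ.open_source.mem_nhds hpφ)] with y hy hy'
  change e.symm y = φ.symm (φ (e.symm (χ.symm (χ y))))
  rw [χ.left_inv hy, φ.left_inv hy']

/-- A `C^2` structure on `M` with the leaf charts is the only one for which the inclusion is an
immersion. -/
theorem exists_diffeomorph_of_leafCharts
    (h : ∀ p : M, ∃ C : LeafChart M n, C.toChart ∈ IsManifold.maximalAtlas (𝓡 n) 2 M ∧
      p ∈ C.toChart.source)
    {N : Type*} [TopologicalSpace N] [ChartedSpace (EuclideanSpace ℝ (Fin n')) N]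
    [IsManifold (𝓡 n') 2 N] (e : N ≃ₜ M)
    (he : IsC2InjectiveImmersion (n := n') (D := D) (inclusion M ∘ e)) :
    ∃ Φ : M ≃ₘ^2⟮𝓡 n, 𝓡 n'⟯ N, ∀ p, Φ p = e.symm p := by
  have he2 : ContMDiff (𝓡 n') (𝓡 n) 2 e :=
    contMDiff_of_contMDiff_inclusion_comp h e.continuous he.contMDiff
  have hinj : ∀ x, Function.Injective (mfderiv (𝓡 n') (𝓡 n) e x) := by
    intro x v w hvw
    obtain ⟨C, hC, hx⟩ := h (e x)
    have h1 : MDifferentiableAt (𝓡 n) (𝓡 D) (inclusion M) (e x) :=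
      (LeafChart.contMDiffAt_inclusion hC hx).mdifferentiableAt two_ne_zero
    have h2 : MDifferentiableAt (𝓡 n') (𝓡 n) e x := (he2 x).mdifferentiableAt two_ne_zero
    refine he.mfderiv_injective x ?_
    exact (mfderiv_comp_apply x h1 h2 v).trans ((congrArg _ hvw).trans
      (mfderiv_comp_apply x h1 h2 w).symm)
  exact ⟨⟨e.symm.toEquiv, contMDiff_symm_of_injective_mfderiv e he2 hinj, he2⟩, fun p => rfl⟩

end Uniqueness

/-! ### Constancy of the rank and conclusion -/

section Main

variable {q D : ℕ} {𝔐 : Type*} [TopologicalSpace 𝔐]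
  [ChartedSpace (EuclideanSpace ℝ (Fin D)) 𝔐] [IsManifold (𝓡 D) 2 𝔐]
  {X : VectorFields q D 𝔐} {x₀ : 𝔐} {M : Set (RhoFiniteSet X x₀)}

/-- The rank is constant on the open domain of each leaf chart, hence locally constant in the
topology of `M`. -/
theorem fieldRank_inclusion_eq (hMconn : IsConnected M)
    (h : ∀ p : M, ∃ C : LeafChart M (fieldRank X (inclusion M p)), p ∈ C.toChart.source)
    (p p' : M) : fieldRank X (inclusion M p) = fieldRank X (inclusion M p') := by
  have := isPreconnected_iff_preconnectedSpace.1 hMconn.isPreconnected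
  have hl : IsLocallyConstant fun m : M => fieldRank X (inclusion M m) := by
    refine (IsLocallyConstant.iff_exists_open _).2 fun m => ?_
    obtain ⟨C, hC⟩ := h m
    exact ⟨C.toChart.source, C.toChart.open_source, hC, fun y hy => C.fieldRank_eq hy⟩
  exact hl.apply_eq_of_preconnectedSpace p p'

end Main

end

theorem proposition3p1 {q D : ℕ} {𝔐 : Type*} [TopologicalSpace 𝔐] [T2Space 𝔐]
    [ChartedSpace (EuclideanSpace ℝ (Fin D)) 𝔐] [IsManifold (𝓡 D) 2 𝔐]
    (X : VectorFields q D 𝔐) (hX : ∀ j, IsC1VectorField (X j)) (x₀ : 𝔐)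
    (M : Set (RhoFiniteSet X x₀)) (hMopen : IsOpen M) (hMconn : IsConnected M)
    (hx₀ : RhoFiniteSet.base X x₀ ∈ M)
    (c : Fin q → Fin q → Fin q → M → ℝ) (hc : ∀ i j k, IsLocallyBounded (c i j k))
    (hbracket : ∀ i j, ∀ p : M, VectorField.mlieBracket (𝓡 D) (X i) (X j) (inclusion M p) =
      ∑ k, c i j k p • X k (inclusion M p)) :
    T2Space M ∧ SecondCountableTopology M ∧
    ∃ S : C2Structure M,
      IsC2InjectiveImmersion (n := S.dim) (D := D) (S.lift (inclusion M)) ∧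
      (∃ Y : VectorFields q S.dim S.Carrier,
        (∀ j, IsC1VectorField (Y j)) ∧
        (∀ j p, mfderiv (𝓡 S.dim) (𝓡 D) (S.lift (inclusion M)) p (Y j p) =
          X j (S.lift (inclusion M) p)) ∧
        ∀ p, Submodule.span ℝ (Set.range fun j => Y j p) = ⊤) ∧
      ∀ S' : C2Structure M,
        IsC2InjectiveImmersion (n := S'.dim) (D := D) (S'.lift (inclusion M)) →
        ∃ Φ : S.Carrier ≃ₘ^2⟮𝓡 S.dim, 𝓡 S'.dim⟯ S'.Carrier, ∀ p : M, Φ p = p := by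

  have hex : ∀ p : M, ∃ C : LeafChart M (fieldRank X (inclusion M p)), p ∈ C.toChart.source :=
    fun p => exists_leafChart hX hMopen hc hbracket p rfl
  refine ⟨t2Space_of_isC1VectorField hX,
    secondCountableTopology_of_leafCharts hMconn fun p => ⟨_, hex p⟩, ?_⟩
  obtain ⟨S, h⟩ : ∃ S : C2Structure M,
      let _ := S.charted
      ∀ p : M, ∃ C : LeafChart M S.dim,
        C.toChart ∈ IsManifold.maximalAtlas (𝓡 S.dim) 2 M ∧ p ∈ C.toChart.source := by
    -- The rank at `x₀` is the dimension; by connectedness leaf charts of this dimension exist at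
    -- every point.
    obtain ⟨i, i', h⟩ := exists_chartedSpace_leafChart
      (n := fieldRank X (inclusion M ⟨_, hx₀⟩)) fun p : M =>
        exists_leafChart hX hMopen hc hbracket p (fieldRank_inclusion_eq hMconn hex p _)
    exact ⟨@C2Structure.mk _ _ _ i i', h⟩
  let _ := S.charted
  have _ := S.isManifold
  have hY : ∀ j, ∀ p : M, ∃ v : TangentSpace (𝓡 S.dim) p,
      mfderiv (𝓡 S.dim) (𝓡 D) (inclusion M) p v = X j (inclusion M p) := fun j p =>
    let ⟨_, hC, hp⟩ := h p
    LeafChart.exists_mfderiv_inclusion_eq hC hp j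
  choose Y hY using hY
  refine ⟨S, ⟨inclusion_injective, fun p => ?_, fun p => ?_⟩,
    ⟨Y, fun j => isC1VectorField_of_chartField fun p => ?_, hY, fun p => ?_⟩, fun S' hS' => ?_⟩
  · obtain ⟨C, hC, hp⟩ := h p
    exact LeafChart.contMDiffAt_inclusion hC hp
  · obtain ⟨C, hC, hp⟩ := h p
    exact LeafChart.mfderiv_inclusion_injective hC hp
  · obtain ⟨C, hC, hp⟩ := h p
    exact ⟨C.toChart, hC, hp, LeafChart.contDiffAt_chartField hC (hX j) (hY j) hp⟩
  · obtain ⟨C, hC, hp⟩ := h p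
    exact LeafChart.span_eq_top hC hp fun j => hY j p
  · let e : S'.Carrier ≃ₜ M := Homeomorph.refl M
    exact exists_diffeomorph_of_leafCharts h e hS'
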